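/- Let $\mathbb{F}_q$ be a finite field of odd characteristic and $K=\mathbb{F}_q(t)$. For an integer $d\ge 3$ coprime to $q$ let $E_d/K$ be the Legendre elliptic curve $y^2=x(x+1)(x+t^d)$. Its Hasse–Weil $L$-function is the formal Euler product $$L(E_d/K,T)=\prod_{v\text{ good}}\bigl(1-a_vT^{\deg v}+q^{\deg v}T^{2\deg v}\bigr)^{-1}\prod_{v\text{ bad}}\bigl(1-a_vT^{\deg v}\bigr)^{-1}$$ over all places $v$ of $K$, where for $v$ of good reduction $a_v=q^{\deg v}+1-|\widetilde{E}_{d,v}(\mathbb{F}_v)|$, with $\mathbb{F}_v$ the residue field at $v$ and $\widetilde{E}_{d,v}$ the reduction of a minimal Weierstrass model at $v$, and $a_v=1,-1,0$ for split multiplicative, nonsplit multiplicative and additive reduction, respectively. Let $H(E_d/K)=q^{\frac1{12}\deg\Delta_{\min}(E_d/K)}$ be the exponential differential height, with $\Delta_{\min}$ the minimal discriminant divisor. Then $L(E_d/K,T)$ is a polynomial in $T$ with integer coefficients, and its special value $$L^*(E_d/K,1)=\left.\frac{L(E_d/K,T)}{(1-qT)^{\rho}}\right|_{T=q^{-1}},\qquad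 \rho=\operatorname{ord}_{T=q^{-1}}L(E_d/K,T),$$ is positive. Moreover, there is an effective absolute constant $A>0$ (one may take $A\le 48$), independent of $q$ and $d$, such that for all such $q$ and all integers $d\ge 3$ coprime to $q$, $$\frac{\log L^*(E_d/K,1)}{\log H(E_d/K)}\le A\cdot\frac{\log\log d}{\log d}.$$ -/

import Mathlib

open scoped Polynomial

namespace RatFuncEC

/-- The places of the rational function field `F(t)`, that is, the closed points of the projective
line over `F`: the finite places are the nonzero prime ideals of `F[t]`, and there is one more place
at infinity. -/
inductive Place (F : Type*) [Field F] where
  | finite (p : IsDedekindDomain.HeightOneSpectrum F[X]) : Place F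
  | infinity : Place F

namespace Place

variable {F : Type*} [Field F]

open scoped Classical in
/-- The normalized valuation at a place, written multiplicatively: the value at `f ≠ 0` is
`exp (-ord_v f)`. -/
noncomputable def valuation : Place F → Valuation (RatFunc F) (WithZero (Multiplicative ℤ))
  | finite p => p.valuation (RatFunc F)
  | infinity => RatFunc.inftyValuation F

/-- The order of vanishing at a place (with the convention `ord_v 0 = 0`). -/
noncomputable def ord (v : Place F) (f : RatFunc F) : ℤ :=
  -WithZero.log (v.valuation f)

/-- The degree of a place: the degree of its residue field over `F`. -/
noncomputable def degree : Place F → ℕ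
  | finite p => Module.finrank F (F[X] ⧸ p.asIdeal)
  | infinity => 1

/-- The valuation ring at a place. -/
noncomputable abbrev ring (v : Place F) : ValuationSubring (RatFunc F) :=
  v.valuation.valuationSubring

theorem exists_valuation_eq (v : Place F) :
    ∃ f : RatFunc F, v.valuation f = WithZero.exp (-1 : ℤ) := by
  cases v with
  | finite p => exact p.valuation_exists_uniformizer (RatFunc F)
  | infinity => exact ⟨1 / RatFunc.X, by classical exact RatFunc.inftyValuation.X_inv F⟩

instance (v : Place F) : v.valuation.IsNontrivial := by
  obtain ⟨f, hf⟩ := v.exists_valuation_eq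
  refine ⟨f, ?_, ?_⟩
  · rw [hf]; exact WithZero.exp_ne_zero
  · rw [hf, ← WithZero.exp_zero]
    exact fun h => by simpa using WithZero.exp_injective h

instance (v : Place F) : IsDiscreteValuationRing v.ring :=
  v.valuation.valuationSubring_isDiscreteValuationRing

end Place

variable {F : Type*} [Field F]

/-- The Euler factor of a Weierstrass curve `W` over `F(t)` at a place `v`, as a power series in `T`:
the inverse of the local polynomial of a minimal model of `W` at `v`, evaluated at `T ^ deg v`.
The local polynomial is `1 - a_v T + q_v T ^ 2` at the places of good reduction, and `1 - T`,
`1 + T`, `1` at the places of split multiplicative, nonsplit multiplicative, and additive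
reduction. -/
noncomputable def eulerFactor (W : WeierstrassCurve (RatFunc F)) (v : Place F) : PowerSeries ℤ :=
  PowerSeries.invOfUnit
    ((Polynomial.expand ℤ v.degree (W.localPolynomial v.ring) : ℤ[X]) : PowerSeries ℤ) 1

/-- The Hasse-Weil `L`-function of a Weierstrass curve `W` over `F(t)`, with `F` finite: the formal
Euler product of the local factors over all places. The factor at `v` is congruent to `1` modulo
`T ^ deg v`, so only the (finitely many) places of degree at most `n` contribute to the
coefficient of `T ^ n`. -/
noncomputable def lFunction (W : WeierstrassCurve (RatFunc F)) : PowerSeries ℤ :=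
  PowerSeries.mk fun n =>
    PowerSeries.coeff n (∏ᶠ (v : Place F) (_ : v.degree ≤ n), eulerFactor W v)

/-- The special value at `T = 1 / q` of a polynomial `L(T)`: the value there of
`L(T) / (1 - q T) ^ ρ`, where `ρ` is the order of vanishing of `L(T)` at `T = 1 / q`. -/
noncomputable def specialValue (q : ℕ) (L : ℤ[X]) : ℝ :=
  let P : ℝ[X] := L.map (Int.castRingHom ℝ)
  (P / (1 - Polynomial.C (q : ℝ) * Polynomial.X) ^ P.rootMultiplicity (q : ℝ)⁻¹).eval (q : ℝ)⁻¹

/-- The degree of the minimal discriminant divisor of a Weierstrass curve over `F(t)`. -/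
noncomputable def minimalDiscriminantDegree (W : WeierstrassCurve (RatFunc F)) : ℤ :=
  ∑ᶠ v : Place F, v.ord (W.minimal v.ring).Δ * (v.degree : ℤ)

/-- The exponential differential height `q ^ (deg Δ_min / 12)` of a Weierstrass curve over `F(t)`,
with `q` the cardinality of `F`. -/
noncomputable def height (W : WeierstrassCurve (RatFunc F)) : ℝ :=
  (Nat.card F : ℝ) ^ ((minimalDiscriminantDegree W : ℝ) / 12)

variable (F) in
/-- The Legendre curve `y ^ 2 = x (x + 1) (x + t ^ d)` over `F(t)`, that is,
`y ^ 2 = x ^ 3 + (1 + t ^ d) x ^ 2 + t ^ d x`. -/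
noncomputable def legendreCurve (d : ℕ) : WeierstrassCurve (RatFunc F) where
  a₁ := 0
  a₂ := 1 + RatFunc.X ^ d
  a₃ := 0
  a₄ := RatFunc.X ^ d
  a₆ := 0

end RatFuncEC

namespace RatFuncEC

open Polynomial Finset

/-! The `L`-function is computed explicitly as a product of factors `1 - j T ^ u`, whose
coefficients are squares of Jacobi sums; the special value is then bounded factor by factor.

Let `S_K(c)` be the sum of the quadratic character of a finite field `K` over the values of `x (x +
1) (x + c)`. At every finite place, good or bad, the local polynomial is `1 + S T + ε T ^ 2`, where
`ε` is the residue cardinality or `0`. It is also the generating series, over monic polynomials `g`,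
of the quadratic character of `g(0) g(1) g(c)`. Its logarithmic derivative therefore has
coefficients `S_K(c)` for `K` running over extensions of the residue field
(`mk_sum_monics_legendreHom`, `primePowerSum_legendreHom`). Summing over places, the `n`-th
coefficient for `L` is `[d even] - ∑ S_K(θ ^ d)` over `θ` in `K = F_{q^n}`, the first term coming
from infinity (`logDeriv_lFunction_legendreCurve`).

Detecting `d`-th powers by characters `χ_m`, with `m` modulo `d`, and using `∑ χ(z) S_K(z) = J(χ) ^
2`, one gets a sum of squared Jacobi sums (`sum_legendreSum_pow`). Classes with `2 m = 0` cancel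
against the contributions of `θ = 0` and of infinity. By the Hasse-Davenport relation the other
classes contribute powers of one number `j_m` depending only on the orbit of `m` under
multiplication by `q`. Hence `L` is the product over orbits of `1 - j T ^ u`, with `u` the orbit
length and `|j| = q ^ u` (`exists_polynomial_lFunction`).

At `T = 1 / q` a factor either has absolute value at most `2`, or equals `1 - (q T) ^ u` and leaves
`u` once `1 - q T` is removed. So `log L*` is at most the sum over classes of `log max(2, u) / u`.
Positivity holds because `L` is real, equals `1` at `0` and has no zero in `[0, 1 / q)`
(`specialValue_pos_and_le`).

Few classes have short orbits: at most `U q ^ U` have length at most `U`. Choosing `U` so that `q ^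
U` is about `√d` gives the bound `8 d log q · log log d / log d` (`sum_log_max_two_div_le`). The
place `t = 0` alone shows `log H ≥ (d / 6) log q`, whence the constant `48 = 8 · 6`. -/

theorem coeff_X_mul_derivative {R : Type*} [CommRing R] (f : PowerSeries R) (n : ℕ) :
    PowerSeries.coeff n (PowerSeries.X * PowerSeries.derivative R f) =
      (n : R) * PowerSeries.coeff n f := by
  cases n with
  | zero => simp
  | succ n =>
    rw [PowerSeries.coeff_succ_X_mul, PowerSeries.coeff_derivative]
    push_cast
    ring

/-! ### Euler products over monic polynomials, in logarithmic form -/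

section MonicSums

variable (k : Type*) [Field k] [Finite k]

theorem finite_monic_natDegree (n : ℕ) : {g : k[X] | g.Monic ∧ g.natDegree = n}.Finite := by
  have : Finite (degreeLT k (n + 1)) := Finite.of_equiv _ (degreeLTEquiv k (n + 1)).symm.toEquiv
  refine Set.Finite.subset (Set.toFinite (degreeLT k (n + 1) : Set k[X])) ?_
  rintro g ⟨-, hg⟩
  simp only [SetLike.mem_coe, mem_degreeLT]
  exact lt_of_le_of_lt degree_le_natDegree (by rw [hg]; exact_mod_cast Nat.lt_succ_self n)

/-- The monic polynomials of degree `n` over a finite field. -/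
noncomputable def monics (n : ℕ) : Finset k[X] := (finite_monic_natDegree k n).toFinset

open scoped Classical in
/-- The monic irreducible polynomials of degree `n` over a finite field. -/
noncomputable def irreds (n : ℕ) : Finset k[X] := (monics k n).filter Irreducible

variable {k}

@[simp] theorem mem_monics {n : ℕ} {g : k[X]} : g ∈ monics k n ↔ g.Monic ∧ g.natDegree = n := by
  simp [monics]

@[simp] theorem mem_irreds {n : ℕ} {g : k[X]} :
    g ∈ irreds k n ↔ g.Monic ∧ g.natDegree = n ∧ Irreducible g := by
  simp [irreds, and_assoc]

/-- Compare degrees in the prime factorization of `g`. Weighted by `Φ g` and summed over `g`, this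
identity becomes the logarithmic derivative of the Euler product. -/
theorem sum_count_normalizedFactors [DecidableEq k] {n : ℕ} {g : k[X]} (hg : g ∈ monics k n) :
    ∑ i ∈ Icc 1 n, ∑ π ∈ irreds k i,
      i * (UniqueFactorizationMonoid.normalizedFactors g).count π = n := by
  obtain ⟨hm, hn⟩ := mem_monics.1 hg
  set s := UniqueFactorizationMonoid.normalizedFactors g with hs
  have hprod : s.prod = g := by
    rw [hs, UniqueFactorizationMonoid.prod_normalizedFactors_eq hm.ne_zero, hm.normalize_eq_self]
  have hmon : ∀ π ∈ s, π.Monic := fun π hπ => by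
    have := UniqueFactorizationMonoid.normalize_normalized_factor π hπ
    rw [← this]
    exact monic_normalize (UniqueFactorizationMonoid.irreducible_of_normalized_factor π hπ).ne_zero
  have hdeg : (s.map natDegree).sum = n := by
    rw [← natDegree_multiset_prod_of_monic s hmon, hprod, hn]
  rw [Finset.sum_multiset_map_count] at hdeg
  rw [Finset.sum_sigma']
  refine Eq.trans ?_ hdeg
  symm
  refine Finset.sum_of_injOn (fun π => (⟨π.natDegree, π⟩ : (_ : ℕ) × k[X])) ?_ ?_ ?_ ?_
  · intro a _ b _ h
    simp only [Sigma.mk.injEq] at h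
    exact eq_of_heq h.2
  · intro π hπ
    have hπ' : π ∈ s := by simpa using hπ
    have hirr := UniqueFactorizationMonoid.irreducible_of_normalized_factor π hπ'
    have hdvd : π ∣ g := UniqueFactorizationMonoid.dvd_of_mem_normalizedFactors hπ'
    simp only [coe_sigma, Set.mem_sigma_iff, mem_coe, mem_Icc, mem_irreds]
    exact ⟨⟨hirr.natDegree_pos, hn ▸ natDegree_le_of_dvd hdvd hm.ne_zero⟩, hmon π hπ', trivial, hirr⟩
  · rintro ⟨i, π⟩ h hnot
    simp only [mem_sigma, mem_Icc, mem_irreds] at h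
    have : π ∉ s := fun hmem => hnot ⟨π, by simpa using hmem, by simp [h.2.2.1]⟩
    simp [Multiset.count_eq_zero_of_notMem this]
  · intro π _
    simp [mul_comm]

theorem count_normalizedFactors_eq_sum [DecidableEq k] {n : ℕ} {g π : k[X]}
    [∀ a, Decidable (π ^ a ∣ g)]
    (hg : g ∈ monics k n) (hm : π.Monic) (hπ : Irreducible π) :
    (UniqueFactorizationMonoid.normalizedFactors g).count π =
      ∑ a ∈ Icc 1 n, if π ^ a ∣ g then 1 else 0 := by
  obtain ⟨hgm, hn⟩ := mem_monics.1 hg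
  have key : ∀ a, π ^ a ∣ g ↔
      a ≤ (UniqueFactorizationMonoid.normalizedFactors g).count π := fun a => by
    rw [pow_dvd_iff_le_emultiplicity,
      UniqueFactorizationMonoid.emultiplicity_eq_count_normalizedFactors hπ hgm.ne_zero,
      hm.normalize_eq_self, Nat.cast_le]
  have hle : (UniqueFactorizationMonoid.normalizedFactors g).count π ≤ n := by
    have := natDegree_le_of_dvd ((key _).2 le_rfl) hgm.ne_zero
    rw [natDegree_pow, hn] at this
    exact (Nat.le_mul_of_pos_right _ hπ.natDegree_pos).trans this
  rw [Finset.sum_ite, Finset.sum_const_zero, add_zero, Finset.sum_const, smul_eq_mul, mul_one]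
  have : (Icc 1 n).filter (fun a => π ^ a ∣ g) =
      Icc 1 ((UniqueFactorizationMonoid.normalizedFactors g).count π) := by
    ext a
    simp only [mem_filter, mem_Icc, key]
    omega
  rw [this]; simp

variable {R : Type*} [CommRing R] (Φ : k[X] →* R)

theorem sum_monics_dvd {n m : ℕ} {h : k[X]} (hh : h ∈ monics k m) [DecidablePred (h ∣ ·)] :
    ∑ g ∈ monics k n with h ∣ g, Φ g =
      if m ≤ n then Φ h * ∑ g ∈ monics k (n - m), Φ g else 0 := by
  obtain ⟨hm, hdeg⟩ := mem_monics.1 hh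
  split_ifs with hmn
  · rw [Finset.mul_sum]
    symm
    refine Finset.sum_bij (fun g _ => h * g) ?_ ?_ ?_ ?_
    · intro g hg
      obtain ⟨hg1, hg2⟩ := mem_monics.1 hg
      simp only [mem_filter, mem_monics, dvd_mul_right, and_true]
      exact ⟨hm.mul hg1, by rw [hm.natDegree_mul hg1, hdeg, hg2]; omega⟩
    · intro a _ b _ hab
      exact mul_left_cancel₀ hm.ne_zero hab
    · intro g hg
      simp only [mem_filter, mem_monics] at hg
      obtain ⟨⟨hg1, hg2⟩, c, rfl⟩ := hg
      have hc : c.Monic := hm.of_mul_monic_left hg1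
      refine ⟨c, ?_, rfl⟩
      rw [hm.natDegree_mul hc] at hg2
      exact mem_monics.2 ⟨hc, by omega⟩
    · intro g _
      rw [map_mul]
  · refine Finset.sum_eq_zero fun g hg => ?_
    simp only [mem_filter, mem_monics] at hg
    exact absurd (natDegree_le_of_dvd hg.2 hg.1.1.ne_zero) (by omega)

/-- Reindexing by `j = a * i`: a prime power `π ^ a` with `deg π = i` has degree `j`. -/
theorem sum_divisors_Icc {M : Type*} [AddCommMonoid M] (n : ℕ) (f : ℕ → ℕ → M) :
    ∑ j ∈ Icc 1 n, ∑ i ∈ j.divisors, f i (j / i) =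
      ∑ i ∈ Icc 1 n, ∑ a ∈ Icc 1 n, if a * i ≤ n then f i a else 0 := by
  rw [Finset.sum_sigma', ← Finset.sum_product', ← Finset.sum_filter]
  refine Finset.sum_bij' (fun x _ => (x.2, x.1 / x.2)) (fun y _ => ⟨y.2 * y.1, y.1⟩) ?_ ?_ ?_ ?_ ?_
  · rintro ⟨j, i⟩ h
    simp only [mem_sigma, mem_Icc, Nat.mem_divisors, mem_filter, mem_product] at h ⊢
    obtain ⟨⟨h1, h2⟩, ⟨c, rfl⟩, h3⟩ := h
    have hi : 0 < i := Nat.pos_of_ne_zero (by rintro rfl; simp at h3)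
    have hc : 0 < c := Nat.pos_of_ne_zero (by rintro rfl; simp at h3)
    rw [Nat.mul_div_cancel_left _ hi]
    refine ⟨⟨⟨hi, ?_⟩, hc, ?_⟩, by rw [mul_comm]; exact h2⟩ <;> nlinarith
  · rintro ⟨i, a⟩ h
    simp only [mem_sigma, mem_Icc, Nat.mem_divisors, mem_filter, mem_product] at h ⊢
    obtain ⟨⟨⟨h1, h2⟩, h3, h4⟩, h5⟩ := h
    exact ⟨⟨Nat.mul_pos h3 h1, h5⟩, Dvd.intro_left a rfl, by positivity⟩
  · rintro ⟨j, i⟩ h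
    simp only [mem_sigma, Nat.mem_divisors] at h
    simp [Nat.div_mul_cancel h.2.1]
  · rintro ⟨i, a⟩ h
    simp only [mem_Icc, mem_filter, mem_product] at h
    simp [Nat.mul_div_cancel a (by omega : 0 < i)]
  · rintro ⟨j, i⟩ h
    rfl

/-- The logarithmic-derivative coefficients of the Euler product attached to a completely
multiplicative function on monic polynomials. -/
noncomputable def primePowerSum (j : ℕ) : R :=
  ∑ i ∈ j.divisors, ∑ π ∈ irreds k i, (i : R) * Φ π ^ (j / i)

/-- Multiply the degree identity by `Φ g`, write the multiplicity of `π` as the number of `a ≥ 1`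
with `π ^ a ∣ g`, and pull `Φ π ^ a` out of the sum over multiples of `π ^ a`. No infinite product
is needed. -/
theorem natCast_mul_sum_monics (n : ℕ) :
    (n : R) * ∑ g ∈ monics k n, Φ g =
      ∑ j ∈ Icc 1 n, primePowerSum Φ j * ∑ g ∈ monics k (n - j), Φ g := by
  classical
  have h1 : ∀ g ∈ monics k n, (n : R) * Φ g = ∑ i ∈ Icc 1 n, ∑ a ∈ Icc 1 n,
      ∑ π ∈ irreds k i, if π ^ a ∣ g then (i : R) * Φ g else 0 := fun g hg => by
    conv_lhs => rw [← sum_count_normalizedFactors hg]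
    push_cast
    rw [Finset.sum_mul]
    refine Finset.sum_congr rfl fun i _ => ?_
    rw [Finset.sum_comm, Finset.sum_mul]
    refine Finset.sum_congr rfl fun π hπ => ?_
    obtain ⟨hm, -, hirr⟩ := mem_irreds.1 hπ
    rw [count_normalizedFactors_eq_sum hg hm hirr]
    push_cast
    rw [Finset.mul_sum, Finset.sum_mul]
    refine Finset.sum_congr rfl fun a _ => ?_
    split_ifs <;> simp
  have h2 : ∀ j ∈ Icc 1 n, primePowerSum Φ j * ∑ g ∈ monics k (n - j), Φ g =
      ∑ i ∈ j.divisors, ∑ π ∈ irreds k i,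
        (i : R) * Φ π ^ (j / i) * ∑ g ∈ monics k (n - (j / i) * i), Φ g := fun j _ => by
    rw [primePowerSum, Finset.sum_mul]
    refine Finset.sum_congr rfl fun i hi => ?_
    rw [Finset.sum_mul, Nat.div_mul_cancel (Nat.dvd_of_mem_divisors hi)]
  rw [Finset.sum_congr rfl h2, sum_divisors_Icc n (fun i a => ∑ π ∈ irreds k i,
    (i : R) * Φ π ^ a * ∑ g ∈ monics k (n - a * i), Φ g), Finset.mul_sum,
    Finset.sum_congr rfl h1, Finset.sum_comm]
  refine Finset.sum_congr rfl fun i _ => ?_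
  rw [Finset.sum_comm]
  refine Finset.sum_congr rfl fun a _ => ?_
  rw [Finset.sum_comm]
  have h3 : ∀ π ∈ irreds k i, (∑ g ∈ monics k n, if π ^ a ∣ g then (i : R) * Φ g else 0) =
      if a * i ≤ n then (i : R) * Φ π ^ a * ∑ g ∈ monics k (n - a * i), Φ g else 0 := fun π hπ => by
    obtain ⟨hm, hdeg, -⟩ := mem_irreds.1 hπ
    rw [← Finset.sum_filter, ← Finset.mul_sum, sum_monics_dvd Φ (h := π ^ a) (m := a * i)
      (mem_monics.2 ⟨hm.pow a, by rw [natDegree_pow, hdeg]⟩), map_pow]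
    split_ifs <;> ring
  rw [Finset.sum_congr rfl h3]
  split_ifs <;> simp

/-- The generating series of the sums of `Φ` over monic polynomials satisfies the logarithmic
derivative form of its Euler product. -/
theorem X_mul_derivative_mk_sum_monics :
    PowerSeries.X * PowerSeries.derivative R (PowerSeries.mk fun n => ∑ g ∈ monics k n, Φ g) =
      PowerSeries.mk (primePowerSum Φ) * PowerSeries.mk fun n => ∑ g ∈ monics k n, Φ g := by
  ext n
  rw [coeff_X_mul_derivative, PowerSeries.coeff_mk, natCast_mul_sum_monics, PowerSeries.coeff_mul,
    Finset.Nat.sum_antidiagonal_eq_sum_range_succ_mk]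
  simp only [PowerSeries.coeff_mk]
  refine Finset.sum_subset (fun j hj => ?_) fun j hj hj' => ?_
  · rw [mem_Icc] at hj
    exact mem_range.2 (by omega)
  · rw [mem_range] at hj
    rw [mem_Icc] at hj'
    obtain rfl : j = 0 := by omega
    simp [primePowerSum]

/-- When its degree divides `[K : k]`, `π` divides the split polynomial `X ^ #K - X`; being
separable, it has `deg π` distinct roots in `K`. -/
theorem card_filter_minpoly_eq {K : Type*} [Field K] [Fintype K] [Algebra k K] {i : ℕ} {π : k[X]}
    (hπ : π ∈ irreds k i) (hi : i ∣ Module.finrank k K) [DecidablePred fun θ : K => minpoly k θ = π] :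
    #{θ : K | minpoly k θ = π} = i := by
  obtain ⟨hm, hdeg, hirr⟩ := mem_irreds.1 hπ
  have hsep : π.Separable := PerfectField.separable_of_irreducible hirr
  have hsplits : (π.map (algebraMap k K)).Splits := by
    have h := (hirr.natDegree_dvd_iff_dvd_X_pow_card_pow_sub_X (n := Module.finrank k K)).1
      (hdeg ▸ hi)
    rw [← Module.natCard_eq_pow_finrank, Nat.card_eq_fintype_card] at h
    refine Splits.of_dvd (IsSplittingField.splits K (X ^ Fintype.card K - X : k[X])) ?_
      (map_dvd (algebraMap k K) h)
    exact map_ne_zero (FiniteField.X_pow_card_sub_X_ne_zero _ Fintype.one_lt_card)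
  rw [← hdeg, ← card_rootSet_eq_natDegree hsep hsplits, ← Set.toFinset_card]
  congr 1
  ext θ
  simp only [mem_filter, mem_univ, true_and, Set.mem_toFinset, mem_rootSet, hm.ne_zero, ne_eq,
    not_false_eq_true]
  constructor
  · rintro rfl
    exact minpoly.aeval k θ
  · intro h
    exact (minpoly.eq_of_irreducible_of_monic hirr h hm).symm

theorem sum_minpoly {K M : Type*} [Field K] [Fintype K] [Algebra k K] [AddCommMonoid M]
    (ψ : k[X] → M) :
    ∑ θ : K, ψ (minpoly k θ) =
      ∑ i ∈ (Module.finrank k K).divisors, ∑ π ∈ irreds k i, i • ψ π := by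
  classical
  rw [Finset.sum_sigma', ← Finset.sum_fiberwise_of_maps_to
    (g := fun θ : K => (⟨(minpoly k θ).natDegree, minpoly k θ⟩ : (_ : ℕ) × k[X]))]
  · refine Finset.sum_congr rfl fun ⟨i, π⟩ h => ?_
    simp only [mem_sigma, Nat.mem_divisors] at h
    obtain rfl := (mem_irreds.1 h.2).2.1
    conv_rhs => rw [← card_filter_minpoly_eq h.2 h.1.1 (K := K), ← Finset.sum_const]
    refine Finset.sum_congr ?_ ?_
    · ext θ
      simp only [Sigma.mk.injEq, mem_filter, mem_univ, true_and]
      constructor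
      · exact fun h => eq_of_heq h.2
      · rintro rfl
        exact ⟨rfl, HEq.rfl⟩
    · intro θ hθ
      rw [(mem_filter.1 hθ).2]
  · intro θ _
    have hint : IsIntegral k θ := Algebra.IsIntegral.isIntegral θ
    simp only [mem_sigma, Nat.mem_divisors, mem_irreds]
    exact ⟨⟨minpoly.degree_dvd hint, Module.finrank_pos.ne'⟩, minpoly.monic hint, trivial,
      minpoly.irreducible hint⟩

theorem primePowerSum_eq_sum_minpoly (K : Type*) [Field K] [Fintype K] [Algebra k K] :
    primePowerSum Φ (Module.finrank k K) =
      ∑ θ : K, Φ (minpoly k θ) ^ (Module.finrank k K / (minpoly k θ).natDegree) := by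
  rw [sum_minpoly fun π => Φ π ^ (Module.finrank k K / π.natDegree), primePowerSum]
  refine Finset.sum_congr rfl fun i _ => Finset.sum_congr rfl fun π hπ => ?_
  rw [(mem_irreds.1 hπ).2.1, nsmul_eq_mul]

omit [Finite k] in
-- The constant term of the minimal polynomial of `θ - r` is, up to sign, its norm from `k(θ)`; the
-- exponent `[K : k(θ)]` turns this into the norm from `K`, and the signs cancel against `N(-1)`.
theorem eval_minpoly_pow {K : Type*} [Field K] [Finite K] [Algebra k K] (θ : K) (r : k) :
    (minpoly k θ).eval r ^ (Module.finrank k K / (minpoly k θ).natDegree) =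
      Algebra.norm k (algebraMap k K r - θ) := by
  have hk : Finite k := Finite.of_injective _ (algebraMap k K).injective
  have hint : IsIntegral k θ := Algebra.IsIntegral.isIntegral θ
  have hint' : IsIntegral k (θ - algebraMap k K r) := Algebra.IsIntegral.isIntegral _
  have hdeg : (minpoly k (θ - algebraMap k K r)).natDegree = (minpoly k θ).natDegree := by
    rw [minpoly.sub_algebraMap, natDegree_comp, natDegree_X_add_C, mul_one]
  have hrank : (minpoly k θ).natDegree *
      Module.finrank (IntermediateField.adjoin k {θ - algebraMap k K r}) K =
        Module.finrank k K := by
    rw [← hdeg, ← IntermediateField.adjoin.finrank hint', Module.finrank_mul_finrank]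
  have hpos : 0 < (minpoly k θ).natDegree := minpoly.natDegree_pos hint
  have h1 : Algebra.norm k (θ - algebraMap k K r) =
      ((-1) ^ (minpoly k θ).natDegree * (minpoly k θ).eval r) ^
        (Module.finrank k K / (minpoly k θ).natDegree) := by
    rw [Algebra.norm_eq_norm_adjoin k (θ - algebraMap k K r),
      ← IntermediateField.adjoin.powerBasis_gen hint',
      Algebra.PowerBasis.norm_gen_eq_coeff_zero_minpoly,
      IntermediateField.adjoin.powerBasis_gen hint', IntermediateField.adjoin.powerBasis_dim,
      IntermediateField.minpoly_gen, hdeg, minpoly.sub_algebraMap, ← hrank,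
      Nat.mul_div_cancel_left _ hpos, coeff_zero_eq_eval_zero, eval_comp]
    simp
  rw [← neg_sub, ← neg_one_mul, map_mul, h1, mul_pow, ← pow_mul, ← hrank,
    Nat.mul_div_cancel_left _ hpos, ← mul_assoc]
  have h2 : Algebra.norm k (-1 : K) = (-1) ^ Module.finrank k K := by
    rw [← Algebra.norm_algebraMap (-1 : k), map_neg (algebraMap k K), map_one]
  rw [h2, ← hrank, ← mul_pow]
  simp

end MonicSums
end RatFuncEC

namespace RatFuncEC

open Polynomial Finset

/-! ### Vanishing of character sums and the Hasse-Davenport relation -/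

section CharacterSums

variable {k : Type*} [Field k]

/-- The completely multiplicative function `g ↦ χ (g r)` on polynomials. -/
noncomputable def evalChar {R : Type*} [CommRing R] (χ : MulChar k R) (r : k) : k[X] →* R :=
  χ.toMonoidHom.comp (evalRingHom r).toMonoidHom

@[simp] theorem evalChar_apply {R : Type*} [CommRing R] (χ : MulChar k R) (r : k) (g : k[X]) :
    evalChar χ r g = χ (g.eval r) := rfl

variable [Finite k]

/-- The permutation `g ↦ g + (a - 1) g(r) ℓ` of the monic polynomials of degree `n` multiplies
`g(r)` by `a` and leaves `Ψ` unchanged, so the sum equals `χ a` times itself; take `a` with `χ a ≠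
1`. -/
theorem sum_monics_eq_zero {R : Type*} [CommRing R] [IsDomain R] {χ : MulChar k R} (hχ : χ ≠ 1)
    (r : k) {n : ℕ} {ℓ : k[X]} (hdeg : ℓ.degree < n) (hℓ : ℓ.eval r = 1) {Ψ : k[X] → R}
    (hΨ : ∀ g a, Ψ (g + C a * ℓ) = Ψ g) :
    ∑ g ∈ monics k n, χ (g.eval r) * Ψ g = 0 := by
  obtain ⟨a, ha⟩ := MulChar.ne_one_iff.1 hχ
  have hmem : ∀ g ∈ monics k n, ∀ b, g + C b * ℓ ∈ monics k n := fun g hg b => by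
    obtain ⟨hm, hn⟩ := mem_monics.1 hg
    have hlt : (C b * ℓ).degree < g.degree := by
      rw [degree_eq_natDegree hm.ne_zero, hn]
      refine lt_of_le_of_lt ?_ hdeg
      rw [← smul_eq_C_mul]
      exact degree_smul_le b ℓ
    exact mem_monics.2 ⟨hm.add_of_left hlt, by rw [natDegree_add_eq_left_of_degree_lt hlt, hn]⟩
  have key : χ a * ∑ g ∈ monics k n, χ (g.eval r) * Ψ g =
      ∑ g ∈ monics k n, χ (g.eval r) * Ψ g := by
    rw [Finset.mul_sum]
    refine Finset.sum_bij' (fun g _ => g + C ((a - 1) * g.eval r) * ℓ)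
      (fun g _ => g + C (((a⁻¹ : kˣ) - 1) * g.eval r) * ℓ) ?_ ?_ ?_ ?_ ?_
    · exact fun g hg => hmem g hg _
    · exact fun g hg => hmem g hg _
    · intro g _
      simp only [eval_add, eval_mul, eval_C, hℓ, mul_one, add_assoc, ← add_mul, ← C_add]
      rw [add_eq_left, show ((a : k) - 1) * g.eval r + (((a⁻¹ : kˣ) : k) - 1) *
        (g.eval r + (a - 1) * g.eval r) = (((a⁻¹ : kˣ) : k) * a - 1) * g.eval r by ring]
      simp
    · intro g _
      simp only [eval_add, eval_mul, eval_C, hℓ, mul_one, add_assoc, ← add_mul, ← C_add]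
      rw [add_eq_left, show (((a⁻¹ : kˣ) : k) - 1) * g.eval r + ((a : k) - 1) *
        (g.eval r + (((a⁻¹ : kˣ) : k) - 1) * g.eval r) =
          (((a⁻¹ : kˣ) : k) * a - 1) * g.eval r by ring]
      simp
    · intro g _
      rw [hΨ, ← mul_assoc, ← map_mul]
      congr 2
      simp only [eval_add, eval_mul, eval_C, hℓ]
      ring
  have h := sub_eq_zero.2 key
  rw [← sub_one_mul] at h
  exact (mul_eq_zero.1 h).resolve_left (sub_ne_zero.2 ha)

theorem sum_monics_zero {R : Type*} [CommRing R] (f : k[X] → R) : ∑ g ∈ monics k 0, f g = f 1 := by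
  have : monics k 0 = {1} := by
    ext g
    rw [mem_monics, mem_singleton]
    exact ⟨fun h => h.1.natDegree_eq_zero.1 h.2, by rintro rfl; simp⟩
  rw [this, sum_singleton]

theorem sum_monics_one [Fintype k] {R : Type*} [CommRing R] (f : k[X] → R) :
    ∑ g ∈ monics k 1, f g = ∑ x : k, f (X + C x) := by
  symm
  refine Finset.sum_bij (fun x _ => X + C x) ?_ ?_ ?_ ?_
  · exact fun x _ => mem_monics.2 ⟨monic_X_add_C x, natDegree_X_add_C x⟩
  · intro x _ y _ h
    simpa using h
  · intro g hg
    obtain ⟨hm, hn⟩ := mem_monics.1 hg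
    exact ⟨g.coeff 0, mem_univ _, (hm.eq_X_add_C hn).symm⟩
  · exact fun _ _ => rfl

theorem sum_monics_two [Fintype k] {R : Type*} [CommRing R] (f : k[X] → R) :
    ∑ g ∈ monics k 2, f g = ∑ e : k, ∑ b : k, f (X ^ 2 + C b * X + C e) := by
  rw [← Finset.sum_product']
  symm
  refine Finset.sum_bij (fun x _ => X ^ 2 + C x.2 * X + C x.1) ?_ ?_ ?_ ?_
  · rintro ⟨e, b⟩ _
    have hd : (C b * X + C e).degree < ((2 : ℕ) : WithBot ℕ) :=
      lt_of_le_of_lt degree_linear_le (by norm_num)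
    rw [mem_monics]
    dsimp only
    rw [add_assoc]
    exact ⟨monic_X_pow_add hd, by
      rw [natDegree_add_eq_left_of_degree_lt (by rwa [degree_X_pow]), natDegree_X_pow]⟩
  · rintro ⟨e, b⟩ _ ⟨e', b'⟩ _ h
    have h0 := congrArg (fun p => coeff p 0) h
    have h1 := congrArg (fun p => coeff p 1) h
    simp [coeff_X, coeff_C] at h0 h1
    simp [h0, h1]
  · intro g hg
    obtain ⟨hm, hn⟩ := mem_monics.1 hg
    refine ⟨(g.coeff 0, g.coeff 1), mem_univ _, ?_⟩
    conv_rhs => rw [hm.as_sum, hn]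
    simp [Finset.sum_range_succ]
    ring
  · exact fun _ _ => rfl

omit [Finite k] in
/-- The Hasse-Davenport relation for Jacobi sums. -/
theorem sum_norm_jacobi [Fintype k] {R : Type*} [CommRing R] [IsDomain R] (χ : MulChar k R)
    {φ : MulChar k R} (hφ : φ ≠ 1) (K : Type*) [Field K] [Fintype K] [Algebra k K] :
    ∑ x : K, χ (Algebra.norm k x) * φ (Algebra.norm k (1 + x)) =
      (-1) ^ (Module.finrank k K - 1) * (∑ x : k, χ x * φ (1 + x)) ^ Module.finrank k K := by
  set Φ : k[X] →* R := evalChar χ 0 * evalChar φ 1 with hΦ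
  set J := ∑ x : k, χ x * φ (1 + x) with hJ
  have hS0 : ∑ g ∈ monics k 0, Φ g = 1 := by rw [sum_monics_zero, map_one]
  have hS1 : ∑ g ∈ monics k 1, Φ g = J := by
    rw [sum_monics_one]
    simp [hΦ, hJ]
  -- Since these sums vanish, the generating series is `1 + J T`, whose logarithmic derivative has
  -- coefficients `(-1) ^ n J ^ (n + 1)`.
  have hS : ∀ n, 2 ≤ n → ∑ g ∈ monics k n, Φ g = 0 := fun n hn => by
    rw [← sum_monics_eq_zero hφ 1 (n := n) (ℓ := X) (Ψ := fun g => χ (g.eval 0))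
      (by rw [degree_X]; exact_mod_cast hn) (by simp) (by simp)]
    exact Finset.sum_congr rfl fun g _ => by simp [hΦ, mul_comm]
  have hP : ∀ n, primePowerSum Φ (n + 1) = (-1) ^ n * J ^ (n + 1) := fun n => by
    induction n with
    | zero =>
      have := natCast_mul_sum_monics Φ 1
      simp [hS0, hS1] at this
      simp [this]
    | succ n ih =>
      have := natCast_mul_sum_monics Φ (n + 2)
      rw [hS _ (by omega), mul_zero, Finset.sum_Icc_succ_top (by omega),
        Finset.sum_Icc_succ_top (by omega), Finset.sum_eq_zero, zero_add, ih, Nat.sub_self, hS0,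
        show n + 2 - (n + 1) = 1 by omega, hS1] at this
      · linear_combination -this
      · intro j hj
        rw [mem_Icc] at hj
        rw [hS _ (by omega), mul_zero]
  have hn : Module.finrank k K = Module.finrank k K - 1 + 1 :=
    (Nat.sub_add_cancel Module.finrank_pos).symm
  have h := primePowerSum_eq_sum_minpoly Φ K
  rw [hn, hP, ← hn] at h
  rw [h, ← Equiv.sum_comp (Equiv.neg K)]
  refine Finset.sum_congr rfl fun θ _ => ?_
  rw [hΦ, MonoidHom.mul_apply, mul_pow, evalChar_apply, evalChar_apply, ← map_pow, ← map_pow,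
    eval_minpoly_pow, eval_minpoly_pow]
  simp [sub_eq_add_neg]

omit [Finite k] in
-- By Euler's criterion both sides are powers of `x`, because the norm is the power with exponent
-- `(#K - 1) / (#k - 1)`.
theorem quadraticChar_norm [Fintype k] [DecidableEq k] (hk : ringChar k ≠ 2) {K : Type*} [Field K]
    [Fintype K] [DecidableEq K] [Algebra k K] (x : K) :
    quadraticChar k (Algebra.norm k x) = quadraticChar K x := by
  have hchar : ringChar K ≠ 2 := by
    rwa [← Algebra.ringChar_eq k K]
  refine (quadraticChar_isQuadratic k).eq_of_eq_coe (R'' := K) (quadraticChar_isQuadratic K)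
    hchar ?_
  have h1 := congrArg (algebraMap k K) (quadraticChar_eq_pow_of_char_ne_two' hk (Algebra.norm k x))
  rw [map_intCast, map_pow, FiniteField.algebraMap_norm_eq_pow, ← pow_mul] at h1
  rw [h1, quadraticChar_eq_pow_of_char_ne_two' hchar]
  congr 1
  have ho1 := FiniteField.odd_card_of_char_ne_two hk
  have ho2 := FiniteField.odd_card_of_char_ne_two hchar
  obtain ⟨c, hc⟩ : Fintype.card k - 1 ∣ Fintype.card K - 1 := by
    rw [Module.card_eq_pow_finrank (K := k) (V := K)]
    simpa using Nat.sub_dvd_pow_sub_pow (Fintype.card k) 1 (Module.finrank k K)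
  have hlt : 1 < Fintype.card k := Fintype.one_lt_card
  rw [Nat.card_eq_fintype_card, Nat.card_eq_fintype_card, hc, Nat.mul_div_cancel_left _ (by omega)]
  obtain ⟨a, ha⟩ : ∃ a, Fintype.card k = 2 * a + 1 := ⟨Fintype.card k / 2, by omega⟩
  obtain ⟨b, hb⟩ : ∃ b, Fintype.card K = 2 * b + 1 := ⟨Fintype.card K / 2, by omega⟩
  rw [ha, hb] at hc ⊢
  have : b = a * c := by
    have : 2 * b = 2 * (a * c) := by rw [← mul_assoc]; simpa using hc
    omega
  rw [show (2 * a + 1) / 2 = a by omega, show (2 * b + 1) / 2 = b by omega, this, mul_comm]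

end CharacterSums

/-! ### The Legendre character sum and its generating polynomial -/

section Legendre

variable {k : Type*} [Field k] [Fintype k] [DecidableEq k]

/-- For `v ≠ 0` dividing by `v ^ 2` leaves `β + δ / v`, which runs over every element but `β` when
`δ ≠ 0`. -/
theorem sum_quadraticChar_mul_linear (hk : ringChar k ≠ 2) (β δ : k) :
    ∑ v, quadraticChar k (v * (β * v + δ)) =
      quadraticChar k β * (if δ = 0 then (Fintype.card k : ℤ) - 1 else -1) := by
  have h1 : ∀ v ∈ univ.erase (0 : k), quadraticChar k (v * (β * v + δ)) =
      quadraticChar k (β + δ * v⁻¹) := fun v hv => by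
    have hv0 : v ≠ 0 := ne_of_mem_erase hv
    rw [show v * (β * v + δ) = v ^ 2 * (β + δ * v⁻¹) by field_simp, map_mul,
      quadraticChar_sq_one' hv0, one_mul]
  rw [← Finset.add_sum_erase _ _ (mem_univ (0 : k)), zero_mul, quadraticChar_zero, zero_add,
    Finset.sum_congr rfl h1]
  split_ifs with hδ
  · simp [hδ, mul_comm, Fintype.card_pos]
  · have h2 : ∑ v, quadraticChar k (β + δ * v⁻¹) = 0 := by
      rw [← quadraticChar_sum_zero hk]
      refine Fintype.sum_bijective (fun v => β + δ * v⁻¹) ?_ _ _ fun _ => rfl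
      exact (AddGroup.addLeft_bijective β).comp ((mulLeft_bijective₀ δ hδ).comp inv_involutive.bijective)
    rw [← Finset.add_sum_erase _ _ (mem_univ (0 : k))] at h2
    simp only [inv_zero, mul_zero, add_zero] at h2
    linarith

/-- This is the sum over monic quadratics `g` in the coordinates `u = g(0)`, `v = g(1)`; the third
factor is `g(c)`. It gives the coefficient of `T ^ 2` at a good place. -/
theorem sum_sum_quadraticChar (hk : ringChar k ≠ 2) {c : k} (h0 : c ≠ 0) (h1 : c ≠ 1) :
    ∑ u, ∑ v, quadraticChar k (u * v * (c * (c - 1) + (1 - c) * u + c * v)) = Fintype.card k := by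
  have h1' : 1 - c ≠ 0 := sub_ne_zero.2 (Ne.symm h1)
  have h : ∀ u, ∑ v, quadraticChar k (u * v * (c * (c - 1) + (1 - c) * u + c * v)) =
      quadraticChar k u * (quadraticChar k c * ((if u = c then (Fintype.card k : ℤ) else 0) - 1)) :=
    fun u => by
    simp_rw [show ∀ v, u * v * (c * (c - 1) + (1 - c) * u + c * v) =
      u * (v * (c * v + (1 - c) * (u - c))) by intro v; ring, map_mul _ u]
    rw [← Finset.mul_sum, sum_quadraticChar_mul_linear hk]
    simp only [mul_eq_zero, h1', false_or, sub_eq_zero]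
    split_ifs <;> ring
  simp_rw [h, mul_sub, mul_one, Finset.sum_sub_distrib, ← Finset.sum_mul, quadraticChar_sum_zero hk]
  simp only [mul_ite, mul_zero, Finset.sum_ite_eq', mem_univ, if_true, zero_mul, sub_zero]
  rw [← mul_assoc, ← sq, quadraticChar_sq_one h0, one_mul]

/-- The quadratic character sum attached to the Legendre cubic `x (x + 1) (x + c)`. -/
def legendreSum (K : Type*) [Field K] [Fintype K] [DecidableEq K] (c : K) : ℤ :=
  ∑ x : K, quadraticChar K (x * (x + 1) * (x + c))

/-- The multiplicative function on polynomials attached to the Legendre cubic. -/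
noncomputable def legendreHom (c : k) : k[X] →* ℤ :=
  evalChar (quadraticChar k) 0 * evalChar (quadraticChar k) 1 * evalChar (quadraticChar k) c

theorem legendreHom_apply (c : k) (g : k[X]) :
    legendreHom c g = quadraticChar k (g.eval 0 * g.eval 1 * g.eval c) := by
  simp only [legendreHom, MonoidHom.mul_apply, evalChar_apply, map_mul]

theorem primePowerSum_legendreHom (hk : ringChar k ≠ 2) (K : Type*) [Field K] [Fintype K]
    [DecidableEq K] [Algebra k K] (c : k) :
    primePowerSum (legendreHom c) (Module.finrank k K) = legendreSum K (algebraMap k K c) := by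
  rw [primePowerSum_eq_sum_minpoly, legendreSum, ← Equiv.sum_comp (Equiv.neg K)]
  refine Finset.sum_congr rfl fun θ _ => ?_
  rw [legendreHom_apply, ← map_pow, mul_pow, mul_pow, eval_minpoly_pow, eval_minpoly_pow,
    eval_minpoly_pow, ← map_mul, ← map_mul, quadraticChar_norm hk]
  congr 1
  simp
  ring

/-- The local polynomial attached to the Legendre cubic. -/
noncomputable def legendrePoly (c : k) : ℤ[X] :=
  1 + C (legendreSum k c) * X + C (if c = 0 ∨ c = 1 then 0 else (Fintype.card k : ℤ)) * X ^ 2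

theorem mk_sum_monics_legendreHom (hk : ringChar k ≠ 2) (c : k) :
    (PowerSeries.mk fun n => ∑ g ∈ monics k n, legendreHom c g) =
      ((legendrePoly c : ℤ[X]) : PowerSeries ℤ) := by
  have hne := quadraticChar_ne_one hk
  -- One root carries the character and `ℓ` vanishes at the other roots. When `c` is `0` or `1` two
  -- roots coincide, so a linear `ℓ` suffices and vanishing starts in degree `2`; otherwise `ℓ` is
  -- quadratic and it starts in degree `3`.
  have hvanish : ∀ n, 2 ≤ n → (c = 0 ∨ c = 1) ∨ 3 ≤ n →
      ∑ g ∈ monics k n, legendreHom c g = 0 := fun n hn hc => by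
    by_cases hc1 : c = 1
    · rw [← sum_monics_eq_zero hne 0 (n := n) (ℓ := 1 - X)
        (Ψ := fun g => quadraticChar k (g.eval 1 * g.eval c)) ?_ (by simp) (by simp [hc1])]
      · exact Finset.sum_congr rfl fun g _ => by rw [legendreHom_apply, ← map_mul, mul_assoc]
      · rw [← neg_sub, degree_neg, ← C_1, degree_X_sub_C]
        exact_mod_cast hn
    · have hc1' : 1 - c ≠ 0 := sub_ne_zero.2 (Ne.symm hc1)
      rcases hc with hc | hc
      · obtain rfl := hc.resolve_right hc1
        rw [← sum_monics_eq_zero hne 1 (n := n) (ℓ := X)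
          (Ψ := fun g => quadraticChar k (g.eval 0 * g.eval 0)) ?_ (by simp) (by simp)]
        · refine Finset.sum_congr rfl fun g _ => ?_
          rw [legendreHom_apply, ← map_mul]
          congr 1
          ring
        · rw [degree_X]
          exact_mod_cast hn
      · rw [← sum_monics_eq_zero hne 1 (n := n) (ℓ := C (1 - c)⁻¹ * (X * (X - C c)))
          (Ψ := fun g => quadraticChar k (g.eval 0 * g.eval c)) ?_ (by simp [hc1']) (by simp)]
        · refine Finset.sum_congr rfl fun g _ => ?_
          rw [legendreHom_apply, ← map_mul]
          congr 1
          ring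
        · rw [degree_C_mul (inv_ne_zero hc1'), degree_mul, degree_X, degree_X_sub_C]
          exact_mod_cast hc
  ext n
  rw [PowerSeries.coeff_mk, coeff_coe]
  match n with
  | 0 =>
    simp only [legendrePoly, coeff_add, coeff_one, coeff_C_mul, coeff_X, coeff_X_pow,
      sum_monics_zero]
    simp
  | 1 =>
    simp only [legendrePoly, sum_monics_one, legendreHom_apply, legendreSum, coeff_add, coeff_one,
      coeff_C_mul, coeff_X, coeff_X_pow]
    simp only [eval_add, eval_X, eval_C, add_comm]
    simp
  | 2 =>
    have hcoeff : (legendrePoly c).coeff 2 =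
        if c = 0 ∨ c = 1 then 0 else (Fintype.card k : ℤ) := by
      simp only [legendrePoly, coeff_add, coeff_one, coeff_C_mul, coeff_X, coeff_X_pow]
      simp
    rw [hcoeff]
    split_ifs with hc
    · exact hvanish 2 le_rfl (Or.inl hc)
    · rw [not_or] at hc
      rw [← sum_sum_quadraticChar hk hc.1 hc.2, sum_monics_two]
      refine Finset.sum_congr rfl fun e _ => ?_
      refine Fintype.sum_equiv (Equiv.addRight (1 + e)) _ _ fun b => ?_
      rw [legendreHom_apply]
      congr 1
      simp
      ring
  | n + 3 =>
    rw [hvanish _ (by omega) (Or.inr (by omega))]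
    simp only [legendrePoly, coeff_add, coeff_one, coeff_C_mul, coeff_X, coeff_X_pow]
    simp

theorem X_mul_derivative_legendrePoly (hk : ringChar k ≠ 2) (c : k) :
    PowerSeries.X * PowerSeries.derivative ℤ ((legendrePoly c : ℤ[X]) : PowerSeries ℤ) =
      PowerSeries.mk (primePowerSum (legendreHom c)) * ((legendrePoly c : ℤ[X]) : PowerSeries ℤ) := by
  rw [← mk_sum_monics_legendreHom hk]
  exact X_mul_derivative_mk_sum_monics _

end Legendre

end RatFuncEC

namespace RatFuncEC

open Polynomial Finset WeierstrassCurve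

/-! ### Counting points through the quadratic character -/

section PointCount

/-- Complete the square with `z = 2 y + a₁ x + a₃`; nonvanishing of the discriminant makes every
affine solution a nonsingular point. -/
theorem card_point_eq {κ : Type*} [Field κ] [Fintype κ] [DecidableEq κ] (hκ : ringChar κ ≠ 2)
    (V : WeierstrassCurve κ) (hV : V.Δ ≠ 0) :
    (Nat.card V.toAffine.Point : ℤ) = Fintype.card κ + 1 +
      ∑ x : κ, quadraticChar κ (4 * x ^ 3 + V.b₂ * x ^ 2 + 2 * V.b₄ * x + V.b₆) := by
  have h2 : (2 : κ) ≠ 0 := Ring.two_ne_zero hκ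
  have e1 : V.toAffine.Point ≃ Option {xy : κ × κ // V.toAffine.Equation xy.1 xy.2} :=
    { toFun := fun P => match P with
        | .zero => none
        | .some x y h => some ⟨(x, y), h.1⟩
      invFun := fun o => match o with
        | none => .zero
        | some ⟨(x, y), h⟩ => .some x y
            ((Affine.equation_iff_nonsingular_of_Δ_ne_zero (W := V.toAffine) hV).1 h)
      left_inv := by rintro (_ | _) <;> rfl
      right_inv := by rintro (_ | ⟨⟨x, y⟩, h⟩) <;> rfl }
  have e2 : {xy : κ × κ // V.toAffine.Equation xy.1 xy.2} ≃
      (x : κ) × {z : κ // z ^ 2 = 4 * x ^ 3 + V.b₂ * x ^ 2 + 2 * V.b₄ * x + V.b₆} :=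
    { toFun := fun P => ⟨P.1.1, 2 * P.1.2 + V.a₁ * P.1.1 + V.a₃, by
        have := (Affine.equation_iff (W := V.toAffine) _ _).1 P.2
        simp only [b₂, b₄, b₆]
        linear_combination 4 * this⟩
      invFun := fun Q => ⟨(Q.1, (Q.2.1 - V.a₁ * Q.1 - V.a₃) / 2), by
        have := Q.2.2
        rw [Affine.equation_iff]
        simp only [b₂, b₄, b₆] at this
        field_simp
        linear_combination this⟩
      left_inv := by
        rintro ⟨⟨x, y⟩, h⟩
        ext
        · rfl
        · simp
          field_simp
          ring
      right_inv := by
        rintro ⟨x, z, h⟩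
        simp only [Sigma.mk.injEq, heq_eq_eq, true_and, Subtype.mk.injEq]
        field_simp
        ring }
  have e3 := e1.trans (Equiv.optionCongr e2)
  have h3 : ∀ a : κ, (Fintype.card {z : κ // z ^ 2 = a} : ℤ) = quadraticChar κ a + 1 := fun a => by
    rw [← quadraticChar_card_sqrts hκ a, Set.toFinset_card]
    rfl
  rw [Nat.card_congr e3, Nat.card_eq_fintype_card, Fintype.card_option, Fintype.card_sigma]
  push_cast
  simp_rw [h3, Finset.sum_add_distrib]
  simp
  ring

end PointCount

theorem splits_quadratic_iff {κ : Type*} [Field κ] (h2 : (2 : κ) ≠ 0) {a b c : κ} (ha : a ≠ 0) :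
    (C a * X ^ 2 + C b * X - C c).Splits ↔ IsSquare (b ^ 2 + 4 * a * c) := by
  have hdeg : (C a * X ^ 2 + C b * X - C c).natDegree = 2 := by
    rw [sub_eq_add_neg, ← C_neg]
    exact natDegree_quadratic ha
  constructor
  · intro h
    obtain ⟨x, hx⟩ := h.exists_eval_eq_zero fun h0 => by
      have := natDegree_eq_zero_iff_degree_le_zero.2 h0.le
      omega
    simp only [eval_sub, eval_add, eval_mul, eval_C, eval_pow, eval_X] at hx
    exact ⟨2 * a * x + b, by linear_combination (-4 * a) * hx⟩
  · rintro ⟨s, hs⟩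
    refine Splits.of_natDegree_eq_two (x := (s - b) / (2 * a)) hdeg ?_
    simp only [eval_sub, eval_add, eval_mul, eval_C, eval_pow, eval_X]
    field_simp
    linear_combination -hs

/-! ### Minimal models and local polynomials over a discrete valuation ring -/

section Reduction

variable {R : Type*} [CommRing R] [IsDomain R] [IsDiscreteValuationRing R]
  {K : Type*} [Field K] [Algebra R K] [IsFractionRing R K]

open IsDiscreteValuationRing IsDedekindDomain.HeightOneSpectrum
open IsLocalRing (ResidueField residue)

theorem valuation_algebraMap_eq_one_iff (r : R) :
    valuation K (maximalIdeal R) (algebraMap R K r) = 1 ↔ IsUnit r := by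
  have h1 := valuation_lt_one_iff_mem (K := K) (maximalIdeal R) r
  have h2 := valuation_le_one (K := K) (maximalIdeal R) r
  have h3 : r ∈ (maximalIdeal R).asIdeal ↔ ¬IsUnit r := mem_nonunits_iff
  rw [h3] at h1
  rw [← not_iff_not, ← h1]
  exact ⟨fun h => lt_of_le_of_ne h2 h, fun h => h.ne⟩

/-- A criterion for an integral model to be related to a minimal model by a change of variables
whose scaling is a unit. -/
theorem exists_minimal_eq_smul (W : WeierstrassCurve K) (W₀ : WeierstrassCurve R)
    (D : VariableChange K) (hD : D • W = W₀.map (algebraMap R K)) (hΔ : W₀.Δ ≠ 0)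
    (hmin : (∀ a : R, ¬IsUnit a → ¬a ^ 12 ∣ W₀.Δ) ∨ ∀ a : R, ¬IsUnit a → ¬a ^ 4 ∣ W₀.c₄) :
    ∃ (C : VariableChange K) (u : Rˣ), W.minimal R = C • W₀.map (algebraMap R K) ∧
      C.u = Units.map (algebraMap R K).toMonoidHom u := by
  obtain ⟨C, hC⟩ : ∃ C : VariableChange K, W.minimal R = C • W₀.map (algebraMap R K) := by
    refine ⟨(W.exists_isMinimal R).choose * D⁻¹, ?_⟩
    rw [mul_smul, ← hD, inv_smul_smul]
    rfl
  have hinj := IsFractionRing.injective R K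
  set I := integralModel R (W.minimal R) with hI
  have hIΔ : algebraMap R K I.Δ = C.u⁻¹ ^ 12 * algebraMap R K W₀.Δ := by
    rw [hI, integralModel_Δ_eq, hC, variableChange_Δ, map_Δ]; 
  have hIc : algebraMap R K I.c₄ = C.u⁻¹ ^ 4 * algebraMap R K W₀.c₄ := by
    rw [hI, integralModel_c₄_eq, hC, variableChange_c₄, map_c₄]
  refine ⟨C, ?_⟩
  -- In a valuation ring the scaling or its inverse is integral. If the scaling were a nonunit `a`,
  -- then `a ^ 12` would divide `W₀.Δ` and `a ^ 4` would divide `W₀.c₄`, against `hmin`; if its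
  -- inverse were a nonunit, `W₀` would beat the minimal model.
  rcases ValuationRing.isInteger_or_isInteger R (C.u : K) with ⟨a, ha⟩ | ⟨a, ha⟩
  · have hau : IsUnit a := by
      by_contra hau
      rcases hmin with h | h
      · refine h a hau ⟨I.Δ, hinj ?_⟩
        rw [map_mul, map_pow, hIΔ, ha, ← mul_assoc, ← mul_pow]
        simp
      · refine h a hau ⟨I.c₄, hinj ?_⟩
        rw [map_mul, map_pow, hIc, ha, ← mul_assoc, ← mul_pow]
        simp
    obtain ⟨u, rfl⟩ := hau
    exact ⟨u, hC, Units.ext (by simp [ha])⟩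
  · have hau : IsUnit a := by
      by_contra hau
      have hmax := (inferInstance : IsMinimal R (W.minimal R)).val_Δ_maximal
      have hW₀ : IsIntegral R (W₀.map (algebraMap R K)) := ⟨W₀, rfl⟩
      have heq : C⁻¹ • W.minimal R = W₀.map (algebraMap R K) := by rw [hC, inv_smul_smul]
      have hint : IsIntegral R (C⁻¹ • W.minimal R) := heq ▸ hW₀
      have hIm : IsIntegral R (W.minimal R) := inferInstance
      have hv : valuation K (maximalIdeal R) (W.minimal R).Δ =
          valuation K (maximalIdeal R) (algebraMap R K a) ^ 12 *
            valuation K (maximalIdeal R) (algebraMap R K W₀.Δ) := by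
        rw [← integralModel_Δ_eq R, ← hI, hIΔ, ← map_pow, ← map_mul, ha]
        simp
      have hlt : valuation K (maximalIdeal R) (algebraMap R K a) < 1 :=
        lt_of_le_of_ne (valuation_le_one _ _) (mt (valuation_algebraMap_eq_one_iff a).1 hau)
      have hne : valuation K (maximalIdeal R) (algebraMap R K W₀.Δ) ≠ 0 := by
        rw [Valuation.ne_zero_iff]
        exact (map_ne_zero_iff _ hinj).2 hΔ
      have hle := hmax.2 hint
      simp only [← Subtype.coe_le_coe, one_smul] at hle
      rw [heq, valuation_Δ_aux_eq_of_isIntegral, valuation_Δ_aux_eq_of_isIntegral, hv, map_Δ] at hle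
      have hlt2 : valuation K (maximalIdeal R) (algebraMap R K a) ^ 12 *
            valuation K (maximalIdeal R) (algebraMap R K W₀.Δ) <
          1 * valuation K (maximalIdeal R) (algebraMap R K W₀.Δ) :=
        mul_lt_mul_of_pos_right (pow_lt_one₀ zero_le hlt (by norm_num)) (zero_lt_iff.2 hne)
      rw [one_mul] at hlt2
      exact absurd (hle hlt2.le) (not_le.2 hlt2)
    obtain ⟨u, rfl⟩ := hau
    refine ⟨u⁻¹, hC, ?_⟩
    rw [map_inv, eq_inv_iff_mul_eq_one]
    refine Units.ext ?_
    simp [ha]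

variable {W : WeierstrassCurve K} {W₀ : WeierstrassCurve R} {C : VariableChange K} {u : Rˣ}

theorem integralModel_c₄_eq_of_smul (hC : W.minimal R = C • W₀.map (algebraMap R K))
    (hu : C.u = Units.map (algebraMap R K).toMonoidHom u) :
    (integralModel R (W.minimal R)).c₄ = ((u⁻¹ : Rˣ) : R) ^ 4 * W₀.c₄ := by
  apply IsFractionRing.injective R K
  rw [integralModel_c₄_eq, hC, variableChange_c₄, map_c₄, hu, ← map_inv]
  simp

theorem integralModel_c₆_eq_of_smul (hC : W.minimal R = C • W₀.map (algebraMap R K))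
    (hu : C.u = Units.map (algebraMap R K).toMonoidHom u) :
    (integralModel R (W.minimal R)).c₆ = ((u⁻¹ : Rˣ) : R) ^ 6 * W₀.c₆ := by
  apply IsFractionRing.injective R K
  rw [integralModel_c₆_eq, hC, variableChange_c₆, map_c₆, hu, ← map_inv]
  simp

theorem integralModel_Δ_eq_of_smul (hC : W.minimal R = C • W₀.map (algebraMap R K))
    (hu : C.u = Units.map (algebraMap R K).toMonoidHom u) :
    (integralModel R (W.minimal R)).Δ = ((u⁻¹ : Rˣ) : R) ^ 12 * W₀.Δ := by
  apply IsFractionRing.injective R K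
  rw [integralModel_Δ_eq, hC, variableChange_Δ, map_Δ, hu, ← map_inv]
  simp

theorem valuation_minimal_Δ_eq_one_iff (hC : W.minimal R = C • W₀.map (algebraMap R K))
    (hu : C.u = Units.map (algebraMap R K).toMonoidHom u) :
    valuation K (maximalIdeal R) (W.minimal R).Δ = 1 ↔ IsUnit W₀.Δ := by
  rw [← integralModel_Δ_eq R, valuation_algebraMap_eq_one_iff, integralModel_Δ_eq_of_smul hC hu]
  exact IsUnit.mul_iff.trans (and_iff_right ((Units.isUnit _).pow _))

theorem valuation_minimal_c₄_eq_one_iff (hC : W.minimal R = C • W₀.map (algebraMap R K))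
    (hu : C.u = Units.map (algebraMap R K).toMonoidHom u) :
    valuation K (maximalIdeal R) (W.minimal R).c₄ = 1 ↔ IsUnit W₀.c₄ := by
  rw [← integralModel_c₄_eq R, valuation_algebraMap_eq_one_iff, integralModel_c₄_eq_of_smul hC hu]
  exact IsUnit.mul_iff.trans (and_iff_right ((Units.isUnit _).pow _))

theorem localPolynomial_eq_one (hC : W.minimal R = C • W₀.map (algebraMap R K))
    (hu : C.u = Units.map (algebraMap R K).toMonoidHom u) (hΔ : ¬IsUnit W₀.Δ)
    (hc : ¬IsUnit W₀.c₄) : W.localPolynomial R = 1 := by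
  have h1 : ¬(W.minimal R).HasGoodReduction R := fun h =>
    hΔ ((valuation_minimal_Δ_eq_one_iff hC hu).1 h.goodReduction)
  have h2 : ¬(W.minimal R).HasMultiplicativeReduction R := fun h =>
    hc ((valuation_minimal_c₄_eq_one_iff hC hu).1 h.multiplicativeReduction)
  rw [localPolynomial, if_neg h1, if_neg fun h => h2 h.toHasMultiplicativeReduction, if_neg h2]

open scoped Classical in
-- The quadratic giving the tangent directions at the node has discriminant `-c₄ c₆`, and a unit
-- change of model multiplies this by a tenth power, hence by a square.
theorem localPolynomial_eq_of_multiplicative (h2 : (2 : ResidueField R) ≠ 0)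
    (hC : W.minimal R = C • W₀.map (algebraMap R K))
    (hu : C.u = Units.map (algebraMap R K).toMonoidHom u) (hΔ : ¬IsUnit W₀.Δ)
    (hc : IsUnit W₀.c₄) :
    W.localPolynomial R =
      if IsSquare (residue R (-(W₀.c₄ * W₀.c₆))) then 1 - X else 1 + X := by
  have h1 : ¬(W.minimal R).HasGoodReduction R := fun h =>
    hΔ ((valuation_minimal_Δ_eq_one_iff hC hu).1 h.goodReduction)
  have h3 : (W.minimal R).HasMultiplicativeReduction R :=
    { badReduction := lt_of_le_of_ne
        (by rw [← integralModel_Δ_eq R]; exact valuation_le_one _ _)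
        (mt (valuation_minimal_Δ_eq_one_iff hC hu).1 hΔ)
      multiplicativeReduction := (valuation_minimal_c₄_eq_one_iff hC hu).2 hc }
  have h4 : (W.minimal R).HasSplitMultiplicativeReduction R ↔
      IsSquare (residue R (-(W₀.c₄ * W₀.c₆))) := by
    have hcI : residue R (integralModel R (W.minimal R)).c₄ ≠ 0 := by
      rw [integralModel_c₄_eq_of_smul hC hu, IsLocalRing.residue_ne_zero_iff_isUnit]
      exact ((Units.isUnit _).pow _).mul hc
    rw [hasSplitMultiplicativeReduction_iff, exists_prop_of_true h3]
    simp only [Polynomial.map_sub, Polynomial.map_add, Polynomial.map_mul, map_C,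
      Polynomial.map_pow, map_X]
    rw [IsLocalRing.ResidueField.algebraMap_eq, splits_quadratic_iff h2 hcI]
    set I := integralModel R (W.minimal R) with hI
    have hdisc : residue R (I.a₁ * I.c₄) ^ 2 + 4 * residue R I.c₄ *
        residue R (54 * I.b₆ - 3 * I.b₂ * I.b₄ + I.a₂ * I.c₄) =
          residue R ((u⁻¹ : Rˣ) : R) ^ 10 * residue R (-(W₀.c₄ * W₀.c₆)) := by
      have h : (I.a₁ * I.c₄) ^ 2 + 4 * I.c₄ * (54 * I.b₆ - 3 * I.b₂ * I.b₄ + I.a₂ * I.c₄) =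
          -(I.c₄ * I.c₆) := by
        simp only [c₄, c₆, b₂, b₄, b₆]
        ring
      have h' : -(I.c₄ * I.c₆) = ((u⁻¹ : Rˣ) : R) ^ 10 * -(W₀.c₄ * W₀.c₆) := by
        rw [hI, integralModel_c₄_eq_of_smul hC hu, integralModel_c₆_eq_of_smul hC hu]
        ring
      rw [← map_pow (residue R) ((u⁻¹ : Rˣ) : R), ← map_mul (residue R) (_ ^ 10), ← h', ← h]
      simp only [map_add, map_sub, map_mul, map_pow, map_ofNat (residue R)]
    have hu0 : residue R ((u⁻¹ : Rˣ) : R) ≠ 0 :=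
      (IsLocalRing.residue_ne_zero_iff_isUnit _).2 (Units.isUnit _)
    rw [hdisc]
    constructor
    · rintro ⟨s, hs⟩
      refine ⟨s / residue R ((u⁻¹ : Rˣ) : R) ^ 5, ?_⟩
      field_simp
      linear_combination hs
    · rintro ⟨s, hs⟩
      exact ⟨residue R ((u⁻¹ : Rˣ) : R) ^ 5 * s, by rw [hs]; ring⟩
  rw [localPolynomial, if_neg h1]
  simp only [h4, h3, if_true]

/-- The character sum can be read off any model with unit discriminant: the change of variables to
the minimal model reduces to an affine bijection of the `x`-line that scales the cubic by a square.
-/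
theorem localPolynomial_eq_of_isUnit_Δ [Fintype (ResidueField R)] [DecidableEq (ResidueField R)]
    (h2 : ringChar (ResidueField R) ≠ 2)
    (hC : W.minimal R = C • W₀.map (algebraMap R K))
    (hu : C.u = Units.map (algebraMap R K).toMonoidHom u) (hΔ : IsUnit W₀.Δ) :
    W.localPolynomial R =
      1 + Polynomial.C (∑ x, quadraticChar (ResidueField R)
        (4 * x ^ 3 + residue R W₀.b₂ * x ^ 2 + 2 * residue R W₀.b₄ * x + residue R W₀.b₆)) * X
        + Polynomial.C (Fintype.card (ResidueField R) : ℤ) * X ^ 2 := by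
  have hgood : (W.minimal R).HasGoodReduction R :=
    { goodReduction := (valuation_minimal_Δ_eq_one_iff hC hu).2 hΔ }
  set I := integralModel R (W.minimal R) with hI
  have hinj := IsFractionRing.injective R K
  have h2u : IsUnit (2 : R) := by
    rw [← IsLocalRing.residue_ne_zero_iff_isUnit, map_ofNat]
    exact Ring.two_ne_zero h2
  have h4u : IsUnit (4 : R) := by
    rw [show (4 : R) = 2 * 2 by norm_num]
    exact h2u.mul h2u
  have hIK : I.map (algebraMap R K) = C • W₀.map (algebraMap R K) := by
    rw [← hC]
    exact baseChange_integralModel_eq R (W.minimal R)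
  have huK : ((C.u⁻¹ : Kˣ) : K) = algebraMap R K ((u⁻¹ : Rˣ) : R) := by
    rw [hu, ← map_inv]
    rfl
  have hb₂ := congrArg WeierstrassCurve.b₂ hIK
  have hb₄ := congrArg WeierstrassCurve.b₄ hIK
  have hb₆ := congrArg WeierstrassCurve.b₆ hIK
  rw [variableChange_b₂, map_b₂, map_b₂, huK] at hb₂
  rw [variableChange_b₄, map_b₄, map_b₄, map_b₂, huK] at hb₄
  rw [variableChange_b₆, map_b₆, map_b₆, map_b₄, map_b₂, huK] at hb₆
  have huinv : algebraMap R K (u : R) * algebraMap R K ((u⁻¹ : Rˣ) : R) = 1 := by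
    rw [← map_mul, Units.mul_inv, map_one]
  -- Divided by the unit `4`, the transformation formula for `b₆` is a monic cubic equation for
  -- `C.r` over the integrally closed ring `R`.
  obtain ⟨r, hr⟩ : ∃ r : R, algebraMap R K r = C.r := by
    refine IsIntegrallyClosed.algebraMap_eq_of_integral
      ⟨Cubic.toPoly ⟨1, (h4u.unit⁻¹ : Rˣ) * W₀.b₂, (h4u.unit⁻¹ : Rˣ) * (2 * W₀.b₄),
        (h4u.unit⁻¹ : Rˣ) * (W₀.b₆ - u ^ 6 * I.b₆)⟩, Cubic.monic_of_a_eq_one rfl, ?_⟩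
    rw [Cubic.toPoly, eval₂_add, eval₂_add, eval₂_add, eval₂_mul, eval₂_mul, eval₂_mul, eval₂_C,
      eval₂_C, eval₂_C, eval₂_C, eval₂_pow, eval₂_pow, eval₂_X]
    have h4 : algebraMap R K ((h4u.unit⁻¹ : Rˣ) : R) * 4 = 1 := by
      rw [← map_ofNat (algebraMap R K) 4, ← map_mul, h4u.val_inv_mul, map_one]
    simp only [map_mul, map_sub, map_pow, map_one, map_ofNat (algebraMap R K), hb₆]
    generalize algebraMap R K ((h4u.unit⁻¹ : Rˣ) : R) = i at h4 ⊢
    generalize algebraMap R K (u : R) = a at huinv ⊢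
    generalize algebraMap R K ((u⁻¹ : Rˣ) : R) = b at huinv ⊢
    have h6 : a ^ 6 * b ^ 6 = 1 := by rw [← mul_pow, huinv, one_pow]
    linear_combination (-C.r ^ 3) * h4 - i * (algebraMap R K W₀.b₆ + 2 * C.r * algebraMap R K W₀.b₄ +
      C.r ^ 2 * algebraMap R K W₀.b₂ + 4 * C.r ^ 3) * h6
  rw [← hr] at hb₂ hb₄ hb₆
  have h₂ : residue R I.b₂ = residue R ((u⁻¹ : Rˣ) : R) ^ 2 *
      (residue R W₀.b₂ + 12 * residue R r) := by
    rw [hinj (a₁ := I.b₂) (a₂ := ((u⁻¹ : Rˣ) : R) ^ 2 * (W₀.b₂ + 12 * r)) (by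
      simp only [hb₂, map_mul, map_add, map_pow, map_ofNat (algebraMap R K)])]
    simp only [map_mul, map_add, map_pow, map_ofNat (residue R)]
  have h₄ : residue R I.b₄ = residue R ((u⁻¹ : Rˣ) : R) ^ 4 *
      (residue R W₀.b₄ + residue R r * residue R W₀.b₂ + 6 * residue R r ^ 2) := by
    rw [hinj (a₁ := I.b₄) (a₂ := ((u⁻¹ : Rˣ) : R) ^ 4 * (W₀.b₄ + r * W₀.b₂ + 6 * r ^ 2)) (by
      simp only [hb₄, map_mul, map_add, map_pow, map_ofNat (algebraMap R K)])]
    simp only [map_mul, map_add, map_pow, map_ofNat (residue R)]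
  have h₆ : residue R I.b₆ = residue R ((u⁻¹ : Rˣ) : R) ^ 6 *
      (residue R W₀.b₆ + 2 * residue R r * residue R W₀.b₄ + residue R r ^ 2 * residue R W₀.b₂ +
        4 * residue R r ^ 3) := by
    rw [hinj (a₁ := I.b₆) (a₂ := ((u⁻¹ : Rˣ) : R) ^ 6 *
      (W₀.b₆ + 2 * r * W₀.b₄ + r ^ 2 * W₀.b₂ + 4 * r ^ 3)) (by
      simp only [hb₆, map_mul, map_add, map_pow, map_ofNat (algebraMap R K)])]
    simp only [map_mul, map_add, map_pow, map_ofNat (residue R)]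
  have hcard := card_point_eq h2 ((W.minimal R).reduction R) (by
    rw [reduction, map_Δ, ← hI, IsLocalRing.residue_ne_zero_iff_isUnit, hI,
      integralModel_Δ_eq_of_smul hC hu]
    exact ((Units.isUnit _).pow _).mul hΔ)
  rw [localPolynomial, if_pos hgood, Nat.card_eq_fintype_card (α := ResidueField R), hcard]
  have hsum : ∑ x, quadraticChar (ResidueField R) (4 * x ^ 3 + ((W.minimal R).reduction R).b₂ * x ^ 2 +
      2 * ((W.minimal R).reduction R).b₄ * x + ((W.minimal R).reduction R).b₆) =
      ∑ x, quadraticChar (ResidueField R)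
        (4 * x ^ 3 + residue R W₀.b₂ * x ^ 2 + 2 * residue R W₀.b₄ * x + residue R W₀.b₆) := by
    rw [reduction, map_b₂, map_b₄, map_b₆, ← hI, h₂, h₄, h₆]
    have hv : residue R (u : R) * residue R ((u⁻¹ : Rˣ) : R) = 1 := by
      rw [← map_mul, Units.mul_inv, map_one]
    generalize residue R (u : R) = a at hv ⊢
    generalize residue R ((u⁻¹ : Rˣ) : R) = b at hv ⊢
    have ha : a ^ 2 ≠ 0 := pow_ne_zero _ (left_ne_zero_of_mul_eq_one hv)
    have hb : b ^ 3 ≠ 0 := pow_ne_zero _ (right_ne_zero_of_mul_eq_one hv)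
    have hab : a ^ 2 * b ^ 2 = 1 := by rw [← mul_pow, hv, one_pow]
    refine Fintype.sum_bijective (fun x => a ^ 2 * x + residue R r)
      ((AddGroup.addRight_bijective _).comp (mulLeft_bijective₀ _ ha)) _ _ fun x => ?_
    have hab4 : a ^ 4 * b ^ 4 = 1 := by
      linear_combination (a ^ 2 * b ^ 2 + 1) * hab
    have hab6 : a ^ 6 * b ^ 6 = 1 := by
      linear_combination (a ^ 4 * b ^ 4 + a ^ 2 * b ^ 2 + 1) * hab
    generalize residue R r = ρ
    generalize residue R W₀.b₂ = β₂
    generalize residue R W₀.b₄ = β₄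
    generalize residue R W₀.b₆ = β₆
    have key : 4 * x ^ 3 + b ^ 2 * (β₂ + 12 * ρ) * x ^ 2 +
        2 * (b ^ 4 * (β₄ + ρ * β₂ + 6 * ρ ^ 2)) * x +
        b ^ 6 * (β₆ + 2 * ρ * β₄ + ρ ^ 2 * β₂ + 4 * ρ ^ 3) =
      (b ^ 3) ^ 2 * (4 * (a ^ 2 * x + ρ) ^ 3 + β₂ * (a ^ 2 * x + ρ) ^ 2 +
        2 * β₄ * (a ^ 2 * x + ρ) + β₆) := by
      linear_combination (-4 * x ^ 3) * hab6 - (b ^ 2 * x ^ 2 * (12 * ρ + β₂)) * hab4 -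
        b ^ 4 * x * (12 * ρ ^ 2 + 2 * β₂ * ρ + 2 * β₄) * hab
    rw [key, map_mul, quadraticChar_sq_one' hb, one_mul]
  rw [hsum]
  simp

end Reduction
end RatFuncEC

namespace RatFuncEC

open Polynomial Finset WeierstrassCurve

/-! ### Invariants of the Legendre model and its degenerate sums -/

section LegendreModel

/-- The Legendre curve `y ^ 2 = x (x + 1) (x + c)`. -/
def legendreModel {A : Type*} [CommRing A] (c : A) : WeierstrassCurve A where
  a₁ := 0
  a₂ := 1 + c
  a₃ := 0
  a₄ := c
  a₆ := 0

variable {A : Type*} [CommRing A] (c : A)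

theorem legendreModel_Δ : (legendreModel c).Δ = 16 * (c * (c - 1)) ^ 2 := by
  simp [legendreModel, Δ, b₂, b₄, b₆, b₈]
  ring

theorem legendreModel_c₄ : (legendreModel c).c₄ = 16 * (c * (c - 1) + 1) := by
  simp [legendreModel, c₄, b₂, b₄]
  ring

theorem legendreModel_c₆ :
    (legendreModel c).c₆ = -32 * ((1 + c) * (2 * c ^ 2 - 5 * c + 2)) := by
  simp [legendreModel, c₆, b₂, b₄, b₆]
  ring

theorem map_legendreModel {B : Type*} [CommRing B] (f : A →+* B) :
    (legendreModel c).map f = legendreModel (f c) := by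
  ext <;> simp [legendreModel]

/-- The cubic has a double root; dropping the square leaves a complete linear character sum with one
term missing. The value matches split multiplicative reduction. -/
theorem legendreSum_zero {κ : Type*} [Field κ] [Fintype κ] [DecidableEq κ] (hκ : ringChar κ ≠ 2) :
    legendreSum κ 0 = -1 := by
  have h := quadraticChar_sum_zero hκ
  rw [← Equiv.sum_comp (Equiv.addRight (1 : κ)), ← Finset.add_sum_erase _ _ (mem_univ 0)] at h
  rw [legendreSum, ← Finset.add_sum_erase _ _ (mem_univ 0), Finset.sum_congr rfl (g := fun x =>
    quadraticChar κ (Equiv.addRight 1 x)) fun x hx => ?_]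
  · simp only [Equiv.coe_addRight, zero_add, map_one] at h ⊢
    rw [zero_mul, zero_mul, quadraticChar_zero]
    linarith
  · rw [show x * (x + 1) * (x + 0) = x ^ 2 * (x + 1) by ring, map_mul,
      quadraticChar_sq_one' (ne_of_mem_erase hx), one_mul]
    rfl

theorem legendreSum_one {κ : Type*} [Field κ] [Fintype κ] [DecidableEq κ] (hκ : ringChar κ ≠ 2) :
    legendreSum κ 1 = -quadraticChar κ (-1) := by
  have h := quadraticChar_sum_zero hκ
  rw [← Finset.add_sum_erase _ _ (mem_univ (-1))] at h
  rw [legendreSum, ← Finset.add_sum_erase _ _ (mem_univ (-1)), Finset.sum_congr rfl (g := fun x =>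
    quadraticChar κ x) fun x hx => ?_]
  · rw [neg_add_cancel, mul_zero, quadraticChar_zero]
    linarith
  · have hx1 : x + 1 ≠ 0 := fun h => ne_of_mem_erase hx (eq_neg_of_add_eq_zero_left h)
    rw [show x * (x + 1) * (x + 1) = (x + 1) ^ 2 * x by ring, map_mul,
      quadraticChar_sq_one' hx1, one_mul]

end LegendreModel

/-! ### Local polynomials of Legendre models -/

section LocalFactor

variable {R : Type*} [CommRing R] [IsDomain R] [IsDiscreteValuationRing R]
  {K : Type*} [Field K] [Algebra R K] [IsFractionRing R K] {W : WeierstrassCurve K}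
  {D : VariableChange K} {c : R}

open IsLocalRing (ResidueField residue)

omit [IsDomain R] [IsDiscreteValuationRing R] in
theorem isUnit_legendreModel_Δ_iff (h2 : IsUnit (2 : R)) :
    IsUnit (legendreModel c).Δ ↔ IsUnit (c * (c - 1)) := by
  have h16 : IsUnit (16 : R) := by
    rw [show (16 : R) = 2 ^ 4 by norm_num]
    exact h2.pow 4
  rw [legendreModel_Δ, IsUnit.mul_iff, and_iff_right h16, isUnit_pow_iff two_ne_zero]

/-- Up to units `c₄` is `c (c - 1) + 1`, so it cannot lie in the maximal ideal together with `c (c -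
1)`: the model is minimal and never has additive reduction. -/
theorem isUnit_legendreModel_c₄ (h2 : IsUnit (2 : R)) (hc : ¬IsUnit (c * (c - 1))) :
    IsUnit (legendreModel c).c₄ := by
  have h16 : IsUnit (16 : R) := by
    rw [show (16 : R) = 2 ^ 4 by norm_num]
    exact h2.pow 4
  rw [legendreModel_c₄]
  refine h16.mul ?_
  by_contra h
  have := (IsLocalRing.maximalIdeal R).sub_mem ((IsLocalRing.mem_maximalIdeal _).2 h)
    ((IsLocalRing.mem_maximalIdeal _).2 hc)
  simp at this

theorem legendreModel_exists_minimal_eq_smul (h2 : IsUnit (2 : R)) (h0 : c ≠ 0) (h1 : c ≠ 1)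
    (hD : D • W = (legendreModel c).map (algebraMap R K)) :
    ∃ (C : VariableChange K) (u : Rˣ), W.minimal R = C • (legendreModel c).map (algebraMap R K) ∧
      C.u = Units.map (algebraMap R K).toMonoidHom u := by
  refine exists_minimal_eq_smul W _ D hD ?_ ?_
  · rw [legendreModel_Δ, show (16 : R) = 2 ^ 4 by norm_num]
    exact mul_ne_zero (pow_ne_zero _ h2.ne_zero)
      (pow_ne_zero _ (mul_ne_zero h0 (sub_ne_zero.2 h1)))
  · by_cases h : IsUnit (c * (c - 1))
    · exact Or.inl fun a ha hdvd => ha ((isUnit_pow_iff (by norm_num)).1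
        (isUnit_of_dvd_unit hdvd ((isUnit_legendreModel_Δ_iff h2).2 h)))
    · exact Or.inr fun a ha hdvd => ha ((isUnit_pow_iff (by norm_num)).1
        (isUnit_of_dvd_unit hdvd (isUnit_legendreModel_c₄ h2 h)))

theorem localPolynomial_legendreModel_of_not_isUnit (h2 : IsUnit (2 : R)) (h0 : c ≠ 0)
    (hc : ¬IsUnit c) (hD : D • W = (legendreModel c).map (algebraMap R K)) :
    W.localPolynomial R = 1 - X := by
  have h1 : c ≠ 1 := by rintro rfl; exact hc isUnit_one
  have hcc : ¬IsUnit (c * (c - 1)) := fun h => hc (isUnit_of_mul_isUnit_left h)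
  have h2' : (2 : ResidueField R) ≠ 0 := by
    rw [← map_ofNat (residue R), IsLocalRing.residue_ne_zero_iff_isUnit]
    exact h2
  obtain ⟨C, u, hC, hu⟩ := legendreModel_exists_minimal_eq_smul h2 h0 h1 hD
  rw [localPolynomial_eq_of_multiplicative h2' hC hu (mt (isUnit_legendreModel_Δ_iff h2).1 hcc)
    (isUnit_legendreModel_c₄ h2 hcc), if_pos]
  have hc0 : residue R c = 0 := (IsLocalRing.residue_eq_zero_iff _).2 hc
  -- At `c = 0` one has `c₄ = 16` and `c₆ = -64`, so `-c₄ c₆ = 32 ^ 2`.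
  refine ⟨32, ?_⟩
  rw [legendreModel_c₄, legendreModel_c₆]
  simp only [map_neg, map_mul, map_add, map_sub, map_pow, map_one, hc0, map_ofNat (residue R)]
  norm_num

/-- One formula covers all reduction types: when `c` reduces to `0` or `1` the Legendre sum is `-1`
or `-χ(-1)`, which encodes split versus nonsplit reduction since `-c₄ c₆` is there `32 ^ 2` or `-32
^ 2`. -/
theorem localPolynomial_legendreModel [Fintype (ResidueField R)] [DecidableEq (ResidueField R)]
    (h2 : ringChar (ResidueField R) ≠ 2) (h0 : c ≠ 0) (h1 : c ≠ 1)
    (hD : D • W = (legendreModel c).map (algebraMap R K)) :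
    W.localPolynomial R = legendrePoly (residue R c) := by
  have h2' : (2 : ResidueField R) ≠ 0 := Ring.two_ne_zero h2
  have h2u : IsUnit (2 : R) := by
    rw [← IsLocalRing.residue_ne_zero_iff_isUnit, map_ofNat]
    exact h2'
  by_cases hc0 : residue R c = 0
  · rw [localPolynomial_legendreModel_of_not_isUnit h2u h0 ((IsLocalRing.residue_eq_zero_iff _).1 hc0) hD,
      legendrePoly, hc0, legendreSum_zero h2]
    simp [sub_eq_add_neg]
  · obtain ⟨C, u, hC, hu⟩ := legendreModel_exists_minimal_eq_smul h2u h0 h1 hD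
    have hcu : IsUnit c := (IsLocalRing.residue_ne_zero_iff_isUnit _).1 hc0
    by_cases hc1 : residue R c = 1
    · have hcc : ¬IsUnit (c * (c - 1)) := fun h => by
        have := (IsLocalRing.residue_ne_zero_iff_isUnit _).2 (isUnit_of_mul_isUnit_right h)
        simp [hc1] at this
      rw [localPolynomial_eq_of_multiplicative h2' hC hu
        (mt (isUnit_legendreModel_Δ_iff h2u).1 hcc) (isUnit_legendreModel_c₄ h2u hcc),
        legendrePoly, hc1, legendreSum_one h2]
      have hsq : IsSquare (residue R (-((legendreModel c).c₄ * (legendreModel c).c₆))) ↔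
          IsSquare (-1 : ResidueField R) := by
        have : residue R (-((legendreModel c).c₄ * (legendreModel c).c₆)) = -1 * 32 ^ 2 := by
          rw [legendreModel_c₄, legendreModel_c₆]
          simp only [map_neg, map_mul, map_add, map_sub, map_pow, map_one, hc1,
            map_ofNat (residue R)]
          norm_num
        have h32 : (32 : ResidueField R) ≠ 0 := by
          rw [show (32 : ResidueField R) = 2 ^ 5 by norm_num]
          exact pow_ne_zero _ h2'
        rw [this]
        constructor
        · rintro ⟨s, hs⟩
          exact ⟨s / 32, by field_simp; linear_combination hs⟩
        · rintro ⟨s, hs⟩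
          exact ⟨s * 32, by rw [hs]; ring⟩
      by_cases hs : IsSquare (-1 : ResidueField R)
      · rw [if_pos (hsq.2 hs), (quadraticChar_one_iff_isSquare (neg_ne_zero.2 one_ne_zero)).2 hs]
        simp [sub_eq_add_neg]
      · rw [if_neg (mt hsq.1 hs), quadraticChar_neg_one_iff_not_isSquare.2 hs]
        simp
    · have hcc : IsUnit (c * (c - 1)) := hcu.mul ((IsLocalRing.residue_ne_zero_iff_isUnit _).1
        (by rwa [map_sub, map_one, sub_ne_zero]))
      rw [localPolynomial_eq_of_isUnit_Δ h2 hC hu ((isUnit_legendreModel_Δ_iff h2u).2 hcc),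
        legendrePoly, if_neg (by tauto)]
      congr 4
      rw [legendreSum]
      refine Finset.sum_congr rfl fun x _ => ?_
      have h4 : quadraticChar (ResidueField R) 4 = 1 := by
        rw [show (4 : ResidueField R) = 2 ^ 2 by norm_num]
        exact quadraticChar_sq_one' h2'
      rw [← one_mul (quadraticChar _ (x * _ * _)), ← h4, ← map_mul]
      congr 1
      simp only [legendreModel, b₂, b₄, b₆, map_mul, map_add, map_pow, map_one, map_zero,
        map_ofNat (residue R)]
      ring

end LocalFactor
end RatFuncEC

namespace RatFuncEC

open Polynomial Finset WeierstrassCurve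
open IsLocalRing (ResidueField residue)
open IsDedekindDomain (HeightOneSpectrum)

/-! ### The finite places of the rational function field -/

section Places

variable {F : Type*} [Field F]

theorem Place.isUnit_iff (v : Place F) (a : v.ring) : IsUnit a ↔ v.valuation (a : RatFunc F) = 1 :=
  (Valuation.valuationSubring.integers v.valuation).isUnit_iff_valuation_eq_one

theorem legendreCurve_eq (d : ℕ) : legendreCurve F d = legendreModel (RatFunc.X ^ d) := rfl

/-- Polynomials are integral at the finite places. -/
noncomputable def toPlaceRing (p : HeightOneSpectrum F[X]) : F[X] →+* (Place.finite p).ring where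
  toFun f := ⟨algebraMap F[X] (RatFunc F) f, p.valuation_le_one f⟩
  map_one' := Subtype.ext (map_one _)
  map_mul' _ _ := Subtype.ext (map_mul _ _ _)
  map_zero' := Subtype.ext (map_zero _)
  map_add' _ _ := Subtype.ext (map_add _ _ _)

/-- The reduction map from polynomials to the residue field at a finite place. -/
noncomputable def residueMap (p : HeightOneSpectrum F[X]) :
    F[X] →+* ResidueField (Place.finite p).ring :=
  (residue _).comp (toPlaceRing p)

theorem ker_residueMap (p : HeightOneSpectrum F[X]) : RingHom.ker (residueMap p) = p.asIdeal := by
  ext f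
  rw [RingHom.mem_ker, residueMap, RingHom.comp_apply, IsLocalRing.residue_eq_zero_iff,
    IsLocalRing.mem_maximalIdeal, mem_nonunits_iff, Place.isUnit_iff,
    ← p.valuation_lt_one_iff_mem (K := RatFunc F)]
  exact ⟨fun h => lt_of_le_of_ne (p.valuation_le_one f) h, fun h => h.ne⟩

/-- Polynomials approximate every integral element of the valuation ring modulo its maximal ideal.
-/
theorem residueMap_surjective (p : HeightOneSpectrum F[X]) :
    Function.Surjective (residueMap p) := by
  intro y
  obtain ⟨x, rfl⟩ := IsLocalRing.residue_surjective y
  obtain ⟨f, hf⟩ := p.exists_valuation_sub_lt_of_integer (K := RatFunc F) (x := x) x.2 1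
  refine ⟨f, ?_⟩
  rw [residueMap, RingHom.comp_apply, ← sub_eq_zero, ← map_sub, IsLocalRing.residue_eq_zero_iff,
    IsLocalRing.mem_maximalIdeal, mem_nonunits_iff, Place.isUnit_iff]
  exact hf.ne

/-- The residue field at a finite place is a quotient of the polynomial ring. -/
noncomputable def residueEquiv (p : HeightOneSpectrum F[X]) :
    F[X] ⧸ p.asIdeal ≃+* ResidueField (Place.finite p).ring :=
  (Ideal.quotEquivOfEq (ker_residueMap p).symm).trans
    (RingHom.quotientKerEquivOfSurjective (residueMap_surjective p))

theorem exists_monic_irreducible_span (p : HeightOneSpectrum F[X]) :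
    ∃ π : F[X], π.Monic ∧ Irreducible π ∧ p.asIdeal = Ideal.span {π} := by
  classical
  obtain ⟨g, hg⟩ := (inferInstance : p.asIdeal.IsPrincipal)
  have hg0 : g ≠ 0 := by
    rintro rfl
    exact p.ne_bot (by simp [hg])
  have hirr : Irreducible g := by
    have := p.isPrime
    rw [hg, Ideal.submodule_span_eq, Ideal.span_singleton_prime hg0] at this
    exact this.irreducible
  refine ⟨normalize g, monic_normalize hg0, (normalize_associated g).symm.irreducible hirr, ?_⟩
  rw [hg, Ideal.submodule_span_eq, Ideal.span_singleton_eq_span_singleton]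
  exact (normalize_associated g).symm

/-- The place of `F(t)` attached to an irreducible polynomial. -/
noncomputable def primeOfIrreducible {π : F[X]} (hπ : Irreducible π) : HeightOneSpectrum F[X] where
  asIdeal := Ideal.span {π}
  isPrime := (Ideal.span_singleton_prime hπ.ne_zero).2 hπ.prime
  ne_bot := by simpa using hπ.ne_zero

theorem degree_finite {p : HeightOneSpectrum F[X]} {π : F[X]} (hp : p.asIdeal = Ideal.span {π}) :
    (Place.finite p).degree = π.natDegree := by
  rw [Place.degree, hp]
  exact finrank_quotient_span_eq_natDegree

variable [Finite F]

omit [Finite F] in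
theorem natCard_residueField {p : HeightOneSpectrum F[X]} {π : F[X]}
    (hp : p.asIdeal = Ideal.span {π}) :
    Nat.card (ResidueField (Place.finite p).ring) = Nat.card F ^ π.natDegree := by
  have hπ : π ≠ 0 := by rintro rfl; exact p.ne_bot (by simp [hp])
  have : Module.Finite F (AdjoinRoot π) := (AdjoinRoot.powerBasis hπ).finite
  rw [← Nat.card_congr (residueEquiv p).toEquiv,
    ← finrank_quotient_span_eq_natDegree (f := π), hp]
  exact Module.natCard_eq_pow_finrank (K := F) (V := AdjoinRoot π)

instance finite_residueField (p : HeightOneSpectrum F[X]) :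
    Finite (ResidueField (Place.finite p).ring) := by
  obtain ⟨π, -, -, hp⟩ := exists_monic_irreducible_span p
  refine Nat.finite_of_card_ne_zero ?_
  rw [natCard_residueField hp]
  exact pow_ne_zero _ Nat.card_pos.ne'

omit [Finite F] in
theorem ringChar_residueField (p : HeightOneSpectrum F[X]) :
    ringChar (ResidueField (Place.finite p).ring) = ringChar F := by
  let : Algebra F (ResidueField (Place.finite p).ring) := ((residueMap p).comp C).toAlgebra
  exact (Algebra.ringChar_eq F _).symm

omit [Finite F] in
theorem ratFunc_X_pow_ne_one {d : ℕ} (hd : d ≠ 0) : (RatFunc.X : RatFunc F) ^ d ≠ 1 := by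
  rw [← RatFunc.algebraMap_X, ← map_pow, ← map_one (algebraMap F[X] (RatFunc F)),
    (RatFunc.algebraMap_injective F).ne_iff]
  exact fun h => hd (by simpa using congrArg natDegree h)

omit [Finite F] in
theorem coe_toPlaceRing_X_pow (p : HeightOneSpectrum F[X]) (d : ℕ) :
    ((toPlaceRing p X ^ d : (Place.finite p).ring) : RatFunc F) = RatFunc.X ^ d := by
  rw [SubmonoidClass.coe_pow, ← RatFunc.algebraMap_X]
  rfl

omit [Finite F] in
theorem toPlaceRing_X_pow_ne_zero (p : HeightOneSpectrum F[X]) (d : ℕ) :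
    toPlaceRing p X ^ d ≠ 0 := fun h => by
  have := congrArg (fun x : (Place.finite p).ring => (x : RatFunc F)) h
  rw [coe_toPlaceRing_X_pow] at this
  exact pow_ne_zero d RatFunc.X_ne_zero this

omit [Finite F] in
theorem toPlaceRing_X_pow_ne_one (p : HeightOneSpectrum F[X]) {d : ℕ} (hd : d ≠ 0) :
    toPlaceRing p X ^ d ≠ 1 := fun h => by
  have := congrArg (fun x : (Place.finite p).ring => (x : RatFunc F)) h
  rw [coe_toPlaceRing_X_pow] at this
  exact ratFunc_X_pow_ne_one hd this

omit [Finite F] in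
theorem legendreCurve_eq_map (p : HeightOneSpectrum F[X]) (d : ℕ) :
    (1 : VariableChange (RatFunc F)) • legendreCurve F d =
      (legendreModel (toPlaceRing p X ^ d)).map
        (algebraMap (Place.finite p).ring (RatFunc F)) := by
  rw [one_smul, map_legendreModel, legendreCurve_eq, ← coe_toPlaceRing_X_pow p]
  rfl

omit [Finite F] in
theorem localPolynomial_finite (hF : ringChar F ≠ 2) {d : ℕ} (hd : d ≠ 0)
    (p : HeightOneSpectrum F[X]) [Fintype (ResidueField (Place.finite p).ring)]
    [DecidableEq (ResidueField (Place.finite p).ring)] :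
    (legendreCurve F d).localPolynomial (Place.finite p).ring =
      legendrePoly (residueMap p X ^ d) := by
  rw [localPolynomial_legendreModel (by rwa [ringChar_residueField]) (toPlaceRing_X_pow_ne_zero p d)
    (toPlaceRing_X_pow_ne_one p hd) (legendreCurve_eq_map p d), map_pow]
  rfl

/-- The local polynomial of the Legendre curve at a finite place is determined, through its
logarithmic derivative, by the Legendre character sums over finite extensions. -/
theorem exists_logDeriv_localPolynomial_finite (hF : ringChar F ≠ 2) {d : ℕ} (hd : d ≠ 0)
    {p : HeightOneSpectrum F[X]} {π : F[X]} (hp : p.asIdeal = Ideal.span {π}) :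
    ((legendreCurve F d).localPolynomial (Place.finite p).ring).coeff 0 = 1 ∧
    ∃ G : PowerSeries ℤ,
      PowerSeries.X * PowerSeries.derivative ℤ
          (((legendreCurve F d).localPolynomial (Place.finite p).ring : ℤ[X]) : PowerSeries ℤ) =
        G * (((legendreCurve F d).localPolynomial (Place.finite p).ring : ℤ[X]) : PowerSeries ℤ) ∧
      ∀ (K : Type) [Field K] [Fintype K] [DecidableEq K] [Algebra F K] (θ : K), aeval θ π = 0 →
        PowerSeries.coeff (Module.finrank F K / π.natDegree) G = legendreSum K (θ ^ d) := by
  classical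
  let := Fintype.ofFinite (ResidueField (Place.finite p).ring)
  have hκ : ringChar (ResidueField (Place.finite p).ring) ≠ 2 := by rwa [ringChar_residueField]
  rw [localPolynomial_finite hF hd p]
  refine ⟨?_, _, X_mul_derivative_legendrePoly hκ _, ?_⟩
  · simp only [legendrePoly, coeff_add, coeff_one, coeff_C_mul, coeff_X, coeff_X_pow]
    simp
  · intro K _ _ _ _ θ hθ
    have hker : ∀ a ∈ RingHom.ker (residueMap p), aeval θ a = 0 := fun a ha => by
      rw [ker_residueMap, hp, Ideal.mem_span_singleton] at ha
      obtain ⟨b, rfl⟩ := ha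
      rw [map_mul, hθ, zero_mul]
    -- A root `θ` of `π` makes `K` an extension of the residue field `F[t] / π`, with `t ↦ θ`, so
    -- the sums over extensions apply with `c = θ ^ d`.
    let φ : ResidueField (Place.finite p).ring →+* K :=
      RingHom.liftOfSurjective (residueMap p) (residueMap_surjective p)
        ⟨(aeval θ : F[X] →ₐ[F] K).toRingHom, hker⟩
    have hφ : φ (residueMap p X) = θ := by
      rw [RingHom.liftOfSurjective_comp_apply]
      simp
    let : Algebra (ResidueField (Place.finite p).ring) K := φ.toAlgebra
    have hrank : Module.finrank F K / π.natDegree =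
        Module.finrank (ResidueField (Place.finite p).ring) K := by
      have h1 := Module.natCard_eq_pow_finrank (K := F) (V := K)
      have h2 := Module.natCard_eq_pow_finrank (K := ResidueField (Place.finite p).ring) (V := K)
      rw [natCard_residueField hp, h1, ← pow_mul] at h2
      have h3 := Nat.pow_right_injective (Finite.one_lt_card (α := F)) h2
      have hpos : 0 < π.natDegree := Nat.pos_of_ne_zero fun h => by
        rw [h, zero_mul] at h3
        exact Module.finrank_pos.ne' h3
      rw [h3, Nat.mul_div_cancel_left _ hpos]
    rw [PowerSeries.coeff_mk, hrank, primePowerSum_legendreHom hκ, map_pow]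
    congr 2

/-! ### The place at infinity -/

section Infinity

omit [Finite F]

theorem isUnit_two_ring (hF : ringChar F ≠ 2) (v : Place F) : IsUnit (2 : v.ring) := by
  have h2 : (2 : F) ≠ 0 := Ring.two_ne_zero hF
  rw [Place.isUnit_iff]
  have : ((2 : v.ring) : RatFunc F) = RatFunc.C 2 := by
    rw [map_ofNat]
    rfl
  rw [this]
  cases v with
  | finite p =>
    rw [← RatFunc.algebraMap_C]
    refine (p.valuation_eq_one_iff_notMem (K := RatFunc F)).2 fun h => p.isPrime.ne_top ?_
    exact Ideal.eq_top_of_isUnit_mem _ h (isUnit_C.2 (isUnit_iff_ne_zero.2 h2))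
  | infinity =>
    classical
    exact RatFunc.inftyValuation.C F h2

theorem valuation_infinity_X_inv :
    (Place.infinity : Place F).valuation (RatFunc.X⁻¹) = WithZero.exp (-1 : ℤ) := by
  classical
  rw [← one_div]
  exact RatFunc.inftyValuation.X_inv F

/-- The uniformizer `1 / t` at infinity. -/
noncomputable def inftyUniformizer : (Place.infinity : Place F).ring :=
  ⟨RatFunc.X⁻¹, by
    rw [Valuation.mem_valuationSubring_iff, valuation_infinity_X_inv, ← WithZero.exp_zero,
      WithZero.exp_le_exp]
    norm_num⟩

theorem inftyUniformizer_ne_zero : (inftyUniformizer : (Place.infinity : Place F).ring) ≠ 0 :=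
  fun h => inv_ne_zero RatFunc.X_ne_zero (congrArg Subtype.val h)

theorem not_isUnit_inftyUniformizer :
    ¬IsUnit (inftyUniformizer : (Place.infinity : Place F).ring) := by
  rw [Place.isUnit_iff]
  change ¬ Place.infinity.valuation (RatFunc.X⁻¹) = 1
  rw [valuation_infinity_X_inv, ← WithZero.exp_zero]
  exact fun h => by simpa using WithZero.exp_injective h

theorem localPolynomial_infinity_even (hF : ringChar F ≠ 2) {d : ℕ} (hd : d ≠ 0) (he : Even d) :
    (legendreCurve F d).localPolynomial (Place.infinity : Place F).ring = 1 - X := by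
  obtain ⟨e, rfl⟩ := he
  -- Substituting `x = t ^ d x'` turns the parameter `t ^ d` into `t ^ (-d)`; the scaling `u`
  -- satisfies `u ^ 2 = t ^ d`, which requires `d` even.
  refine localPolynomial_legendreModel_of_not_isUnit (c := inftyUniformizer ^ (e + e))
    (D := ⟨Units.mk0 (RatFunc.X ^ e) (pow_ne_zero _ RatFunc.X_ne_zero), 0, 0, 0⟩)
    (isUnit_two_ring hF _) (pow_ne_zero _ inftyUniformizer_ne_zero)
    (mt (isUnit_pow_iff hd).1 not_isUnit_inftyUniformizer) ?_
  have hX : (RatFunc.X : RatFunc F) ≠ 0 := RatFunc.X_ne_zero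
  have hs : algebraMap (Place.infinity : Place F).ring (RatFunc F) inftyUniformizer =
    RatFunc.X⁻¹ := rfl
  rw [map_legendreModel, map_pow, hs, legendreCurve_eq]
  ext <;> simp [variableChange_def, legendreModel]
  · field_simp
    ring
  · field_simp
    ring

theorem localPolynomial_infinity_odd (hF : ringChar F ≠ 2) {d : ℕ} (he : Odd d) :
    (legendreCurve F d).localPolynomial (Place.infinity : Place F).ring = 1 := by
  obtain ⟨e, rfl⟩ := he
  set s : (Place.infinity : Place F).ring := inftyUniformizer with hs
  set d := 2 * e + 1 with hd
  -- For odd `d` the nearest available scaling is `u ^ 2 = t ^ (d + 1)`. The extra factor `s` leaves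
  -- `c₄` with valuation exactly `2`: too small for a fourth power, yet positive, so the model is
  -- minimal and the reduction additive.
  let W₀ : WeierstrassCurve (Place.infinity : Place F).ring := ⟨0, s + s ^ (d + 1), 0, s ^ (d + 2), 0⟩
  have hsu : ¬IsUnit s := not_isUnit_inftyUniformizer
  have h2 := isUnit_two_ring hF (Place.infinity : Place F)
  have h16 : IsUnit (16 : (Place.infinity : Place F).ring) := by
    rw [show (16 : (Place.infinity : Place F).ring) = 2 ^ 4 by norm_num]
    exact h2.pow 4
  have hunit : ∀ x, IsUnit (1 + s * x) := fun x => by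
    by_contra h
    have := (IsLocalRing.maximalIdeal _).sub_mem ((IsLocalRing.mem_maximalIdeal _).2 h)
      (Ideal.mul_mem_right x _ ((IsLocalRing.mem_maximalIdeal _).2 hsu))
    simp at this
  have hΔ : W₀.Δ = 16 * (s ^ (d + 3) * (-1 + s ^ d)) ^ 2 := by
    simp [W₀, Δ, b₂, b₄, b₆, b₈]
    ring
  have hc₄ : W₀.c₄ = s ^ 2 * (16 * (1 + s * (s ^ (2 * e) * (s ^ d - 1)))) := by
    simp [W₀, c₄, b₂, b₄]
    ring
  have hΔ0 : W₀.Δ ≠ 0 := by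
    rw [hΔ]
    refine mul_ne_zero h16.ne_zero (pow_ne_zero _ (mul_ne_zero
      (pow_ne_zero _ inftyUniformizer_ne_zero) ?_))
    have := (hunit (-s ^ (2 * e))).neg
    rw [show -(1 + s * -s ^ (2 * e)) = -1 + s ^ d by rw [hd]; ring] at this
    exact this.ne_zero
  have hcu : IsUnit (16 * (1 + s * (s ^ (2 * e) * (s ^ d - 1)))) := h16.mul (hunit _)
  have hdvd : ∀ a : (Place.infinity : Place F).ring, ¬IsUnit a → s ∣ a := fun a ha => by
    refine (Valuation.valuationSubring.integers (Place.infinity : Place F).valuation).dvd_of_le ?_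
    rw [Place.isUnit_iff] at ha
    have hlt : Place.infinity.valuation (a : RatFunc F) < 1 := lt_of_le_of_ne a.2 ha
    refine le_of_le_of_eq ?_ valuation_infinity_X_inv.symm
    change Place.infinity.valuation (a : RatFunc F) ≤ _
    by_cases h0 : Place.infinity.valuation (a : RatFunc F) = 0
    · rw [h0]
      exact zero_le
    · rw [← WithZero.exp_log h0, ← WithZero.exp_zero, WithZero.exp_lt_exp] at hlt
      rw [← WithZero.exp_log h0, WithZero.exp_le_exp]
      omega
  have hD : (⟨Units.mk0 (RatFunc.X ^ (e + 1)) (pow_ne_zero _ RatFunc.X_ne_zero), 0, 0, 0⟩ :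
      VariableChange (RatFunc F)) • legendreCurve F d = W₀.map (algebraMap _ _) := by
    have hX : (RatFunc.X : RatFunc F) ≠ 0 := RatFunc.X_ne_zero
    have hs' : ((s : (Place.infinity : Place F).ring) : RatFunc F) = RatFunc.X⁻¹ := rfl
    rw [legendreCurve_eq]
    ext <;> simp [variableChange_def, legendreModel, W₀, hs', hd]
    · field_simp
      ring
    · field_simp
      ring
  obtain ⟨C, u, hC, hu⟩ := exists_minimal_eq_smul _ W₀ _ hD hΔ0 (Or.inr fun a ha hda => by
    have h4 : s ^ 2 * s ^ 2 ∣ s ^ 2 * (16 * (1 + s * (s ^ (2 * e) * (s ^ d - 1)))) := by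
      rw [← hc₄, ← pow_add]
      exact (pow_dvd_pow_of_dvd (hdvd a ha) 4).trans hda
    exact hsu ((isUnit_pow_iff two_ne_zero).1 (isUnit_of_dvd_unit ((mul_dvd_mul_iff_left
      (pow_ne_zero 2 inftyUniformizer_ne_zero)).1 h4) hcu)))
  refine localPolynomial_eq_one hC hu (fun h => hsu ?_) fun h => hsu ?_
  · rw [hΔ] at h
    exact (isUnit_pow_iff (by omega)).1 (isUnit_of_mul_isUnit_left ((isUnit_pow_iff two_ne_zero).1
      (isUnit_of_mul_isUnit_right h)))
  · rw [hc₄] at h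
    exact (isUnit_pow_iff two_ne_zero).1 (isUnit_of_mul_isUnit_left h)

end Infinity

/-! ### The minimal discriminant and a lower bound for the height -/

section Height

omit [Finite F]

theorem ord_minimal_Δ_nonneg (W : WeierstrassCurve (RatFunc F)) (v : Place F) :
    0 ≤ v.ord (W.minimal v.ring).Δ := by
  obtain ⟨r, hr⟩ := Δ_integral_of_isIntegral v.ring (W.minimal v.ring)
  have h : v.valuation (W.minimal v.ring).Δ ≤ 1 := by
    rw [← hr]
    exact r.2
  rw [Place.ord, neg_nonneg]
  by_cases h0 : v.valuation (W.minimal v.ring).Δ = 0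
  · simp [h0]
  · rwa [← WithZero.exp_log h0, ← WithZero.exp_zero, WithZero.exp_le_exp] at h

theorem valuation_minimal_Δ_finite (hF : ringChar F ≠ 2) {d : ℕ} (hd : d ≠ 0)
    (p : HeightOneSpectrum F[X]) :
    (Place.finite p).valuation ((legendreCurve F d).minimal (Place.finite p).ring).Δ =
      p.intValuation (16 * (X ^ d * (X ^ d - 1)) ^ 2) := by
  obtain ⟨C, u, hC, hu⟩ := legendreModel_exists_minimal_eq_smul
    (isUnit_two_ring hF (Place.finite p)) (toPlaceRing_X_pow_ne_zero p d)
    (toPlaceRing_X_pow_ne_one p hd) (legendreCurve_eq_map p d)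
  rw [hC, variableChange_Δ, map_Δ, map_mul, map_pow, hu, ← map_inv]
  have h1 := (Place.isUnit_iff (Place.finite p) _).1 (u⁻¹).isUnit
  have h2 : (Place.finite p).valuation (algebraMap (Place.finite p).ring (RatFunc F)
      (legendreModel (toPlaceRing p X ^ d)).Δ) =
      p.intValuation (16 * (X ^ d * (X ^ d - 1)) ^ 2) := by
    rw [legendreModel_Δ, ← p.valuation_of_algebraMap (K := RatFunc F)]
    congr 1
    rw [show (16 : (Place.finite p).ring) * (toPlaceRing p X ^ d * (toPlaceRing p X ^ d - 1)) ^ 2 =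
      toPlaceRing p (16 * (X ^ d * (X ^ d - 1)) ^ 2) by
        simp only [map_mul, map_pow, map_sub, map_one, map_ofNat (toPlaceRing p)]]
    rfl
  rw [h2]
  refine (congrArg (· * _) ?_).trans (one_mul _)
  change (Place.finite p).valuation (((u⁻¹ : _) : (Place.finite p).ring) : RatFunc F) ^ 12 = 1
  rw [h1, one_pow]

theorem isUnit_sixteen (hF : ringChar F ≠ 2) : IsUnit (16 : F[X]) := by
  have h2 : (2 : F) ≠ 0 := Ring.two_ne_zero hF
  rw [show (16 : F[X]) = C (2 ^ 4) by rw [map_pow, map_ofNat]; norm_num]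
  exact isUnit_C.2 (isUnit_iff_ne_zero.2 (pow_ne_zero _ h2))

/-- Needed because a `finsum` with infinite support has the default value `0`. -/
theorem finite_support_ord_minimal_Δ (hF : ringChar F ≠ 2) {d : ℕ} (hd : d ≠ 0) :
    (Function.support fun v : Place F =>
      v.ord ((legendreCurve F d).minimal v.ring).Δ * (v.degree : ℤ)).Finite := by
  set g : F[X] := 16 * (X ^ d * (X ^ d - 1)) ^ 2 with hg
  have hg0 : g ≠ 0 := by
    refine mul_ne_zero (isUnit_sixteen hF).ne_zero (pow_ne_zero _ (mul_ne_zero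
      (pow_ne_zero _ X_ne_zero) ?_))
    rw [← C_1]
    exact X_pow_sub_C_ne_zero (Nat.pos_of_ne_zero hd) 1
  have hfin : {p : HeightOneSpectrum F[X] | p.asIdeal ∣ Ideal.span {g}}.Finite :=
    Ideal.finite_factors (by simpa using hg0)
  refine ((hfin.image Place.finite).insert Place.infinity).subset fun v hv => ?_
  cases v with
  | infinity => exact Set.mem_insert _ _
  | finite p =>
    refine Set.mem_insert_of_mem _ ⟨p, ?_, rfl⟩
    rw [Set.mem_ofPred_eq, ← p.intValuation_lt_one_iff_dvd]
    refine lt_of_le_of_ne (p.intValuation_le_one g) fun h => hv ?_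
    dsimp only
    rw [Place.ord, valuation_minimal_Δ_finite hF hd, h]
    simp

/-- The place `t = 0` alone contributes `2 d`, and all other contributions are nonnegative. -/
theorem two_mul_le_minimalDiscriminantDegree (hF : ringChar F ≠ 2) {d : ℕ} (hd : d ≠ 0) :
    (2 * d : ℤ) ≤ minimalDiscriminantDegree (legendreCurve F d) := by
  set p : HeightOneSpectrum F[X] := primeOfIrreducible irreducible_X with hp
  have hpX : p.asIdeal = Ideal.span {X} := rfl
  have hX : p.intValuation X = WithZero.exp (-1 : ℤ) := p.intValuation_singleton X_ne_zero hpX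
  have h1 : p.intValuation (X ^ d - 1) = 1 := by
    rw [HeightOneSpectrum.intValuation_eq_one_iff, hpX, Ideal.mem_span_singleton, X_dvd_iff]
    simp [hd.symm]
  have h16 : p.intValuation 16 = 1 := by
    rw [HeightOneSpectrum.intValuation_eq_one_iff]
    exact fun h => p.isPrime.ne_top (Ideal.eq_top_of_isUnit_mem _ h (isUnit_sixteen hF))
  have hord : (Place.finite p).ord ((legendreCurve F d).minimal (Place.finite p).ring).Δ *
      ((Place.finite p).degree : ℤ) = 2 * d := by
    rw [Place.ord, valuation_minimal_Δ_finite hF hd, degree_finite hpX, map_mul, map_pow, map_mul,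
      map_pow, h1, h16, hX, mul_one, one_mul, ← pow_mul, WithZero.log_pow, WithZero.log_exp]
    simp
    ring
  rw [minimalDiscriminantDegree, finsum_eq_sum _ (finite_support_ord_minimal_Δ hF hd), ← hord]
  refine Finset.single_le_sum (f := fun v : Place F =>
    v.ord ((legendreCurve F d).minimal v.ring).Δ * (v.degree : ℤ))
    (fun v _ => mul_nonneg (ord_minimal_Δ_nonneg _ v) (Int.natCast_nonneg _)) ?_
  rw [Set.Finite.mem_toFinset, Function.mem_support, hord]
  positivity

theorem mul_log_le_log_height [Finite F] (hF : ringChar F ≠ 2) {d : ℕ} (hd : d ≠ 0) :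
    (d : ℝ) / 6 * Real.log (Nat.card F) ≤ Real.log (height (legendreCurve F d)) := by
  have hq : (1 : ℝ) < Nat.card F := by exact_mod_cast Finite.one_lt_card
  rw [height, Real.log_rpow (by linarith)]
  refine mul_le_mul_of_nonneg_right ?_ (Real.log_pos hq).le
  have : (2 * d : ℝ) ≤ minimalDiscriminantDegree (legendreCurve F d) := by
    exact_mod_cast two_mul_le_minimalDiscriminantDegree hF hd
  linarith

end Height

end Places
end RatFuncEC

namespace RatFuncEC

open Polynomial Finset WeierstrassCurve
open IsDedekindDomain (HeightOneSpectrum)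

/-! ### Logarithmic derivatives of Euler factors -/

section EulerProduct

/-- The power series `m * G (T ^ m)`. -/
noncomputable def mulExpand (m : ℕ) (G : PowerSeries ℤ) : PowerSeries ℤ :=
  PowerSeries.mk fun n => if m ∣ n then (m : ℤ) * PowerSeries.coeff (n / m) G else 0

theorem coe_expand_eq {m : ℕ} (hm : m ≠ 0) (f : ℤ[X]) :
    ((expand ℤ m f : ℤ[X]) : PowerSeries ℤ) = PowerSeries.expand m hm (f : PowerSeries ℤ) := by
  ext n
  rw [coeff_coe, coeff_expand (Nat.pos_of_ne_zero hm), PowerSeries.coeff_expand, coeff_coe]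

theorem X_mul_derivative_expand {m : ℕ} (hm : m ≠ 0) {f : ℤ[X]} {G : PowerSeries ℤ}
    (h : PowerSeries.X * PowerSeries.derivative ℤ (f : PowerSeries ℤ) = G * (f : PowerSeries ℤ)) :
    PowerSeries.X * PowerSeries.derivative ℤ ((expand ℤ m f : ℤ[X]) : PowerSeries ℤ) =
      mulExpand m G * ((expand ℤ m f : ℤ[X]) : PowerSeries ℤ) := by
  have h1 : mulExpand m G = PowerSeries.C (m : ℤ) * PowerSeries.expand m hm G := by
    ext n
    simp only [mulExpand, PowerSeries.coeff_mk, PowerSeries.coeff_C_mul, PowerSeries.coeff_expand,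
      mul_ite, mul_zero]
  rw [h1, coe_expand_eq hm, mul_assoc, ← map_mul, ← h]
  ext n
  rw [coeff_X_mul_derivative, PowerSeries.coeff_C_mul, PowerSeries.coeff_expand,
    PowerSeries.coeff_expand]
  split_ifs with hn
  · obtain ⟨j, rfl⟩ := hn
    rw [Nat.mul_div_cancel_left _ (Nat.pos_of_ne_zero hm), coeff_X_mul_derivative]
    push_cast
    ring
  · simp

theorem X_mul_derivative_of_mul_eq_one {E P H : PowerSeries ℤ} (hEP : E * P = 1)
    (h : PowerSeries.X * PowerSeries.derivative ℤ P = H * P) :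
    PowerSeries.X * PowerSeries.derivative ℤ E = -H * E := by
  have hP : P ≠ 0 := right_ne_zero_of_mul_eq_one hEP
  have h0 := congrArg (PowerSeries.derivative ℤ) hEP
  rw [Derivation.leibniz, Derivation.map_one_eq_zero, smul_eq_mul, smul_eq_mul] at h0
  refine mul_right_cancel₀ hP ?_
  linear_combination PowerSeries.X * h0 - E * h

theorem X_mul_derivative_prod {R ι : Type*} [CommRing R] (s : Finset ι) {E H : ι → PowerSeries R}
    (h : ∀ v ∈ s, PowerSeries.X * PowerSeries.derivative R (E v) = H v * E v) :
    PowerSeries.X * PowerSeries.derivative R (∏ v ∈ s, E v) = (∑ v ∈ s, H v) * ∏ v ∈ s, E v := by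
  classical
  induction s using Finset.induction_on with
  | empty => simp
  | insert a s ha ih =>
    rw [Finset.prod_insert ha, Finset.sum_insert ha, Derivation.leibniz, smul_eq_mul, smul_eq_mul]
    linear_combination E a * ih (fun v hv => h v (mem_insert_of_mem hv)) +
      (∏ v ∈ s, E v) * h a (mem_insert_self a s)

theorem X_pow_dvd_prod_sub_one {ι : Type*} (s : Finset ι) {E : ι → PowerSeries ℤ} {n : ℕ}
    (h : ∀ v ∈ s, PowerSeries.X ^ n ∣ E v - 1) : PowerSeries.X ^ n ∣ ∏ v ∈ s, E v - 1 := by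
  classical
  induction s using Finset.induction_on with
  | empty => simp
  | insert a s ha ih =>
    rw [Finset.prod_insert ha, show E a * ∏ v ∈ s, E v - 1 =
      (E a - 1) * ∏ v ∈ s, E v + (∏ v ∈ s, E v - 1) by ring]
    exact dvd_add ((h a (mem_insert_self a s)).mul_right _)
      (ih fun v hv => h v (mem_insert_of_mem hv))

end EulerProduct

/-! ### Places of bounded degree -/

section PlacesOfBoundedDegree

variable {F : Type*} [Field F]

open scoped Classical in
/-- The place attached to an irreducible polynomial. -/
noncomputable def toPlace (π : F[X]) : Place F :=
  if h : Irreducible π then .finite (primeOfIrreducible h) else .infinity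

theorem toPlace_of_irreducible {π : F[X]} (h : Irreducible π) :
    toPlace π = .finite (primeOfIrreducible h) := dif_pos h

theorem degree_toPlace {π : F[X]} (h : Irreducible π) : (toPlace π).degree = π.natDegree := by
  rw [toPlace_of_irreducible h]
  exact degree_finite rfl

theorem toPlace_injOn : Set.InjOn (toPlace (F := F)) {π | π.Monic ∧ Irreducible π} := by
  rintro π ⟨hm, hπ⟩ ρ ⟨hm', hρ⟩ h
  rw [toPlace_of_irreducible hπ, toPlace_of_irreducible hρ, Place.finite.injEq] at h
  have h' : Ideal.span {π} = Ideal.span {ρ} := congrArg HeightOneSpectrum.asIdeal h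
  rw [Ideal.span_singleton_eq_span_singleton] at h'
  exact eq_of_monic_of_associated hm hm' h'

variable [Finite F]

open scoped Classical in
variable (F) in
/-- The places of degree at most `n`, together with the place at infinity. -/
noncomputable def placesLE (n : ℕ) : Finset (Place F) :=
  insert .infinity (((Icc 1 n).biUnion (irreds F)).image toPlace)

/-- Infinity always belongs to `placesLE F n` and has degree `1`, hence the condition `1 ≤ n`. -/
theorem mem_placesLE {n : ℕ} (hn : 1 ≤ n) {v : Place F} : v ∈ placesLE F n ↔ v.degree ≤ n := by
  cases v with
  | infinity => simpa [placesLE, Place.degree] using hn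
  | finite p =>
    obtain ⟨π, hm, hirr, hp⟩ := exists_monic_irreducible_span p
    have hpl : Place.finite p = toPlace π := by
      rw [toPlace_of_irreducible hirr]
      congr 1
      exact HeightOneSpectrum.ext hp
    rw [degree_finite hp]
    simp only [placesLE, mem_insert, reduceCtorEq, false_or, mem_image, mem_biUnion, mem_Icc,
      mem_irreds]
    constructor
    · rintro ⟨ρ, ⟨i, ⟨h1, h2⟩, hρm, hρ, hρi⟩, hρp⟩
      rw [hpl] at hρp
      rw [← toPlace_injOn ⟨hρm, hρi⟩ ⟨hm, hirr⟩ hρp, hρ]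
      exact h2
    · exact fun h => ⟨π, ⟨_, ⟨hirr.natDegree_pos, h⟩, hm, rfl, hirr⟩, hpl.symm⟩

theorem sum_placesLE {M : Type*} [AddCommMonoid M] (n : ℕ) (f : Place F → M) :
    ∑ v ∈ placesLE F n, f v =
      f .infinity + ∑ i ∈ Icc 1 n, ∑ π ∈ irreds F i, f (toPlace π) := by
  classical
  rw [placesLE, Finset.sum_insert, Finset.sum_image, Finset.sum_biUnion]
  · intro i _ j _ hij
    rw [Function.onFun, Finset.disjoint_left]
    intro π hi hj
    exact hij ((mem_irreds.1 hi).2.1.symm.trans (mem_irreds.1 hj).2.1)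
  · intro π hπ ρ hρ h
    simp only [coe_biUnion, Set.mem_iUnion, mem_coe, mem_irreds] at hπ hρ
    obtain ⟨_, _, h1, _, h2⟩ := hπ
    obtain ⟨_, _, h3, _, h4⟩ := hρ
    exact toPlace_injOn ⟨h1, h2⟩ ⟨h3, h4⟩ h
  · simp only [mem_image, mem_biUnion, mem_irreds, not_exists, not_and]
    rintro π ⟨_, _, _, _, h⟩
    rw [toPlace_of_irreducible h]
    exact fun h => by cases h

omit [Finite F] in
theorem Place.degree_pos (v : Place F) : 0 < v.degree := by
  cases v with
  | infinity => exact one_pos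
  | finite p =>
    obtain ⟨π, hm, hirr, hp⟩ := exists_monic_irreducible_span p
    rw [degree_finite hp]
    exact hirr.natDegree_pos

end PlacesOfBoundedDegree

/-! ### The logarithmic derivative of the `L`-function -/

section LFunction

variable {F : Type*} [Field F] [Finite F]

/-- The local polynomial, as a power series in the global variable. -/
noncomputable def globalLocalPolynomial (W : WeierstrassCurve (RatFunc F)) (v : Place F) :
    PowerSeries ℤ :=
  ((expand ℤ v.degree (W.localPolynomial v.ring) : ℤ[X]) : PowerSeries ℤ)

variable {W : WeierstrassCurve (RatFunc F)}

omit [Finite F] in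
theorem constantCoeff_globalLocalPolynomial {v : Place F}
    (h : (W.localPolynomial v.ring).coeff 0 = 1) :
    PowerSeries.constantCoeff (globalLocalPolynomial W v) = 1 := by
  rw [globalLocalPolynomial, ← PowerSeries.coeff_zero_eq_constantCoeff_apply, coeff_coe,
    coeff_expand v.degree_pos]
  simpa using h

omit [Finite F] in
theorem eulerFactor_mul {v : Place F} (h : (W.localPolynomial v.ring).coeff 0 = 1) :
    eulerFactor W v * globalLocalPolynomial W v = 1 := by
  rw [mul_comm]
  exact PowerSeries.mul_invOfUnit _ 1 (constantCoeff_globalLocalPolynomial h)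

omit [Finite F] in
theorem X_pow_degree_dvd_eulerFactor_sub_one {v : Place F}
    (h : (W.localPolynomial v.ring).coeff 0 = 1) :
    PowerSeries.X ^ v.degree ∣ eulerFactor W v - 1 := by
  have h1 : PowerSeries.X ^ v.degree ∣ globalLocalPolynomial W v - 1 := by
    rw [PowerSeries.X_pow_dvd_iff]
    intro m hm
    rw [map_sub, globalLocalPolynomial, coeff_coe, coeff_expand v.degree_pos]
    rcases Nat.eq_zero_or_pos m with rfl | hpos
    · simp [h]
    · rw [if_neg fun hd => absurd (Nat.le_of_dvd hpos hd) (not_le.2 hm), PowerSeries.coeff_one,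
        if_neg hpos.ne', sub_zero]
  have h2 := eulerFactor_mul h
  rw [show eulerFactor W v - 1 = -(eulerFactor W v) * (globalLocalPolynomial W v - 1) by
    linear_combination h2]
  exact h1.mul_left _

open scoped Classical in
-- Factors at places of degree above `n` are `1` modulo `T ^ (n + 1)`, so one finite product serves
-- for all coefficients up to `N`.
theorem coeff_lFunction (hW : ∀ v : Place F, (W.localPolynomial v.ring).coeff 0 = 1) {n N : ℕ}
    (hn : n ≤ N) (hN : 1 ≤ N) :
    PowerSeries.coeff n (lFunction W) =
      PowerSeries.coeff n (∏ v ∈ placesLE F N, eulerFactor W v) := by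
  have h1 : (∏ᶠ (v : Place F) (_ : v.degree ≤ n), eulerFactor W v) =
      ∏ v ∈ placesLE F N with v.degree ≤ n, eulerFactor W v :=
    finprod_cond_eq_prod_of_cond_iff _ fun {v} _ => by
      rw [mem_filter, mem_placesLE hN]
      exact ⟨fun h => ⟨h.trans hn, h⟩, And.right⟩
  rw [lFunction, PowerSeries.coeff_mk, h1,
    ← Finset.prod_filter_mul_prod_filter_not (placesLE F N) (fun v => v.degree ≤ n)]
  have h2 : PowerSeries.X ^ (n + 1) ∣
      ∏ v ∈ placesLE F N with ¬ v.degree ≤ n, eulerFactor W v - 1 :=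
    X_pow_dvd_prod_sub_one _ fun v hv =>
      (pow_dvd_pow _ (not_le.1 (mem_filter.1 hv).2)).trans
        (X_pow_degree_dvd_eulerFactor_sub_one (hW v))
  have h3 := PowerSeries.X_pow_dvd_iff.1
    (h2.mul_left (∏ v ∈ placesLE F N with v.degree ≤ n, eulerFactor W v)) n n.lt_succ_self
  rw [mul_sub, mul_one, map_sub, sub_eq_zero] at h3
  exact h3.symm

/-- Makes the coefficients independent of the truncation `N`. At `i = 0` the two sets of places
differ, but both sums vanish. -/
theorem coeff_sum_placesLE {H : Place F → PowerSeries ℤ}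
    (h0 : ∀ v, PowerSeries.coeff 0 (H v) = 0) {i N : ℕ} (hi : i ≤ N) :
    ∑ v ∈ placesLE F N, PowerSeries.coeff i (mulExpand v.degree (H v)) =
      ∑ v ∈ placesLE F i, PowerSeries.coeff i (mulExpand v.degree (H v)) := by
  rcases Nat.eq_zero_or_pos i with rfl | hpos
  · simp [mulExpand, h0]
  · refine (Finset.sum_subset (fun v hv => ?_) fun v _ hv => ?_).symm
    · rw [mem_placesLE hpos] at hv
      exact (mem_placesLE (hpos.trans_le hi)).2 (hv.trans hi)
    · rw [mem_placesLE hpos] at hv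
      rw [mulExpand, PowerSeries.coeff_mk, if_neg fun hd => hv (Nat.le_of_dvd hpos hd)]

omit [Finite F] in
theorem coeff_zero_of_logDeriv (hW : ∀ v : Place F, (W.localPolynomial v.ring).coeff 0 = 1)
    {G : Place F → PowerSeries ℤ}
    (hG : ∀ v, PowerSeries.X * PowerSeries.derivative ℤ
      ((W.localPolynomial v.ring : ℤ[X]) : PowerSeries ℤ) =
        G v * ((W.localPolynomial v.ring : ℤ[X]) : PowerSeries ℤ)) (v : Place F) :
    PowerSeries.coeff 0 (G v) = 0 := by
  have := congrArg (PowerSeries.coeff 0) (hG v)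
  rw [coeff_X_mul_derivative, Nat.cast_zero, zero_mul, PowerSeries.coeff_mul] at this
  simpa [hW v] using this.symm

theorem X_mul_derivative_lFunction (hW : ∀ v : Place F, (W.localPolynomial v.ring).coeff 0 = 1)
    {G : Place F → PowerSeries ℤ}
    (hG : ∀ v, PowerSeries.X * PowerSeries.derivative ℤ
      ((W.localPolynomial v.ring : ℤ[X]) : PowerSeries ℤ) =
        G v * ((W.localPolynomial v.ring : ℤ[X]) : PowerSeries ℤ)) (n : ℕ) :
    (n : ℤ) * PowerSeries.coeff n (lFunction W) =
      ∑ p ∈ antidiagonal n, (-∑ v ∈ placesLE F p.1, PowerSeries.coeff p.1 (mulExpand v.degree (G v))) *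
        PowerSeries.coeff p.2 (lFunction W) := by
  have h0 := coeff_zero_of_logDeriv hW hG
  have h1 := X_mul_derivative_prod (placesLE F (n + 1)) (E := eulerFactor W)
    (H := fun v => -mulExpand v.degree (G v)) fun v _ =>
      X_mul_derivative_of_mul_eq_one (eulerFactor_mul (hW v))
        (X_mul_derivative_expand v.degree_pos.ne' (hG v))
  have h2 := congrArg (PowerSeries.coeff n) h1
  rw [coeff_X_mul_derivative, PowerSeries.coeff_mul,
    ← coeff_lFunction hW n.le_succ n.succ_pos] at h2
  refine h2.trans (Finset.sum_congr rfl fun p hp => ?_)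
  have hp' := mem_antidiagonal.1 hp
  rw [coeff_lFunction hW (N := n + 1) (by omega) n.succ_pos,
    ← coeff_sum_placesLE h0 (i := p.1) (N := n + 1) (by omega), Finset.sum_neg_distrib, map_neg,
    map_sum]

omit [Finite F] in
theorem coeff_zero_lFunction :
    PowerSeries.coeff 0 (lFunction W) = 1 := by
  classical
  have h1 : (∏ᶠ (v : Place F) (_ : v.degree ≤ 0), eulerFactor W v) = 1 := by
    have h := finprod_cond_eq_prod_of_cond_iff (eulerFactor W)
      (p := fun v : Place F => v.degree ≤ 0) (t := ∅) fun {v} _ => by simp [v.degree_pos.ne']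
    rw [h, Finset.prod_empty]
  rw [lFunction, PowerSeries.coeff_mk, h1, PowerSeries.coeff_zero_one]

/-- The logarithmic derivative of the `L`-function of the Legendre curve, in terms of Legendre
character sums over the finite extensions of the field of constants. -/
theorem logDeriv_lFunction_legendreCurve (hF : ringChar F ≠ 2) {d : ℕ} (hd : d ≠ 0) :
    PowerSeries.coeff 0 (lFunction (legendreCurve F d)) = 1 ∧
    ∃ A : ℕ → ℤ, A 0 = 0 ∧
      (∀ (K : Type) [Field K] [Fintype K] [DecidableEq K] [Algebra F K],
        A (Module.finrank F K) = (if Even d then 1 else 0) - ∑ θ : K, legendreSum K (θ ^ d)) ∧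
      ∀ n : ℕ, (n : ℤ) * PowerSeries.coeff n (lFunction (legendreCurve F d)) =
        ∑ p ∈ antidiagonal n,
          A p.1 * PowerSeries.coeff p.2 (lFunction (legendreCurve F d)) := by
  classical
  have key : ∀ v : Place F, ((legendreCurve F d).localPolynomial v.ring).coeff 0 = 1 ∧
      ∃ G : PowerSeries ℤ, PowerSeries.X * PowerSeries.derivative ℤ
        (((legendreCurve F d).localPolynomial v.ring : ℤ[X]) : PowerSeries ℤ) =
          G * (((legendreCurve F d).localPolynomial v.ring : ℤ[X]) : PowerSeries ℤ) ∧
        (v = .infinity → ∀ n ≠ 0, PowerSeries.coeff n G = -if Even d then 1 else 0) ∧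
        ∀ π : F[X], π.Monic → Irreducible π → v = toPlace π →
          ∀ (K : Type) [Field K] [Fintype K] [DecidableEq K] [Algebra F K] (θ : K),
            aeval θ π = 0 →
              PowerSeries.coeff (Module.finrank F K / π.natDegree) G = legendreSum K (θ ^ d) := by
    intro v
    cases v with
    | infinity =>
      have hpl : ∀ π : F[X], Irreducible π → (Place.infinity : Place F) ≠ toPlace π := by
        intro π hπ h
        rw [toPlace_of_irreducible hπ] at h
        cases h
      rcases Nat.even_or_odd d with he | ho
      · rw [localPolynomial_infinity_even hF hd he]
        refine ⟨by simp, PowerSeries.mk fun n => if n = 0 then 0 else -1, ?_, ?_,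
          fun π _ hπ h => absurd h (hpl π hπ)⟩
        · have hX : ((X : ℤ[X]) : PowerSeries ℤ) = PowerSeries.X := Polynomial.coe_X
          rw [Polynomial.coe_sub, Polynomial.coe_one, hX, map_sub, Derivation.map_one_eq_zero, PowerSeries.derivative_X,
            zero_sub, mul_neg, mul_one, mul_sub, mul_one]
          ext n
          cases n with
          | zero => simp
          | succ n =>
            rw [map_sub, PowerSeries.coeff_succ_mul_X]
            cases n with
            | zero => simp
            | succ n => simp [PowerSeries.coeff_X]
        · intro _ n hn
          simp [hn, he]
      · rw [localPolynomial_infinity_odd hF ho]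
        refine ⟨by simp, 0, by simp, fun _ n _ => ?_, fun π _ hπ h => absurd h (hpl π hπ)⟩
        simp [Nat.not_even_iff_odd.2 ho]
    | finite p =>
      obtain ⟨ρ, hρm, hρ, hp⟩ := exists_monic_irreducible_span p
      obtain ⟨h0, G, hG, hK⟩ := exists_logDeriv_localPolynomial_finite hF hd hp
      refine ⟨h0, G, hG, fun h => absurd h (by simp), fun π hm hπ h => ?_⟩
      have : ρ = π := by
        refine toPlace_injOn ⟨hρm, hρ⟩ ⟨hm, hπ⟩ (Eq.trans ?_ h)
        rw [toPlace_of_irreducible hρ]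
        congr 1
        exact HeightOneSpectrum.ext hp.symm
      subst this
      exact hK
  choose h0 G hG hinf hfin using key
  refine ⟨coeff_zero_lFunction,
    fun n => -∑ v ∈ placesLE F n, PowerSeries.coeff n (mulExpand v.degree (G v)), ?_, ?_,
    X_mul_derivative_lFunction h0 hG⟩
  · have hG0 : ∀ v, PowerSeries.coeff 0 (G v) = 0 := coeff_zero_of_logDeriv h0 hG
    simp [mulExpand, hG0]
  · intro K _ _ _ _
    set n := Module.finrank F K with hn
    have hpos : 0 < n := Module.finrank_pos
    simp only [sum_placesLE]
    have h1 : PowerSeries.coeff n (mulExpand (Place.infinity : Place F).degree (G .infinity)) =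
        -if Even d then 1 else 0 := by
      rw [mulExpand, PowerSeries.coeff_mk, show (Place.infinity : Place F).degree = 1 from rfl,
        if_pos (one_dvd n), Nat.div_one, hinf _ rfl n hpos.ne', Nat.cast_one, one_mul]
    have h2 : ∑ i ∈ Icc 1 n, ∑ π ∈ irreds F i,
        PowerSeries.coeff n (mulExpand (toPlace π).degree (G (toPlace π))) =
          ∑ θ : K, legendreSum K (θ ^ d) := by
      -- Only places of degree `i ∣ n` reach the coefficient of `T ^ n`, each with weight `i`; such
      -- a place accounts for the `i` elements of `K` having its polynomial as minimal polynomial.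
      have h3 := sum_minpoly (K := K)
        (fun π : F[X] => PowerSeries.coeff (n / π.natDegree) (G (toPlace π)))
      rw [← hn] at h3
      have h4 : ∀ θ : K, PowerSeries.coeff (n / (minpoly F θ).natDegree)
          (G (toPlace (minpoly F θ))) = legendreSum K (θ ^ d) := fun θ =>
        hfin _ _ (minpoly.monic (.of_finite F θ)) (minpoly.irreducible (.of_finite F θ)) rfl K θ
          (minpoly.aeval F θ)
      rw [Finset.sum_congr rfl fun θ _ => h4 θ] at h3
      rw [h3]
      symm
      refine Finset.sum_subset_zero_on_sdiff (fun i hi => ?_) (fun i hi => ?_) (fun i hi => ?_)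
      · rw [Nat.mem_divisors] at hi
        exact mem_Icc.2 ⟨Nat.pos_of_dvd_of_pos hi.1 hpos, Nat.le_of_dvd hpos hi.1⟩
      · refine Finset.sum_eq_zero fun π hπ => ?_
        rw [mem_irreds] at hπ
        rw [mem_sdiff, Nat.mem_divisors] at hi
        rw [mulExpand, PowerSeries.coeff_mk, degree_toPlace hπ.2.2,
          hπ.2.1, if_neg fun h => hi.2 ⟨h, hpos.ne'⟩]
      · refine Finset.sum_congr rfl fun π hπ => ?_
        rw [mem_irreds] at hπ
        rw [mulExpand, PowerSeries.coeff_mk, degree_toPlace hπ.2.2,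
          hπ.2.1, if_pos (Nat.dvd_of_mem_divisors hi), nsmul_eq_mul]
    rw [h1, h2]
    ring

end LFunction
end RatFuncEC

namespace RatFuncEC

open Finset

/-! ### Characters of order dividing `d`, compatible across finite fields -/

section PowChar

variable {d : ℕ} [NeZero d] {E : Type*} [Field E] {K : Type*} [Field K] [Finite K]

/-- The homomorphism `z ↦ z ^ (m (#K - 1) / d)`, with values in the `d`-th roots of unity of an
extension. -/
noncomputable def powHom (φ : K →+* E) (m : ℕ) (h : d ∣ (Nat.card K - 1) * m) :
    Kˣ →* rootsOfUnity d E :=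
  ((Units.map (φ : K →* E)).comp (powMonoidHom ((Nat.card K - 1) * m / d))).codRestrict
    (rootsOfUnity d E) fun z => by
      rw [mem_rootsOfUnity, MonoidHom.comp_apply, powMonoidHom_apply, ← map_pow, ← pow_mul,
        Nat.div_mul_cancel h, pow_mul, ← Nat.card_units, pow_card_eq_one', one_pow, map_one]

open scoped Classical in
/-- The multiplicative character `z ↦ ω (z ^ (m (#K - 1) / d))`. -/
noncomputable def powChar (ω : rootsOfUnity d E →* ℂˣ) (φ : K →+* E) (m : ZMod d) : MulChar K ℂ :=
  if h : d ∣ (Nat.card K - 1) * m.val then MulChar.ofUnitHom (ω.comp (powHom φ m.val h)) else 1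

variable (d K) in
/-- The classes `m` for which `m (#K - 1) / d` is an integer. -/
noncomputable def powSupport : AddSubgroup (ZMod d) :=
  (AddMonoidHom.mulLeft ((Nat.card K - 1 : ℕ) : ZMod d)).ker

omit [NeZero d] [Field K] [Finite K] in
theorem mem_powSupport {m : ZMod d} :
    m ∈ powSupport d K ↔ ((Nat.card K - 1 : ℕ) : ZMod d) * m = 0 := Iff.rfl

omit [NeZero d] [Field K] [Finite K] in
theorem natCast_mem_powSupport {m : ℕ} :
    (m : ZMod d) ∈ powSupport d K ↔ d ∣ (Nat.card K - 1) * m := by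
  rw [mem_powSupport, ← Nat.cast_mul, ZMod.natCast_eq_zero_iff]

omit [Field K] [Finite K] in
theorem exists_lift_of_mem {m : ZMod d} (hm : m ∈ powSupport d K) :
    ∃ m' e : ℕ, (m' : ZMod d) = m ∧ m' < d ∧ d * e = (Nat.card K - 1) * m' := by
  have h : (m.val : ZMod d) ∈ powSupport d K := by rwa [ZMod.natCast_zmod_val]
  obtain ⟨e, he⟩ := natCast_mem_powSupport.1 h
  exact ⟨m.val, e, ZMod.natCast_zmod_val m, ZMod.val_lt m, he.symm⟩

omit [Finite K] in
-- Any natural lift `m'` of the class may be used: adding `d` to `m'` adds `#K - 1` to the exponent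
-- `e`. This makes additivity in `m` immediate.
theorem powChar_apply (ω : rootsOfUnity d E →* ℂˣ) (φ : K →+* E) {m' e : ℕ}
    (he : d * e = (Nat.card K - 1) * m') (z : Kˣ) {r : rootsOfUnity d E}
    (hr : ((r : Eˣ) : E) = φ z ^ e) : powChar ω φ (m' : ZMod d) z = ω r := by
  have hd : 0 < d := Nat.pos_of_neZero d
  have hz : (z : K) ^ (Nat.card K - 1) = 1 := by
    rw [← Units.val_pow_eq_pow_val, ← Nat.card_units, pow_card_eq_one', Units.val_one]
  have hdvd : d ∣ (Nat.card K - 1) * (m' : ZMod d).val := by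
    rw [← natCast_mem_powSupport, ZMod.natCast_zmod_val, natCast_mem_powSupport]
    exact ⟨e, he.symm⟩
  rw [powChar, dif_pos hdvd, MulChar.ofUnitHom_coe, MonoidHom.comp_apply]
  congr 2
  refine Subtype.ext (Units.ext ?_)
  rw [hr]
  change φ ((z : K) ^ _) = _
  rw [← map_pow]
  congr 1
  have hval : (m' : ZMod d).val = m' % d := ZMod.val_natCast d m'
  have he' : e = (Nat.card K - 1) * (m' : ZMod d).val / d + (Nat.card K - 1) * (m' / d) := by
    refine Nat.eq_of_mul_eq_mul_left hd ?_
    rw [he, mul_add, Nat.mul_div_cancel' hdvd, hval, mul_left_comm, ← mul_add, Nat.mod_add_div]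
  rw [he', pow_add, pow_mul z.1, hz, one_pow, mul_one]

omit [NeZero d] [Finite K] in
theorem exists_rootsOfUnity_eq (φ : K →+* E) {m' e : ℕ} (he : d * e = (Nat.card K - 1) * m')
    (z : Kˣ) : ∃ r : rootsOfUnity d E, ((r : Eˣ) : E) = φ z ^ e := by
  refine ⟨⟨Units.map (φ : K →* E) z ^ e, ?_⟩, rfl⟩
  rw [mem_rootsOfUnity, ← map_pow, ← map_pow, ← pow_mul, mul_comm e, he, pow_mul,
    ← Nat.card_units, pow_card_eq_one', one_pow, map_one]

omit [Finite K] in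
theorem powChar_add (ω : rootsOfUnity d E →* ℂˣ) (φ : K →+* E) {m n : ZMod d}
    (hm : m ∈ powSupport d K) (hn : n ∈ powSupport d K) :
    powChar ω φ (m + n) = powChar ω φ m * powChar ω φ n := by
  obtain ⟨m', e, rfl, -, he⟩ := exists_lift_of_mem hm
  obtain ⟨n', f, rfl, -, hf⟩ := exists_lift_of_mem hn
  refine MulChar.ext fun z => ?_
  obtain ⟨r, hr⟩ := exists_rootsOfUnity_eq φ he z
  obtain ⟨s, hs⟩ := exists_rootsOfUnity_eq φ hf z
  rw [MulChar.mul_apply, powChar_apply ω φ he z hr, powChar_apply ω φ hf z hs, ← Nat.cast_add,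
    powChar_apply ω φ (e := e + f) (r := r * s) (by rw [mul_add, mul_add, he, hf]) z
      (by rw [pow_add, ← hr, ← hs]; rfl), map_mul, Units.val_mul]

omit [Finite K] in
theorem powChar_zero (ω : rootsOfUnity d E →* ℂˣ) (φ : K →+* E) : powChar ω φ 0 = 1 := by
  refine MulChar.ext fun z => ?_
  have := powChar_apply ω φ (m' := 0) (e := 0) (by simp) z (r := 1) (by simp)
  rw [Nat.cast_zero] at this
  simp [this]

omit [Finite K] in
theorem powChar_nsmul (ω : rootsOfUnity d E →* ℂˣ) (φ : K →+* E) {m : ZMod d}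
    (hm : m ∈ powSupport d K) (q : ℕ) : powChar ω φ (q • m) = powChar ω φ m ^ q := by
  induction q with
  | zero => simp [powChar_zero]
  | succ q ih => rw [succ_nsmul, powChar_add ω φ (AddSubgroup.nsmul_mem _ hm q) hm, ih, pow_succ]

/-- Evaluate at a generator of the unit group: triviality forces `#K - 1 ∣ e`, hence `d ∣ m'`. -/
theorem powChar_eq_one_iff {ω : rootsOfUnity d E →* ℂˣ} (hω : Function.Injective ω) (φ : K →+* E)
    {m : ZMod d} (hm : m ∈ powSupport d K) : powChar ω φ m = 1 ↔ m = 0 := by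
  refine ⟨fun h => ?_, fun h => h ▸ powChar_zero ω φ⟩
  obtain ⟨m', e, rfl, hlt, he⟩ := exists_lift_of_mem hm
  obtain ⟨g, hg⟩ := IsCyclic.exists_ofOrder_eq_natCard (α := Kˣ)
  obtain ⟨r, hr⟩ := exists_rootsOfUnity_eq φ he g
  have h1 := powChar_apply ω φ he g hr
  rw [h, MulChar.one_apply_coe] at h1
  have h2 : r = 1 := hω (by rw [map_one]; exact Units.ext h1.symm)
  rw [h2, ← map_pow] at hr
  have h3 : g ^ e = 1 := Units.ext (φ.injective (by rw [Units.val_pow_eq_pow_val, ← hr]; simp))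
  have h4 : Nat.card K - 1 ∣ e := by
    rw [← Nat.card_units, ← hg]
    exact orderOf_dvd_of_pow_eq_one h3
  obtain ⟨c, rfl⟩ := h4
  have hpos : 0 < Nat.card K - 1 := Nat.sub_pos_of_lt Finite.one_lt_card
  have h5 : d * c = m' := Nat.eq_of_mul_eq_mul_left hpos (by rw [← he]; ring)
  rw [← h5]
  simp

/-- The norm raises to the power `(#K - 1) / (#k - 1)`, which turns the exponent `m (#k - 1) / d`
into `m (#K - 1) / d`. The values are compared inside the common field `E`. -/
theorem powChar_norm (ω : rootsOfUnity d E →* ℂˣ) {k : Type*} [Field k] [Finite k] [Algebra k K]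
    {φ : K →+* E} {ψ : k →+* E} (h : φ.comp (algebraMap k K) = ψ) {m : ZMod d}
    (hm : m ∈ powSupport d k) (x : K) :
    powChar ω ψ m (Algebra.norm k x) = powChar ω φ m x := by
  rcases eq_or_ne x 0 with rfl | hx
  · rw [Algebra.norm_zero, MulChar.map_zero, MulChar.map_zero]
  have hdvd : Nat.card k - 1 ∣ Nat.card K - 1 := by
    rw [Module.natCard_eq_pow_finrank (K := k) (V := K)]
    simpa using Nat.sub_dvd_pow_sub_pow (Nat.card k) 1 (Module.finrank k K)
  obtain ⟨m', e, rfl, -, he⟩ := exists_lift_of_mem hm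
  obtain ⟨c, hc⟩ := hdvd
  have he' : d * (e * c) = (Nat.card K - 1) * m' := by rw [hc, ← mul_assoc, he]; ring
  obtain ⟨r, hr⟩ := exists_rootsOfUnity_eq φ he' (Units.mk0 x hx)
  have hpos : 0 < Nat.card k - 1 := Nat.sub_pos_of_lt Finite.one_lt_card
  have hc' : (Nat.card K - 1) / (Nat.card k - 1) = c := by rw [hc, Nat.mul_div_cancel_left _ hpos]
  have h1 := powChar_apply ω φ he' (Units.mk0 x hx) hr
  rw [Units.val_mk0] at h1
  rw [h1]
  refine powChar_apply ω ψ he (Units.mk0 _ (Algebra.norm_ne_zero_iff.2 hx)) ?_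
  rw [hr, Units.val_mk0, Units.val_mk0, ← h, RingHom.comp_apply, FiniteField.algebraMap_norm_eq_pow,
    hc', map_pow, ← pow_mul, mul_comm c]

theorem card_powSupport : Nat.card (powSupport d K) = d.gcd (Nat.card K - 1) := by
  have h := IsAddCyclic.card_nsmulAddMonoidHom_ker (G := ZMod d) (Nat.card K - 1)
  rw [Nat.card_zmod] at h
  rw [← h]
  congr! 2
  ext m
  simp [mem_powSupport, AddMonoidHom.mem_ker, nsmul_eq_mul]

/-- With `g = gcd(d, #K - 1)`, the single class `d / g` already gives `z ^ ((#K - 1) / g) = 1`. So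
`z` is a `g`-th power, and Bézout makes it a `d`-th power. -/
theorem exists_pow_eq_of_powChar {ω : rootsOfUnity d E →* ℂˣ} (hω : Function.Injective ω)
    (φ : K →+* E) {z : Kˣ} (h : ∀ m ∈ powSupport d K, powChar ω φ m z = 1) :
    ∃ s : Kˣ, s ^ d = z := by
  set M := Nat.card K - 1 with hM
  obtain ⟨a, ha⟩ := Nat.gcd_dvd_left d M
  obtain ⟨b, hb⟩ := Nat.gcd_dvd_right d M
  set g := d.gcd M with hg
  have hgpos : 0 < g := Nat.gcd_pos_of_pos_left _ (Nat.pos_of_neZero d)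
  have hMpos : 0 < M := Nat.sub_pos_of_lt Finite.one_lt_card
  have he : d * b = M * a := by
    conv_lhs => rw [ha]
    conv_rhs => rw [hb]
    ring
  obtain ⟨r, hr⟩ := exists_rootsOfUnity_eq φ he z
  have h1 := powChar_apply ω φ he z hr
  rw [h _ (natCast_mem_powSupport.2 ⟨b, he.symm⟩)] at h1
  have h2 : r = 1 := hω (by rw [map_one]; exact Units.ext h1.symm)
  rw [h2, ← map_pow] at hr
  have h3 : z ^ b = 1 := Units.ext (φ.injective (by rw [Units.val_pow_eq_pow_val, ← hr]; simp))
  obtain ⟨γ, hγ⟩ := IsCyclic.exists_generator (α := Kˣ)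
  have hord : orderOf γ = M := by rw [orderOf_eq_card_of_forall_mem_zpowers hγ, Nat.card_units]
  obtain ⟨i, rfl⟩ := Subgroup.mem_zpowers_iff.1 (hγ z)
  rw [← zpow_natCast, ← zpow_mul, ← orderOf_dvd_iff_zpow_eq_one, hord] at h3
  have hb0 : (b : ℤ) ≠ 0 := by
    rintro h0
    rw [Nat.cast_eq_zero.1 h0, mul_zero] at hb
    omega
  obtain ⟨c, rfl⟩ : (g : ℤ) ∣ i := by
    refine Int.dvd_of_mul_dvd_mul_right hb0 ?_
    rwa [← Nat.cast_mul, ← hb]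
  refine ⟨γ ^ (d.gcdA M * c), ?_⟩
  have hbez : (g : ℤ) * c = d.gcdA M * c * d + M * (d.gcdB M * c) := by
    rw [hg, Nat.gcd_eq_gcd_ab d M]
    ring
  rw [hbez, zpow_add, zpow_mul γ (M : ℤ), zpow_natCast γ M, ← hord, pow_orderOf_eq_one, one_zpow,
    mul_one, ← zpow_natCast, ← zpow_mul]

open scoped Classical in
-- Orthogonality of characters: on `d`-th powers both sides equal `gcd(d, #K - 1)`; elsewhere some
-- character in the group is nontrivial at `z`, which forces the sum to vanish.
theorem card_pow_eq {ω : rootsOfUnity d E →* ℂˣ} (hω : Function.Injective ω)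
    (φ : K →+* E) [Fintype K] (z : Kˣ) :
    (#{t : Kˣ | t ^ d = z} : ℂ) = ∑ m : ZMod d with m ∈ powSupport d K, powChar ω φ m z := by
  by_cases hz : ∃ s : Kˣ, s ^ d = z
  · obtain ⟨s, rfl⟩ := hz
    have h1 : ∀ m ∈ univ.filter (fun m : ZMod d => m ∈ powSupport d K),
        powChar ω φ m ((s ^ d : Kˣ) : K) = 1 := fun m hm => by
      have h := powChar_nsmul ω φ (mem_filter.1 hm).2 d
      rw [nsmul_eq_mul, CharP.cast_eq_zero, zero_mul, powChar_zero] at h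
      rw [Units.val_pow_eq_pow_val, map_pow, ← MulChar.pow_apply_coe, ← h, MulChar.one_apply_coe]
    rw [Finset.sum_congr rfl h1, Finset.sum_const, nsmul_one, Nat.cast_inj]
    have h2 : #{m : ZMod d | m ∈ powSupport d K} = Nat.card (powSupport d K) := by
      rw [← Fintype.card_subtype, ← Nat.card_eq_fintype_card]
    have h3 := IsCyclic.card_powMonoidHom_ker (G := Kˣ) d
    rw [h2, card_powSupport, Nat.gcd_comm, ← Nat.card_units, ← h3, ← Fintype.card_subtype,
      ← Nat.card_eq_fintype_card]
    refine Nat.card_congr ((Equiv.divRight s).subtypeEquiv fun t => ?_)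
    rw [MonoidHom.mem_ker, powMonoidHom_apply, Equiv.divRight_apply, div_pow, div_eq_one]
  · have hz' := hz
    contrapose! hz
    by_contra! hne
    have hm : ∃ m ∈ powSupport d K, powChar ω φ m z ≠ 1 := by
      by_contra! h
      exact hz' (exists_pow_eq_of_powChar hω φ h)
    obtain ⟨m, hm, hmz⟩ := hm
    refine hz ?_
    rw [Finset.filter_false_of_mem fun t _ => hne t, Finset.card_empty, Nat.cast_zero]
    have h2 : powChar ω φ m z * ∑ m : ZMod d with m ∈ powSupport d K, powChar ω φ m z =
        ∑ m : ZMod d with m ∈ powSupport d K, powChar ω φ m z := by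
      rw [Finset.mul_sum]
      refine Finset.sum_equiv (Equiv.addLeft m) (fun n => ?_) fun n hn => ?_
      · simp only [mem_filter, mem_univ, true_and, Equiv.coe_addLeft]
        exact ((powSupport d K).add_mem_cancel_left hm).symm
      · rw [Equiv.coe_addLeft, powChar_add ω φ hm (mem_filter.1 hn).2, MulChar.mul_apply]
    exact (by_contra fun h0 => hmz (mul_eq_right₀ (Ne.symm h0) |>.1 h2))

end PowChar

/-! ### Jacobi sums with the quadratic character -/

section JacobiSum

variable {K : Type*} [Field K] [Fintype K] [DecidableEq K]

variable (K) in
/-- The quadratic character with complex values. -/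
noncomputable def complexQuadraticChar : MulChar K ℂ :=
  (quadraticChar K).ringHomComp (Int.castRingHom ℂ)

theorem complexQuadraticChar_apply (x : K) :
    complexQuadraticChar K x = (quadraticChar K x : ℂ) := rfl

/-- The Jacobi sum of a character with the quadratic character, up to sign. -/
noncomputable def quadraticJacobi (χ : MulChar K ℂ) : ℂ :=
  ∑ y, χ y * complexQuadraticChar K (1 + y)

theorem complexQuadraticChar_ne_one (hK : ringChar K ≠ 2) : complexQuadraticChar K ≠ 1 := by
  obtain ⟨a, ha⟩ := MulChar.ne_one_iff.1 (quadraticChar_ne_one hK)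
  refine MulChar.ne_one_iff.2 ⟨a, fun h => ha ?_⟩
  rw [complexQuadraticChar_apply] at h
  exact_mod_cast h

theorem complexQuadraticChar_sq : complexQuadraticChar K ^ 2 = 1 := by
  refine MulChar.ext fun a => ?_
  rw [MulChar.pow_apply_coe, complexQuadraticChar_apply, ← Int.cast_pow,
    quadraticChar_sq_one a.ne_zero, Int.cast_one, MulChar.one_apply_coe]

/-- Exchange the sums and put `z = x y` in the inner one: a Jacobi sum factors out, and what remains
over `x` is the same Jacobi sum because `φ(x) ^ 2 = 1`. -/
theorem sum_mul_legendreSum (χ : MulChar K ℂ) :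
    ∑ z, χ z * (legendreSum K z : ℂ) = quadraticJacobi χ ^ 2 := by
  have h1 : ∀ x ≠ (0 : K), ∑ z, χ z * complexQuadraticChar K (x + z) =
      χ x * complexQuadraticChar K x * quadraticJacobi χ := fun x hx => by
    rw [← Equiv.sum_comp (Equiv.mulLeft₀ x hx), quadraticJacobi, Finset.mul_sum]
    refine Finset.sum_congr rfl fun y _ => ?_
    rw [Equiv.mulLeft₀_apply, map_mul, show x + x * y = x * (1 + y) by ring, map_mul]
    ring
  have h2 : ∀ x, complexQuadraticChar K (x * (x + 1)) * ∑ z, χ z * complexQuadraticChar K (x + z) =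
      quadraticJacobi χ * (χ x * complexQuadraticChar K (1 + x)) := fun x => by
    rcases eq_or_ne x 0 with rfl | hx
    · rw [zero_mul, MulChar.map_zero, MulChar.map_zero, zero_mul, zero_mul, mul_zero]
    · have h3 : complexQuadraticChar K x * complexQuadraticChar K x = 1 := by
        rw [← sq, complexQuadraticChar_apply, ← Int.cast_pow, quadraticChar_sq_one hx, Int.cast_one]
      rw [h1 x hx, map_mul, add_comm x 1]
      linear_combination χ x * complexQuadraticChar K (1 + x) * quadraticJacobi χ * h3
  rw [sq]
  conv_rhs => enter [2]; rw [quadraticJacobi]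
  rw [Finset.mul_sum, ← Finset.sum_congr rfl fun x _ => h2 x]
  simp only [legendreSum, Int.cast_sum, Finset.mul_sum]
  rw [Finset.sum_comm]
  refine Finset.sum_congr rfl fun x _ => Finset.sum_congr rfl fun z _ => ?_
  rw [map_mul (quadraticChar K), Int.cast_mul, ← complexQuadraticChar_apply,
    ← complexQuadraticChar_apply]
  ring

theorem quadraticJacobi_eq (χ : MulChar K ℂ) :
    quadraticJacobi χ = χ (-1) * jacobiSum χ (complexQuadraticChar K) := by
  rw [quadraticJacobi, jacobiSum, ← Equiv.sum_comp (Equiv.neg K), Finset.mul_sum]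
  refine Finset.sum_congr rfl fun y _ => ?_
  rw [Equiv.neg_apply, ← neg_one_mul y, map_mul, neg_one_mul, sub_eq_add_neg, mul_assoc]

theorem quadraticJacobi_one (hK : ringChar K ≠ 2) : quadraticJacobi (1 : MulChar K ℂ) = -1 := by
  rw [quadraticJacobi_eq, jacobiSum_one_nontrivial (complexQuadraticChar_ne_one hK),
    MulChar.one_apply (by simp), one_mul]

theorem quadraticJacobi_complexQuadraticChar (hK : ringChar K ≠ 2) :
    quadraticJacobi (complexQuadraticChar K) = -1 := by
  have h : (complexQuadraticChar K)⁻¹ = complexQuadraticChar K :=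
    inv_eq_of_mul_eq_one_left (by rw [← sq, complexQuadraticChar_sq])
  have h1 := jacobiSum_nontrivial_inv (complexQuadraticChar_ne_one hK)
  rw [h] at h1
  rw [quadraticJacobi_eq, h1, mul_neg, ← map_mul, neg_one_mul, neg_neg, map_one]

theorem eq_complexQuadraticChar {χ : MulChar K ℂ} (h : χ ^ 2 = 1) (hχ : χ ≠ 1) :
    χ = complexQuadraticChar K := by
  have hsq : ∀ x : K, x ≠ 0 → IsSquare x → χ x = 1 := by
    rintro x hx ⟨s, rfl⟩
    have hs : s ≠ 0 := left_ne_zero_of_mul hx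
    rw [map_mul, ← sq, ← MulChar.pow_apply' χ two_ne_zero, h, MulChar.one_apply hs.isUnit]
  obtain ⟨a, ha⟩ := MulChar.ne_one_iff.1 hχ
  have ha0 : (a : K) ≠ 0 := a.ne_zero
  have hna : ¬IsSquare (a : K) := fun hs => ha (hsq _ ha0 hs)
  have hqa : quadraticChar K a = -1 := by
    rw [quadraticChar_apply, quadraticCharFun, if_neg ha0, if_neg hna]
  have ha1 : χ a = -1 := by
    have h1 : χ a ^ 2 = 1 := by rw [← MulChar.pow_apply_coe, h, MulChar.one_apply_coe]
    exact (mul_self_eq_one_iff.1 (by rw [← sq]; exact h1)).resolve_left ha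
  refine MulChar.ext fun x => ?_
  rw [complexQuadraticChar_apply]
  by_cases hx : IsSquare (x : K)
  · rw [hsq _ x.ne_zero hx, (quadraticChar_one_iff_isSquare x.ne_zero).2 hx, Int.cast_one]
  · have hqx : quadraticChar K x = -1 := by
      rw [quadraticChar_apply, quadraticCharFun, if_neg x.ne_zero, if_neg hx]
    have h1 : IsSquare ((x : K) * a) := by
      rw [← quadraticChar_one_iff_isSquare (mul_ne_zero x.ne_zero ha0), map_mul, hqa, hqx]
      norm_num
    have h2 := hsq _ (mul_ne_zero x.ne_zero ha0) h1
    rw [map_mul, ha1] at h2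
    rw [hqx]
    push_cast
    linear_combination -h2

/-- The condition says that `χ`, and hence its product with the quadratic character, is nontrivial:
this is the case in which a Jacobi sum has absolute value `√#K`. -/
theorem norm_quadraticJacobi_sq (hK : ringChar K ≠ 2) {χ : MulChar K ℂ} (h : χ ^ 2 ≠ 1) :
    ‖quadraticJacobi χ‖ ^ 2 = Fintype.card K := by
  have hχ : χ ≠ 1 := by rintro rfl; exact h (one_pow 2)
  have hχφ : χ * complexQuadraticChar K ≠ 1 := fun h1 => h (by
    rw [eq_inv_of_mul_eq_one_left h1, inv_pow, complexQuadraticChar_sq, inv_one])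
  have hinv : (complexQuadraticChar K)⁻¹ = complexQuadraticChar K :=
    inv_eq_of_mul_eq_one_left (by rw [← sq, complexQuadraticChar_sq])
  have hchar : ringChar ℂ ≠ ringChar K := by
    rw [ringChar.eq_zero]
    exact (CharP.ringChar_ne_zero_of_finite K).symm
  have h1 := jacobiSum_mul_jacobiSum_inv hchar hχ (complexQuadraticChar_ne_one hK) hχφ
  have hstar : ∀ ψ : MulChar K ℂ, ψ.ringHomComp (starRingEnd ℂ) = ψ⁻¹ := fun ψ =>
    MulChar.ext fun a => MulChar.star_apply' ψ a
  rw [← hstar, ← hstar, jacobiSum_ringHomComp, Complex.mul_conj'] at h1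
  rw [quadraticJacobi_eq, norm_mul, mul_pow]
  have h2 : ‖χ (-1)‖ ^ 2 = 1 := by
    rw [← norm_pow, ← map_pow, neg_one_sq, map_one, norm_one]
  rw [h2, one_mul]
  exact_mod_cast h1

end JacobiSum
end RatFuncEC

namespace RatFuncEC

open Finset

/-! ### Jacobi sums under field extension and Frobenius -/

section Compatibility

variable {F E k K : Type*} [Field F] [Field E] [Algebra F E] [Field k] [Finite k] [Algebra F k]
  [Field K] [Finite K] [Algebra F K]

/-- The image of `K` in `E` consists of all the roots of `X ^ #K - X`, and the image of `k`
satisfies this equation. -/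
theorem exists_algHom_comp_eq (φ : K →ₐ[F] E) (ψ : k →ₐ[F] E)
    (h : Module.finrank F k ∣ Module.finrank F K) : ∃ ι : k →ₐ[F] K, φ.comp ι = ψ := by
  have := Fintype.ofFinite K
  have hF : Finite F := .of_injective _ (algebraMap F K).injective
  have hpow : ∀ x : k, x ^ Nat.card K = x := fun x => by
    obtain ⟨c, hc⟩ := h
    rw [Module.natCard_eq_pow_finrank (K := F) (V := K), hc, pow_mul,
      ← Module.natCard_eq_pow_finrank (K := F) (V := k)]
    have := Fintype.ofFinite k
    rw [Nat.card_eq_fintype_card, FiniteField.pow_card_pow]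
  have hmem : ∀ x, ψ x ∈ φ.range := fun x => by
    have h1 := Polynomial.roots_map_of_injective_of_card_eq_natDegree
      (p := (Polynomial.X ^ Fintype.card K - Polynomial.X : K[X])) (f := (φ : K →+* E))
      φ.toRingHom.injective (by
        rw [FiniteField.roots_X_pow_card_sub_X, FiniteField.X_pow_card_sub_X_natDegree_eq _
          Fintype.one_lt_card]
        rfl)
    have h2 : ψ x ∈ ((Polynomial.X ^ Fintype.card K - Polynomial.X : K[X]).map
        (φ : K →+* E)).roots := by
      rw [Polynomial.mem_roots ((Polynomial.map_ne_zero_iff (φ : K →+* E).injective).2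
        (FiniteField.X_pow_card_sub_X_ne_zero K Fintype.one_lt_card))]
      simp [← Nat.card_eq_fintype_card, ← map_pow, hpow]
    rw [← h1, FiniteField.roots_X_pow_card_sub_X, Multiset.mem_map] at h2
    obtain ⟨y, -, hy⟩ := h2
    exact ⟨y, hy⟩
  refine ⟨(AlgEquiv.ofInjective φ φ.toRingHom.injective).symm.toAlgHom.comp
    (ψ.codRestrict φ.range hmem), ?_⟩
  ext x
  have := AlgEquiv.ofInjective_apply φ φ.toRingHom.injective
    ((AlgEquiv.ofInjective φ φ.toRingHom.injective).symm (ψ.codRestrict φ.range hmem x))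
  rw [AlgEquiv.apply_symm_apply] at this
  exact this.symm

/-- Hasse-Davenport for `K / k`; squaring removes the sign `(-1) ^ ([K : k] - 1)`. -/
theorem quadraticJacobi_powChar_sq [Fintype k] [DecidableEq k] [Fintype K] [DecidableEq K]
    (hk : ringChar k ≠ 2) {d : ℕ} [NeZero d] (ω : rootsOfUnity d E →* ℂˣ)
    (φ : K →ₐ[F] E) (ψ : k →ₐ[F] E) (h : Module.finrank F k ∣ Module.finrank F K) {m : ZMod d}
    (hm : m ∈ powSupport d k) :
    quadraticJacobi (powChar ω (φ : K →+* E) m) ^ 2 =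
      (quadraticJacobi (powChar ω (ψ : k →+* E) m) ^ 2) ^
        (Module.finrank F K / Module.finrank F k) := by
  obtain ⟨ι, hι⟩ := exists_algHom_comp_eq φ ψ h
  have hF : Finite F := .of_injective _ (algebraMap F K).injective
  let := ι.toRingHom.toAlgebra
  have : IsScalarTower F k K := .of_algebraMap_eq' ι.comp_algebraMap.symm
  have hr : Module.finrank F K / Module.finrank F k = Module.finrank k K := by
    rw [← Module.finrank_mul_finrank F k K, Nat.mul_div_cancel_left _ Module.finrank_pos]
  have h1 := sum_norm_jacobi (powChar ω (ψ : k →+* E) m) (complexQuadraticChar_ne_one hk) K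
  have hcomp : (φ : K →+* E).comp (algebraMap k K) = (ψ : k →+* E) := by
    rw [← hι]
    rfl
  have h2 : quadraticJacobi (powChar ω (φ : K →+* E) m) =
      (-1) ^ (Module.finrank k K - 1) *
        quadraticJacobi (powChar ω (ψ : k →+* E) m) ^ Module.finrank k K := by
    rw [quadraticJacobi, quadraticJacobi, ← h1]
    refine Finset.sum_congr rfl fun x _ => ?_
    rw [powChar_norm ω hcomp hm, complexQuadraticChar_apply, complexQuadraticChar_apply,
      quadraticChar_norm hk]
  rw [h2, hr, mul_pow, ← pow_mul, mul_comm _ 2, pow_mul, neg_one_sq, one_pow, one_mul, ← pow_mul,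
    ← pow_mul, mul_comm]

omit [Algebra F E] in
-- Reindex by the Frobenius `y ↦ y ^ q`: it is additive, and the quadratic character equals its own
-- `q`-th power because `q` is odd.
theorem quadraticJacobi_powChar_mul [Finite F] (hF : ringChar F ≠ 2) [Fintype K] [DecidableEq K]
    {d : ℕ} [NeZero d] (ω : rootsOfUnity d E →* ℂˣ) (φ : K →+* E) {m : ZMod d}
    (hm : m ∈ powSupport d K) :
    quadraticJacobi (powChar ω φ ((Nat.card F : ZMod d) * m)) =
      quadraticJacobi (powChar ω φ m) := by
  have := Fintype.ofFinite F
  have hodd : Odd (Nat.card F) := by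
    rw [Nat.card_eq_fintype_card, Nat.odd_iff]
    exact FiniteField.odd_card_of_char_ne_two hF
  have hpos : Nat.card F ≠ 0 := Nat.card_pos.ne'
  have hφ : complexQuadraticChar K ^ Nat.card F = complexQuadraticChar K := by
    obtain ⟨c, hc⟩ := hodd
    rw [hc, pow_succ, pow_mul, complexQuadraticChar_sq, one_pow, one_mul]
  rw [← nsmul_eq_mul, powChar_nsmul ω φ hm, quadraticJacobi, quadraticJacobi,
    ← Equiv.sum_comp (FiniteField.frobeniusAlgEquivOfAlgebraic F K).toEquiv
      fun y => powChar ω φ m y * complexQuadraticChar K (1 + y)]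
  refine Finset.sum_congr rfl fun y _ => ?_
  have h1 : (FiniteField.frobeniusAlgEquivOfAlgebraic F K) y = y ^ Nat.card F := by
    rw [Nat.card_eq_fintype_card]; rfl
  have h2 : (1 : K) + y ^ Nat.card F = (1 + y) ^ Nat.card F := by
    rw [← h1, ← map_one (FiniteField.frobeniusAlgEquivOfAlgebraic F K), ← map_add, map_one,
      Nat.card_eq_fintype_card]
    rfl
  change _ = powChar ω φ m (FiniteField.frobeniusAlgEquivOfAlgebraic F K y) *
    complexQuadraticChar K (1 + FiniteField.frobeniusAlgEquivOfAlgebraic F K y)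
  rw [MulChar.pow_apply' _ hpos, ← map_pow, h1, h2, map_pow (complexQuadraticChar K),
    ← MulChar.pow_apply' _ hpos, hφ]

theorem mem_powSupport_iff [Finite F] {d : ℕ} {m : ZMod d} :
    m ∈ powSupport d K ↔
      Function.IsPeriodicPt (fun m : ZMod d => (Nat.card F : ZMod d) * m) (Module.finrank F K) m := by
  have hfin : Finite F := .of_injective _ (algebraMap F K).injective
  have h1 : 1 ≤ Nat.card K := Nat.card_pos
  rw [mem_powSupport, Function.IsPeriodicPt, Function.IsFixedPt, mul_left_iterate,
    Nat.cast_sub h1, Module.natCard_eq_pow_finrank (K := F) (V := K), Nat.cast_pow, Nat.cast_one,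
    sub_mul, one_mul, sub_eq_zero]

theorem exists_injective_rootsOfUnity (d : ℕ) [NeZero d] (E : Type*) [Field E] :
    ∃ ω : rootsOfUnity d E →* ℂˣ, Function.Injective ω := by
  have : NeZero (Nat.card (rootsOfUnity d E)) := ⟨Nat.card_pos.ne'⟩
  let e : rootsOfUnity d E ≃* rootsOfUnity (Nat.card (rootsOfUnity d E)) ℂ :=
    mulEquivOfCyclicCardEq (Complex.card_rootsOfUnity _).symm
  exact ⟨(Subgroup.subtype _).comp e.toMonoidHom, Subtype.val_injective.comp e.injective⟩

open scoped Classical in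
-- The term `θ = 0` gives `-1`. Each `m` with `2 m = 0` gives `(-1) ^ 2 = 1`, and there are one or
-- two of these according to the parity of `d`, which leaves `[d even]`.
theorem sum_legendreSum_pow [Fintype K] [DecidableEq K] (hK : ringChar K ≠ 2) {d : ℕ} [NeZero d]
    {ω : rootsOfUnity d E →* ℂˣ} (hω : Function.Injective ω) (φ : K →+* E) :
    ((∑ θ : K, legendreSum K (θ ^ d) : ℤ) : ℂ) = (if Even d then 1 else 0) +
      ∑ m : ZMod d with m ∈ powSupport d K ∧ 2 * m ≠ 0, quadraticJacobi (powChar ω φ m) ^ 2 := by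
  have h1 : ((∑ θ : K, legendreSum K (θ ^ d) : ℤ) : ℂ) = -1 +
      ∑ m : ZMod d with m ∈ powSupport d K, quadraticJacobi (powChar ω φ m) ^ 2 := by
    have h3 : ∀ g : K → ℂ, ∑ θ : K, g θ = g 0 + ∑ t : Kˣ, g t := fun g => by
      rw [← Finset.add_sum_erase _ _ (mem_univ 0)]
      congr 1
      symm
      refine Finset.sum_bij (fun t _ => (t : K)) (fun t _ => by simp) (fun t _ s _ h => Units.ext h)
        (fun x hx => ⟨Units.mk0 x (ne_of_mem_erase hx), mem_univ _, rfl⟩) fun t _ => rfl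
    have h4 : ∀ m : ZMod d, quadraticJacobi (powChar ω φ m) ^ 2 =
        ∑ z : Kˣ, powChar ω φ m z * (legendreSum K z : ℂ) := fun m => by
      rw [← sum_mul_legendreSum, h3, MulChar.map_zero, zero_mul, zero_add]
    rw [Int.cast_sum, h3, zero_pow (NeZero.ne d), legendreSum_zero hK, Int.cast_neg, Int.cast_one,
      Finset.sum_congr rfl fun m _ => h4 m, Finset.sum_comm,
      ← Finset.sum_fiberwise (s := univ) (g := fun t : Kˣ => t ^ d)]
    congr 1
    refine Finset.sum_congr rfl fun z _ => ?_
    rw [← Finset.sum_mul, ← card_pow_eq hω, ← nsmul_eq_mul, ← Finset.sum_const]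
    refine Finset.sum_congr (by ext t; simp only [mem_filter, mem_univ, true_and]) fun t ht => ?_
    have ht' : t ^ d = z := by simpa using ht
    rw [← ht', Units.val_pow_eq_pow_val]
  have h2 : ∑ m : ZMod d with m ∈ powSupport d K ∧ ¬ 2 * m ≠ 0,
      quadraticJacobi (powChar ω φ m) ^ 2 = 1 + if Even d then 1 else 0 := by
    have heven : ∃ c, Nat.card K - 1 = c * 2 := by
      have := FiniteField.odd_card_of_char_ne_two hK
      rw [← Nat.card_eq_fintype_card] at this
      exact ⟨(Nat.card K - 1) / 2, by omega⟩
    have hmem : ∀ m : ZMod d, 2 * m = 0 → m ∈ powSupport d K := fun m hm => by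
      obtain ⟨c, hc⟩ := heven
      rw [mem_powSupport, hc, Nat.cast_mul, mul_assoc, Nat.cast_ofNat, hm, mul_zero]
    have h3 : ∀ m ∈ univ.filter (fun m : ZMod d => m ∈ powSupport d K ∧ ¬ 2 * m ≠ 0),
        quadraticJacobi (powChar ω φ m) ^ 2 = 1 := fun m hm => by
      obtain ⟨-, hmS, hm2⟩ := mem_filter.1 hm
      rw [not_not] at hm2
      have h4 : quadraticJacobi (powChar ω φ m) = -1 := by
        by_cases h5 : powChar ω φ m = 1
        · rw [h5, quadraticJacobi_one hK]
        · rw [eq_complexQuadraticChar _ h5, quadraticJacobi_complexQuadraticChar hK]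
          rw [← powChar_nsmul ω φ hmS, nsmul_eq_mul, Nat.cast_ofNat, hm2, powChar_zero]
      rw [h4, neg_one_sq]
    rw [Finset.sum_congr rfl h3, Finset.sum_const, nsmul_one]
    have h6 := IsAddCyclic.card_nsmulAddMonoidHom_ker (G := ZMod d) 2
    have h7 : #{m : ZMod d | m ∈ powSupport d K ∧ ¬ 2 * m ≠ 0} =
        Nat.card (nsmulAddMonoidHom 2 : ZMod d →+ ZMod d).ker := by
      rw [← Fintype.card_subtype, ← Nat.card_eq_fintype_card]
      refine Nat.card_congr (Equiv.subtypeEquivRight fun m => ?_)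
      rw [not_not, AddMonoidHom.mem_ker, nsmulAddMonoidHom_apply, nsmul_eq_mul, Nat.cast_ofNat]
      exact ⟨And.right, fun h => ⟨hmem m h, h⟩⟩
    rw [h7, h6, Nat.card_zmod]
    rcases Nat.even_or_odd d with he | ho
    · rw [Nat.gcd_eq_right he.two_dvd, if_pos he]
      norm_num
    · rw [Nat.coprime_two_right.2 ho, if_neg (Nat.not_even_iff_odd.2 ho)]
      norm_num
  rw [h1, ← Finset.sum_filter_add_sum_filter_not _ (fun m : ZMod d => 2 * m ≠ 0),
    Finset.filter_filter, Finset.filter_filter, h2]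
  ring

end Compatibility

/-! ### Jacobi sums attached to the orbits of multiplication by `q` -/

section JacobiFamily

theorem exists_field_finrank_eq (F : Type*) [Field F] [Finite F] {n : ℕ} (hn : 0 < n) :
    ∃ (k : Type) (_ : Field k) (_ : Fintype k) (_ : Algebra F k), Module.finrank F k = n := by
  have : Fact (ringChar F).Prime := ⟨CharP.char_is_prime F (ringChar F)⟩
  have : NeZero n := ⟨hn.ne'⟩
  exact ⟨FiniteField.Extension F (ringChar F) n, inferInstance, Fintype.ofFinite _, inferInstance,
    FiniteField.finrank_extension F (ringChar F) n⟩

/-- Multiplication by `q` on the integers modulo `d`. -/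
def mulMap (d q : ℕ) (m : ZMod d) : ZMod d := (q : ZMod d) * m

theorem mulMap_iterate (d q n : ℕ) (m : ZMod d) : (mulMap d q)^[n] m = (q : ZMod d) ^ n * m := by
  rw [show mulMap d q = ((q : ZMod d) * ·) from rfl, mul_left_iterate]

theorem mulMap_injective {d q : ℕ} (h : d.Coprime q) : Function.Injective (mulMap d q) :=
  fun _ _ hab => ((ZMod.isUnit_iff_coprime q d).2 h.symm).mul_left_cancel hab

theorem minimalPeriod_mulMap_pos {d q : ℕ} [NeZero d] (h : d.Coprime q) (m : ZMod d) :
    0 < Function.minimalPeriod (mulMap d q) m :=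
  Function.minimalPeriod_pos_of_mem_periodicPts ((mulMap_injective h).mem_periodicPts m)

open scoped Classical in
/-- The squares of the Jacobi sums attached to the classes modulo `d`, and their relation with the
Legendre character sums. -/
theorem exists_jacobi {F : Type*} [Field F] [Finite F] (hF : ringChar F ≠ 2) {d : ℕ} [NeZero d]
    (hd : d.Coprime (Nat.card F)) :
    ∃ j : ZMod d → ℂ, (∀ m, j (mulMap d (Nat.card F) m) = j m) ∧
      (∀ m, 2 * m ≠ 0 →
        ‖j m‖ = (Nat.card F : ℝ) ^ Function.minimalPeriod (mulMap d (Nat.card F)) m) ∧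
      ∀ (K : Type) [Field K] [Fintype K] [DecidableEq K] [Algebra F K],
        (((if Even d then 1 else 0) - ∑ θ : K, legendreSum K (θ ^ d) : ℤ) : ℂ) =
          -∑ m : ZMod d with Function.IsPeriodicPt (mulMap d (Nat.card F)) (Module.finrank F K) m ∧
            2 * m ≠ 0, j m ^ (Module.finrank F K /
              Function.minimalPeriod (mulMap d (Nat.card F)) m) := by
  obtain ⟨ω, hω⟩ := exists_injective_rootsOfUnity d (AlgebraicClosure F)
  have hchar : ∀ (K : Type) [Field K] [Algebra F K], ringChar K ≠ 2 := fun K _ _ => by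
    rwa [← Algebra.ringChar_eq F K]
  -- Define `j m` over the extension of degree the orbit length of `m`, the smallest one where the
  -- character lives; Hasse-Davenport gives every larger field.
  have key : ∀ m : ZMod d, ∃ c : ℂ,
      ∀ (K : Type) [Field K] [Fintype K] [DecidableEq K] [Algebra F K]
        (φ : K →ₐ[F] AlgebraicClosure F), m ∈ powSupport d K →
        quadraticJacobi (powChar ω (φ : K →+* AlgebraicClosure F) m) ^ 2 =
          c ^ (Module.finrank F K / Function.minimalPeriod (mulMap d (Nat.card F)) m) := fun m => by
    obtain ⟨k, _, _, _, hk⟩ := exists_field_finrank_eq F (minimalPeriod_mulMap_pos hd m)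
    refine ⟨quadraticJacobi (powChar ω ((IsAlgClosed.lift : k →ₐ[F] AlgebraicClosure F) :
      k →+* AlgebraicClosure F) m) ^ 2, fun K _ _ _ _ φ hm => ?_⟩
    have h := quadraticJacobi_powChar_sq (hchar k) ω φ IsAlgClosed.lift
      (by rw [hk]; exact Function.isPeriodicPt_iff_minimalPeriod_dvd.1 (mem_powSupport_iff.1 hm))
      (m := m) (mem_powSupport_iff.2 (by rw [hk]; exact Function.isPeriodicPt_minimalPeriod _ _))
    rwa [hk] at h
  choose j hj using key
  have hj1 : ∀ m, ∃ (k : Type) (_ : Field k) (_ : Fintype k) (_ : DecidableEq k) (_ : Algebra F k)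
      (φ : k →ₐ[F] AlgebraicClosure F), m ∈ powSupport d k ∧
        Module.finrank F k = Function.minimalPeriod (mulMap d (Nat.card F)) m := fun m => by
    obtain ⟨k, _, _, _, hk⟩ := exists_field_finrank_eq F (minimalPeriod_mulMap_pos hd m)
    exact ⟨k, inferInstance, inferInstance, inferInstance, inferInstance, IsAlgClosed.lift,
      mem_powSupport_iff.2 (by rw [hk]; exact Function.isPeriodicPt_minimalPeriod _ _), hk⟩
  refine ⟨j, fun m => ?_, fun m hm => ?_, fun K _ _ _ _ => ?_⟩
  · obtain ⟨k, _, _, _, _, φ, hmk, hk⟩ := hj1 m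
    have hper : Function.minimalPeriod (mulMap d (Nat.card F)) (mulMap d (Nat.card F) m) =
        Function.minimalPeriod (mulMap d (Nat.card F)) m :=
      Function.minimalPeriod_apply
        (Function.minimalPeriod_pos_iff_mem_periodicPts.1 (minimalPeriod_mulMap_pos hd m))
    have hpos := minimalPeriod_mulMap_pos hd m
    have hmk' : mulMap d (Nat.card F) m ∈ powSupport d k := by
      rw [mulMap, ← nsmul_eq_mul]
      exact AddSubgroup.nsmul_mem _ hmk _
    have h1 := hj m k φ hmk
    have h2 := hj _ k φ hmk'
    rw [hper, hk, Nat.div_self hpos, pow_one] at h2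
    rw [hk, Nat.div_self hpos, pow_one] at h1
    rw [← h1, ← h2, mulMap, quadraticJacobi_powChar_mul hF ω _ hmk]
  · obtain ⟨k, _, _, _, _, φ, hmk, hk⟩ := hj1 m
    have h1 := hj m k φ hmk
    rw [hk, Nat.div_self (minimalPeriod_mulMap_pos hd m), pow_one] at h1
    rw [← h1, norm_pow, norm_quadraticJacobi_sq (hchar k), ← Nat.card_eq_fintype_card,
      Module.natCard_eq_pow_finrank (K := F) (V := k), hk, Nat.cast_pow]
    rw [← powChar_nsmul ω _ hmk, nsmul_eq_mul, Nat.cast_ofNat, Ne, powChar_eq_one_iff hω]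
    · exact hm
    · rw [two_mul]
      exact add_mem hmk hmk
  -- The parity term from infinity cancels the one left by the characters of order at most `2`.
  · rw [Int.cast_sub, sum_legendreSum_pow (hchar K) hω
      ((IsAlgClosed.lift : K →ₐ[F] AlgebraicClosure F) : K →+* AlgebraicClosure F), Int.cast_ite,
      Int.cast_one, Int.cast_zero, sub_add_cancel_left, neg_inj]
    refine Finset.sum_congr ?_ fun m hm => ?_
    · ext m
      simp only [mem_filter, mem_univ, true_and, mem_powSupport_iff (F := F)]
      rfl
    · exact hj m K IsAlgClosed.lift (mem_powSupport_iff.2 (mem_filter.1 hm).2.1)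

end JacobiFamily
end RatFuncEC

namespace RatFuncEC

open Finset Polynomial

/-! ### Representatives of the cycles of an injective self-map -/

section Orbits

/-- Remove one cycle at a time. `R` is chosen before `M` and `g`, since the same representatives
serve for the complex product formula and for the real estimate. -/
theorem exists_orbit_representatives {X : Type*} [Finite X] [DecidableEq X] {f : X → X}
    (hf : Function.Injective f) (S : Finset X) (hS : ∀ x, f x ∈ S ↔ x ∈ S) :
    ∃ R ⊆ S, ∀ (M : Type) [AddCommMonoid M] (g : X → M), (∀ x, g (f x) = g x) →
      ∑ x ∈ S, g x = ∑ x ∈ R, Function.minimalPeriod f x • g x := by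
  induction hn : #S using Nat.strong_induction_on generalizing S with
  | _ n ih =>
    rcases S.eq_empty_or_nonempty with rfl | ⟨a, ha⟩
    · exact ⟨∅, Finset.Subset.refl _, fun M _ g _ => by simp⟩
    set u := Function.minimalPeriod f a with hu
    have hupos : 0 < u := Function.minimalPeriod_pos_of_mem_periodicPts (hf.mem_periodicPts a)
    set O := (range u).image fun i => f^[i] a with hO
    have hmem : ∀ i, f^[i] a ∈ O := fun i => by
      rw [← Function.iterate_mod_minimalPeriod_eq]
      exact mem_image_of_mem _ (mem_range.2 (Nat.mod_lt _ hupos))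
    have hfO : ∀ x, f x ∈ O ↔ x ∈ O := fun x => by
      constructor
      · intro h
        obtain ⟨i, -, hi⟩ := mem_image.1 h
        rcases i with _ | i
        · have h1 : f (f^[u - 1] a) = f x := by
            rw [← Function.iterate_succ_apply' f, Nat.succ_eq_add_one, Nat.sub_add_cancel hupos, ← hi,
              hu, Function.iterate_minimalPeriod]
            rfl
          rw [← hf h1]
          exact hmem _
        · simp only [Function.iterate_succ_apply'] at hi
          rw [← hf hi]
          exact hmem _
      · intro h
        obtain ⟨i, -, rfl⟩ := mem_image.1 h
        rw [← Function.iterate_succ_apply' f]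
        exact hmem _
    have hOS : O ⊆ S := fun x hx => by
      obtain ⟨i, -, rfl⟩ := mem_image.1 hx
      clear hx
      induction i with
      | zero => exact ha
      | succ i ih => rwa [Function.iterate_succ_apply', hS]
    have hlt : #(S \ O) < n := by
      rw [← hn]
      exact Finset.card_lt_card (Finset.sdiff_ssubset hOS ⟨a, hmem 0⟩)
    obtain ⟨R, hR, hsum⟩ := ih _ hlt (S \ O) (fun x => by rw [mem_sdiff, mem_sdiff, hS, hfO]) rfl
    have haR : a ∉ R := fun h => (mem_sdiff.1 (hR h)).2 (hmem 0)
    refine ⟨insert a R, Finset.insert_subset ha (hR.trans Finset.sdiff_subset), fun M _ g hg => ?_⟩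
    have hg' : ∀ i, g (f^[i] a) = g a := fun i => by
      induction i with
      | zero => rfl
      | succ i ih => rw [Function.iterate_succ_apply', hg, ih]
    rw [Finset.sum_insert haR, ← hsum M g hg, ← Finset.sum_sdiff hOS, add_comm, hO,
      Finset.sum_image fun i hi j hj h =>
        Function.iterate_injOn_Iio_minimalPeriod (mem_range.1 hi) (mem_range.1 hj) h,
      Finset.sum_congr rfl fun i _ => hg' i, Finset.sum_const, card_range]

end Orbits

/-! ### The `L`-function as a product over orbits -/

section ProductFormula

/-- The logarithmic derivative of `1 - c T ^ u`. -/
noncomputable def cyclicLogDeriv (c : ℂ) (u : ℕ) : PowerSeries ℂ :=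
  PowerSeries.mk fun n => if n ≠ 0 ∧ u ∣ n then -((u : ℂ) * c ^ (n / u)) else 0

theorem X_mul_derivative_one_sub (c : ℂ) {u : ℕ} (hu : 0 < u) :
    PowerSeries.X * PowerSeries.derivative ℂ ((1 - C c * X ^ u : ℂ[X]) : PowerSeries ℂ) =
      cyclicLogDeriv c u * ((1 - C c * X ^ u : ℂ[X]) : PowerSeries ℂ) := by
  ext n
  rw [coeff_X_mul_derivative, coeff_coe, Polynomial.coe_sub, Polynomial.coe_one,
    Polynomial.coe_mul, Polynomial.coe_pow, Polynomial.coe_C, Polynomial.coe_X, mul_sub, mul_one,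
    map_sub, mul_left_comm, PowerSeries.coeff_C_mul, PowerSeries.coeff_mul_X_pow', coeff_sub,
    coeff_C_mul, coeff_one, coeff_X_pow]
  simp only [cyclicLogDeriv, PowerSeries.coeff_mk]
  rcases lt_trichotomy n u with h | rfl | h
  · rcases Nat.eq_zero_or_pos n with rfl | hn
    · simp [hu.ne']
    · simp [h.not_ge, h.ne, hn.ne', Nat.not_dvd_of_pos_of_lt hn h]
  · simp [hu.ne', Nat.div_self hu]
  · obtain ⟨k, rfl⟩ := Nat.exists_eq_add_of_lt h
    have h1 : u + k + 1 - u = k + 1 := by omega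
    have h2 : u ∣ u + k + 1 ↔ u ∣ k + 1 := by
      rw [add_assoc]
      exact Nat.dvd_add_right dvd_rfl
    rw [h1]
    simp only [h2]
    by_cases h3 : u ∣ k + 1
    · obtain ⟨e, he⟩ := h3
      have h4 : u + k + 1 = u * (e + 1) := by rw [add_assoc, he]; ring
      rw [he, h4, Nat.mul_div_cancel_left _ hu, Nat.mul_div_cancel_left _ hu]
      have he0 : e ≠ 0 := by rintro rfl; simp at he
      have h5 : u ≤ u * (e + 1) := Nat.le_mul_of_pos_right u e.succ_pos
      have h6 : u * (e + 1) ≠ u := by rw [← h4]; omega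
      simp [hu.ne', he0, h5, h6]
      ring
    · simp [h3, hu.ne']
      omega

/-- As `A 0 = 0`, the relation determines the coefficient at `n > 0` from earlier ones, after
division by `n` in characteristic zero. -/
theorem eq_of_logDeriv_eq {A : ℕ → ℂ} (hA : A 0 = 0) {f g : PowerSeries ℂ}
    (h0 : PowerSeries.coeff 0 f = PowerSeries.coeff 0 g)
    (hf : ∀ n : ℕ, (n : ℂ) * PowerSeries.coeff n f =
      ∑ p ∈ antidiagonal n, A p.1 * PowerSeries.coeff p.2 f)
    (hg : ∀ n : ℕ, (n : ℂ) * PowerSeries.coeff n g =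
      ∑ p ∈ antidiagonal n, A p.1 * PowerSeries.coeff p.2 g) : f = g := by
  ext n
  induction n using Nat.strong_induction_on with
  | _ n ih =>
    rcases Nat.eq_zero_or_pos n with rfl | hn
    · exact h0
    · have hn' : (n : ℂ) ≠ 0 := Nat.cast_ne_zero.2 hn.ne'
      refine mul_left_cancel₀ hn' ?_
      rw [hf, hg]
      refine Finset.sum_congr rfl fun p hp => ?_
      rcases Nat.eq_zero_or_pos p.1 with h | h
      · rw [h, hA, zero_mul, zero_mul]
      · rw [ih p.2 (by have := mem_antidiagonal.1 hp; omega)]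

open scoped Classical in
/-- The `L`-function of the Legendre curve is a polynomial, a product over the orbits of
multiplication by `q` on the classes modulo `d`. -/
theorem exists_polynomial_lFunction {F : Type*} [Field F] [Finite F] (hF : ringChar F ≠ 2) {d : ℕ}
    [NeZero d] (hd : d.Coprime (Nat.card F)) :
    ∃ (L : ℤ[X]) (R : Finset (ZMod d)) (j : ZMod d → ℂ),
      (L : PowerSeries ℤ) = lFunction (legendreCurve F d) ∧
      L.map (Int.castRingHom ℂ) =
        ∏ r ∈ R, (1 - C (j r) * X ^ Function.minimalPeriod (mulMap d (Nat.card F)) r) ∧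
      (∀ r ∈ R, ‖j r‖ = (Nat.card F : ℝ) ^ Function.minimalPeriod (mulMap d (Nat.card F)) r) ∧
      ∀ g : ZMod d → ℝ, (∀ m, g (mulMap d (Nat.card F) m) = g m) →
        ∑ m : ZMod d with 2 * m ≠ 0, g m =
          ∑ r ∈ R, Function.minimalPeriod (mulMap d (Nat.card F)) r • g r := by
  set f := mulMap d (Nat.card F) with hf
  have hinj : Function.Injective f := mulMap_injective hd
  have hpos : ∀ m, 0 < Function.minimalPeriod f m := minimalPeriod_mulMap_pos hd
  have hper : ∀ m, Function.minimalPeriod f (f m) = Function.minimalPeriod f m := fun m =>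
    Function.minimalPeriod_apply (hinj.mem_periodicPts m)
  obtain ⟨j, hj, hnorm, hjsum⟩ := exists_jacobi hF hd
  obtain ⟨h0, A, hA0, hA, hL⟩ := logDeriv_lFunction_legendreCurve hF (NeZero.ne d)
  obtain ⟨R, hR, hsum⟩ := exists_orbit_representatives hinj
    (univ.filter fun m : ZMod d => 2 * m ≠ 0) (fun m => by
      have h2 : 2 * f m = f (2 * m) := by simp only [hf, mulMap]; ring
      have h3 : f 0 = 0 := by simp [hf, mulMap]
      rw [mem_filter, mem_filter, h2, ← h3, Ne, hinj.eq_iff, h3]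
      simp)
  set P : ℂ[X] := ∏ r ∈ R, (1 - C (j r) * X ^ Function.minimalPeriod f r) with hP
  have hAn : ∀ n, (A n : ℂ) =
      ∑ r ∈ R, PowerSeries.coeff n (cyclicLogDeriv (j r) (Function.minimalPeriod f r)) := fun n => by
    rcases Nat.eq_zero_or_pos n with rfl | hn
    · simp [hA0, cyclicLogDeriv]
    · obtain ⟨K, _, _, _, hK⟩ := exists_field_finrank_eq F hn
      have h1 := hA K
      have h2 := hjsum K
      rw [hK] at h1 h2
      rw [h1, h2, Finset.sum_congr (Finset.filter_congr (q := fun m : ZMod d => 2 * m ≠ 0 ∧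
        Function.minimalPeriod f m ∣ n) fun m _ => by
          rw [Function.isPeriodicPt_iff_minimalPeriod_dvd, and_comm]) fun _ _ => rfl,
        ← Finset.filter_filter, Finset.sum_filter,
        hsum ℂ (fun m => if Function.minimalPeriod f m ∣ n then
          j m ^ (n / Function.minimalPeriod f m) else 0) (fun m => by rw [hper, hj]),
        ← Finset.sum_neg_distrib]
      refine Finset.sum_congr rfl fun r _ => ?_
      simp only [cyclicLogDeriv, PowerSeries.coeff_mk, hn.ne', ne_eq, not_false_eq_true, true_and]
      split_ifs <;> simp
  have hPL : PowerSeries.map (Int.castRingHom ℂ) (lFunction (legendreCurve F d)) =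
      (P : PowerSeries ℂ) := by
    refine eq_of_logDeriv_eq (A := fun n => (A n : ℂ)) (by simp [hA0]) ?_ (fun n => ?_) fun n => ?_
    · rw [PowerSeries.coeff_map, h0, coeff_coe, hP, coeff_zero_eq_eval_zero, eval_prod]
      symm
      refine Eq.trans (map_one (Int.castRingHom ℂ) ▸ Finset.prod_eq_one fun r _ => ?_) rfl
      simp [(hpos r).ne']
    · have := congrArg (Int.castRingHom ℂ) (hL n)
      simpa using this
    · have h1 := X_mul_derivative_prod R
        (E := fun r => ((1 - C (j r) * X ^ Function.minimalPeriod f r : ℂ[X]) : PowerSeries ℂ))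
        (H := fun r => cyclicLogDeriv (j r) (Function.minimalPeriod f r))
        fun r _ => X_mul_derivative_one_sub (j r) (hpos r)
      have h2 : (P : PowerSeries ℂ) =
          ∏ r ∈ R, ((1 - C (j r) * X ^ Function.minimalPeriod f r : ℂ[X]) : PowerSeries ℂ) := by
        rw [hP]
        exact map_prod (Polynomial.coeToPowerSeries.ringHom) _ _
      rw [← h2] at h1
      have h3 := congrArg (PowerSeries.coeff n) h1
      rw [coeff_X_mul_derivative, PowerSeries.coeff_mul] at h3
      simpa only [hAn, map_sum] using h3
  have hcoeff : ∀ n, ((PowerSeries.coeff n (lFunction (legendreCurve F d)) : ℤ) : ℂ) =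
      P.coeff n := fun n => by
    have := congrArg (PowerSeries.coeff n) hPL
    simpa using this
  -- The integral series becomes the polynomial `P` over `ℂ`, so its own coefficients vanish beyond
  -- `P.natDegree`.
  have htrunc : ((PowerSeries.trunc (P.natDegree + 1) (lFunction (legendreCurve F d)) : ℤ[X]) :
      PowerSeries ℤ) = lFunction (legendreCurve F d) := by
    ext n
    rw [coeff_coe, PowerSeries.coeff_trunc]
    split_ifs with h
    · rfl
    · have h1 := hcoeff n
      rw [coeff_eq_zero_of_natDegree_lt (by omega)] at h1
      exact_mod_cast h1.symm
  refine ⟨_, R, j, htrunc, ?_, fun r hr => hnorm r (mem_filter.1 (hR hr)).2, hsum ℝ⟩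
  ext n
  rw [coeff_map, ← hcoeff, ← htrunc, coeff_coe]
  simp

end ProductFormula
end RatFuncEC

namespace RatFuncEC

open Finset Polynomial

/-! ### Positivity and upper bound for the special value -/

section SpecialValue

/-- Nonvanishing of both cofactors at `a` forces the exponents of `ℓ` to agree. It lets `1 - q T` be
removed factor by factor. -/
theorem eval_eq_of_pow_mul_eq {K : Type*} [Field K] {a : K} {ℓ G H : K[X]} (hℓ : ℓ ≠ 0)
    (ha : ℓ.eval a = 0) {m n : ℕ} (h : ℓ ^ m * G = ℓ ^ n * H) (hG : G.eval a ≠ 0)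
    (hH : H.eval a ≠ 0) : G.eval a = H.eval a := by
  wlog hmn : m ≤ n generalizing m n G H
  · exact (this h.symm hH hG (not_le.1 hmn).le).symm
  obtain ⟨k, rfl⟩ := Nat.exists_eq_add_of_le hmn
  rw [pow_add, mul_assoc] at h
  have h1 := mul_left_cancel₀ (pow_ne_zero m hℓ) h
  rcases Nat.eq_zero_or_pos k with rfl | hk
  · rw [h1, pow_zero, one_mul]
  · rw [h1, eval_mul, eval_pow, ha, zero_pow hk.ne', zero_mul] at hG
    exact absurd rfl hG

theorem exists_eq_pow_mul {q : ℕ} (hq : q ≠ 0) {P : ℝ[X]} (hP : P ≠ 0) :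
    ∃ G : ℝ[X], P = (1 - C (q : ℝ) * X) ^ P.rootMultiplicity (q : ℝ)⁻¹ * G ∧
      G.eval (q : ℝ)⁻¹ ≠ 0 := by
  have hq' : (q : ℝ) ≠ 0 := Nat.cast_ne_zero.2 hq
  obtain ⟨Q, hQ, hQ'⟩ := exists_eq_pow_rootMultiplicity_mul_and_not_dvd P hP (q : ℝ)⁻¹
  set n := P.rootMultiplicity (q : ℝ)⁻¹
  have h1 : (X - C (q : ℝ)⁻¹ : ℝ[X]) = C (-(q : ℝ)⁻¹) * (1 - C (q : ℝ) * X) := by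
    rw [mul_sub, mul_one, ← mul_assoc, ← C_mul, neg_mul, inv_mul_cancel₀ hq']
    simp only [map_neg, map_one]
    ring
  refine ⟨C (-(q : ℝ)⁻¹) ^ n * Q, ?_, ?_⟩
  · conv_lhs => rw [hQ, h1, mul_pow]
    ring
  · rw [eval_mul, eval_pow, eval_C]
    refine mul_ne_zero (pow_ne_zero _ (neg_ne_zero.2 (inv_ne_zero hq'))) fun h => ?_
    exact hQ' (dvd_iff_isRoot.2 h)

/-- If `c = q ^ u`, the cofactor of `1 - q T` is a geometric sum with value `u` at `1 / q`;
otherwise nothing is removed and the value `1 - c / q ^ u` is nonzero of absolute value at most `2`.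
-/
theorem exists_factor_one_sub {q : ℕ} (hq : q ≠ 0) {u : ℕ} (hu : 0 < u) {c : ℂ}
    (hc : ‖c‖ = (q : ℝ) ^ u) :
    ∃ (n : ℕ) (H : ℂ[X]), (1 - C c * X ^ u : ℂ[X]) = (1 - C (q : ℂ) * X) ^ n * H ∧
      H.eval (q : ℂ)⁻¹ ≠ 0 ∧ ‖H.eval (q : ℂ)⁻¹‖ ≤ max 2 (u : ℝ) := by
  have hq' : (q : ℂ) ≠ 0 := Nat.cast_ne_zero.2 hq
  by_cases h : c = (q : ℂ) ^ u
  · refine ⟨1, ∑ i ∈ range u, (C (q : ℂ) * X) ^ i, ?_, ?_⟩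
    · rw [pow_one, mul_neg_geom_sum, mul_pow, h, C_pow]
    · have h1 : (∑ i ∈ range u, (C (q : ℂ) * X) ^ i : ℂ[X]).eval (q : ℂ)⁻¹ = u := by
        rw [eval_finsetSum]
        simp [hq']
      rw [h1]
      refine ⟨Nat.cast_ne_zero.2 hu.ne', ?_⟩
      rw [Complex.norm_natCast]
      exact le_max_right _ _
  · refine ⟨0, 1 - C c * X ^ u, by rw [pow_zero, one_mul], ?_⟩
    have h1 : (1 - C c * X ^ u : ℂ[X]).eval (q : ℂ)⁻¹ = 1 - c * (q : ℂ)⁻¹ ^ u := by simp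
    rw [h1]
    constructor
    · intro h2
      refine h ?_
      rw [inv_pow] at h2
      exact ((mul_inv_eq_one₀ (pow_ne_zero u hq')).1 (sub_eq_zero.1 h2).symm)
    · refine (norm_sub_le _ _).trans (le_trans (le_of_eq ?_) (le_max_left _ _))
      rw [norm_one, norm_mul, hc, norm_pow, norm_inv, Complex.norm_natCast, inv_pow,
        mul_inv_cancel₀ (pow_ne_zero u (Nat.cast_ne_zero.2 hq))]
      norm_num

theorem eval_ne_zero_of_norm_lt {ι : Type*} {R : Finset ι} {u : ι → ℕ} (hu : ∀ r ∈ R, 0 < u r)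
    {j : ι → ℂ} {q : ℕ} (hq : q ≠ 0) (hj : ∀ r ∈ R, ‖j r‖ = (q : ℝ) ^ u r) {x : ℝ} (hx0 : 0 ≤ x)
    (hx : x < (q : ℝ)⁻¹) :
    (∏ r ∈ R, (1 - C (j r) * X ^ u r)).eval (x : ℂ) ≠ 0 := by
  rw [eval_prod]
  refine Finset.prod_ne_zero_iff.2 fun r hr h => ?_
  simp only [eval_sub, eval_one, eval_mul, eval_C, eval_pow, eval_X] at h
  have h1 := congrArg norm (sub_eq_zero.1 h)
  rw [norm_one, norm_mul, hj r hr, norm_pow, Complex.norm_real, Real.norm_of_nonneg hx0,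
    ← mul_pow] at h1
  have hqpos : 0 < (q : ℝ) := Nat.cast_pos.2 (Nat.pos_of_ne_zero hq)
  have h2 : (q : ℝ) * x < 1 := by
    rwa [inv_eq_one_div, lt_div_iff₀' hqpos] at hx
  exact absurd h1.symm (pow_lt_one₀ (by positivity) h2 (hu r hr).ne').ne

/-- The special value of a polynomial whose inverse roots are, up to roots of order `u`, of absolute
value `q`. -/
theorem specialValue_pos_and_le {ι : Type*} {R : Finset ι} {u : ι → ℕ} (hu : ∀ r ∈ R, 0 < u r)
    {j : ι → ℂ} {q : ℕ} (hq : q ≠ 0) (hj : ∀ r ∈ R, ‖j r‖ = (q : ℝ) ^ u r) {L : ℤ[X]}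
    (hL : L.map (Int.castRingHom ℂ) = ∏ r ∈ R, (1 - C (j r) * X ^ u r)) :
    0 < specialValue q L ∧ specialValue q L ≤ ∏ r ∈ R, max 2 (u r : ℝ) := by
  set P : ℝ[X] := L.map (Int.castRingHom ℝ) with hP
  have hPC : P.map Complex.ofRealHom = ∏ r ∈ R, (1 - C (j r) * X ^ u r) := by
    rw [← hL, hP, Polynomial.map_map]
    congr 1
  have hq' : (q : ℝ) ≠ 0 := Nat.cast_ne_zero.2 hq
  have heval : ∀ x : ℝ, ((P.eval x : ℝ) : ℂ) = (∏ r ∈ R, (1 - C (j r) * X ^ u r)).eval (x : ℂ) :=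
    fun x => by
      rw [← hPC]
      exact (eval_map_apply (f := Complex.ofRealHom) (p := P) (x := x)).symm
  have hP0 : P.eval 0 = 1 := by
    have h1 := heval 0
    rw [eval_prod, Finset.prod_eq_one fun r hr => by simp [(hu r hr).ne']] at h1
    exact_mod_cast h1
  have hPne : P ≠ 0 := by
    rintro h
    simp [h] at hP0
  obtain ⟨G, hG, hGa⟩ := exists_eq_pow_mul hq hPne
  set ρ := P.rootMultiplicity (q : ℝ)⁻¹ with hρ
  have hℓ : (1 - C (q : ℝ) * X : ℝ[X]) ≠ 0 := fun h => by
    simpa using congrArg (eval 0) h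
  have hval : specialValue q L = G.eval (q : ℝ)⁻¹ := by
    have h1 : P / (1 - C (q : ℝ) * X) ^ ρ = G := by
      conv_lhs => rw [hG]
      exact mul_div_cancel_left₀ G (pow_ne_zero ρ hℓ)
    change (P / (1 - C (q : ℝ) * X) ^ ρ).eval (q : ℝ)⁻¹ = _
    rw [h1]
  have hqpos : 0 < (q : ℝ) := Nat.cast_pos.2 (Nat.pos_of_ne_zero hq)
  -- Since `G` is `1` at `0`, a nonpositive value at `1 / q` would give a zero of `G` in `[0, 1 /
  -- q]`. None lies below `1 / q` by the size of the `j r`, and `1 / q` itself is excluded by the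
  -- choice of `G`.
  have hGpos : 0 < G.eval (q : ℝ)⁻¹ := by
    by_contra hneg
    have hG0 : G.eval 0 = 1 := by
      have h1 := hP0
      rw [hG] at h1
      simpa using h1
    obtain ⟨x, hx, hx0⟩ := intermediate_value_Icc' (f := fun x => G.eval x)
      (inv_pos.2 hqpos).le G.continuous.continuousOn
      (show (0 : ℝ) ∈ Set.Icc (G.eval (q : ℝ)⁻¹) (G.eval 0) from
        ⟨not_lt.1 hneg, by rw [hG0]; exact zero_le_one⟩)
    rcases hx.2.lt_or_eq with h | h
    · refine eval_ne_zero_of_norm_lt hu hq hj hx.1 h ?_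
      rw [← heval, hG, eval_mul, show G.eval x = 0 from hx0, mul_zero, Complex.ofReal_zero]
    · exact hGa (h ▸ hx0)
  refine ⟨hval ▸ hGpos, ?_⟩
  have hfac : ∀ r, ∃ (n : ℕ) (H : ℂ[X]), r ∈ R →
      (1 - C (j r) * X ^ u r : ℂ[X]) = (1 - C (q : ℂ) * X) ^ n * H ∧
        H.eval (q : ℂ)⁻¹ ≠ 0 ∧ ‖H.eval (q : ℂ)⁻¹‖ ≤ max 2 (u r : ℝ) := fun r => by
    by_cases hr : r ∈ R
    · obtain ⟨n, H, h⟩ := exists_factor_one_sub hq (hu r hr) (hj r hr)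
      exact ⟨n, H, fun _ => h⟩
    · exact ⟨0, 0, fun h => absurd h hr⟩
  choose n H hH using hfac
  have hℓC : (1 - C (q : ℂ) * X : ℂ[X]) ≠ 0 := fun h => by
    simpa using congrArg (eval 0) h
  have hℓa : (1 - C (q : ℂ) * X : ℂ[X]).eval (q : ℂ)⁻¹ = 0 := by
    simp [Nat.cast_ne_zero.2 hq]
  have hGC : (G.map Complex.ofRealHom).eval (q : ℂ)⁻¹ = ((G.eval (q : ℝ)⁻¹ : ℝ) : ℂ) := by
    have := eval_map_apply (f := Complex.ofRealHom) (p := G) (x := (q : ℝ)⁻¹)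
    simpa using this
  have hmain : (1 - C (q : ℂ) * X : ℂ[X]) ^ ρ * G.map Complex.ofRealHom =
      (1 - C (q : ℂ) * X) ^ (∑ r ∈ R, n r) * ∏ r ∈ R, H r := by
    rw [← Finset.prod_pow_eq_pow_sum, ← Finset.prod_mul_distrib,
      ← Finset.prod_congr rfl fun r hr => (hH r hr).1, ← hPC]
    conv_rhs => rw [hG]
    simp
  have hkey := eval_eq_of_pow_mul_eq hℓC hℓa hmain
    (by rw [hGC]; exact_mod_cast hGa)
    (by rw [eval_prod]; exact Finset.prod_ne_zero_iff.2 fun r hr => (hH r hr).2.1)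
  rw [hval, ← Real.norm_of_nonneg hGpos.le, ← Complex.norm_real, ← hGC, hkey, eval_prod, norm_prod]
  exact Finset.prod_le_prod (fun _ _ => norm_nonneg _) fun r hr => (hH r hr).2.2

theorem log_specialValue_le {ι : Type*} {R : Finset ι} {u : ι → ℕ} (hu : ∀ r ∈ R, 0 < u r)
    {j : ι → ℂ} {q : ℕ} (hq : q ≠ 0) (hj : ∀ r ∈ R, ‖j r‖ = (q : ℝ) ^ u r) {L : ℤ[X]}
    (hL : L.map (Int.castRingHom ℂ) = ∏ r ∈ R, (1 - C (j r) * X ^ u r)) :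
    Real.log (specialValue q L) ≤ ∑ r ∈ R, Real.log (max 2 (u r : ℝ)) := by
  obtain ⟨h1, h2⟩ := specialValue_pos_and_le hu hq hj hL
  refine (Real.log_le_log h1 h2).trans (le_of_eq (Real.log_prod fun r _ => ?_))
  positivity

end SpecialValue
end RatFuncEC

namespace RatFuncEC

open Finset Real

/-! ### Estimating the sum over orbit lengths -/

section Numerics

theorem log_max_two_div_nonneg (u : ℕ) : 0 ≤ log (max 2 (u : ℝ)) / u :=
  div_nonneg (log_nonneg (le_max_of_le_left one_le_two)) (Nat.cast_nonneg u)

theorem log_max_two_div_le {u : ℕ} (hu : 0 < u) : log (max 2 (u : ℝ)) / u ≤ log 2 := by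
  have hu' : (0 : ℝ) < u := Nat.cast_pos.2 hu
  rw [div_le_iff₀ hu', mul_comm, ← log_pow]
  refine log_le_log (by positivity) (max_le ?_ ?_)
  · calc (2 : ℝ) = 2 ^ 1 := (pow_one _).symm
      _ ≤ 2 ^ u := pow_le_pow_right₀ one_le_two hu
  · exact_mod_cast Nat.lt_two_pow_self.le

/-- Period `u` means `(q ^ u - 1) m = 0`, which has at most `q ^ u` solutions modulo `d`. -/
theorem card_le_of_minimalPeriod_le {d q : ℕ} [NeZero d] (hd : d.Coprime q) (hq : 2 ≤ q) (U : ℕ) :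
    #{m : ZMod d | Function.minimalPeriod (mulMap d q) m ≤ U} ≤ U * q ^ U := by
  classical
  have h1 : (univ.filter fun m : ZMod d => Function.minimalPeriod (mulMap d q) m ≤ U) ⊆
      (Icc 1 U).biUnion fun u => univ.filter fun m : ZMod d => m ∈
        (nsmulAddMonoidHom (q ^ u - 1) : ZMod d →+ ZMod d).ker := fun m hm => by
    refine mem_biUnion.2 ⟨_, mem_Icc.2 ⟨minimalPeriod_mulMap_pos hd m, (mem_filter.1 hm).2⟩,
      mem_filter.2 ⟨mem_univ _, ?_⟩⟩
    have h2 := Function.iterate_minimalPeriod (f := mulMap d q) (x := m)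
    rw [mulMap_iterate] at h2
    rw [AddMonoidHom.mem_ker, nsmulAddMonoidHom_apply, nsmul_eq_mul,
      Nat.cast_sub (Nat.one_le_pow _ _ (by omega)), Nat.cast_pow, Nat.cast_one, sub_mul, h2, one_mul,
      sub_self]
  refine (card_le_card h1).trans (card_biUnion_le.trans ?_)
  calc ∑ u ∈ Icc 1 U, #{m : ZMod d | m ∈ (nsmulAddMonoidHom (q ^ u - 1) : ZMod d →+ ZMod d).ker}
      ≤ ∑ u ∈ Icc 1 U, q ^ U := Finset.sum_le_sum fun u hu => by
        obtain ⟨hu1, hu2⟩ := mem_Icc.1 hu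
        have h3 := IsAddCyclic.card_nsmulAddMonoidHom_ker (G := ZMod d) (q ^ u - 1)
        rw [← Fintype.card_subtype, ← Nat.card_eq_fintype_card]
        have hpos : 0 < q ^ u - 1 := Nat.sub_pos_of_lt (Nat.one_lt_pow (by omega) (by omega))
        calc _ = _ := h3
          _ ≤ q ^ u - 1 := Nat.gcd_le_right _ hpos
          _ ≤ q ^ u := Nat.sub_le _ _
          _ ≤ q ^ U := Nat.pow_le_pow_right (by omega) hu2
    _ = U * q ^ U := by simp

/-- The right side is concave in `x`, so the two endpoints suffice. At `log 3` the margin is thin,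
and `log y ≥ 1 - 1 / y` is just enough. -/
theorem mul_log_two_le {x : ℝ} (h1 : log 3 ≤ x) (h2 : x ≤ 40) : x * log 2 ≤ 8 * log 3 * log x := by
  have h3 := log_three_gt_d9
  have h4 := log_two_lt_d9
  have h4' := log_two_gt_d9
  have h5 : log 2 ≤ 8 * log (log 3) := by
    have := one_sub_inv_le_log_of_pos (show 0 < log 3 by linarith)
    have h6 : (log 3)⁻¹ ≤ (1.0986122885 : ℝ)⁻¹ := inv_anti₀ (by norm_num) h3.le
    norm_num at h6
    linarith
  have h6 : 5 * log 2 ≤ log 40 := by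
    rw [show (5 : ℝ) * log 2 = log (2 ^ 5) by rw [log_pow]; norm_num]
    exact log_le_log (by norm_num) (by norm_num)
  have h7 : 40 * log 2 ≤ 8 * log 3 * log 40 := by nlinarith
  obtain ⟨a, b, ha, hb, hab, rfl⟩ := (Convex.mem_Icc (h1.trans h2)).1 ⟨h1, h2⟩
  have h8 := strictConcaveOn_log_Ioi.concaveOn.2 (show log 3 ∈ Set.Ioi (0 : ℝ) by
    rw [Set.mem_Ioi]; linarith) (show (40 : ℝ) ∈ Set.Ioi (0 : ℝ) by norm_num) ha hb hab
  simp only [smul_eq_mul] at h8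
  have h9 : log 3 * log 2 ≤ 8 * log 3 * log (log 3) := by nlinarith
  have h10 : 8 * log 3 * (a * log (log 3) + b * log 40) ≤ 8 * log 3 * log (a * log 3 + b * 40) :=
    mul_le_mul_of_nonneg_left h8 (by linarith)
  nlinarith

theorem sum_log_max_two_div_le {d q : ℕ} [NeZero d] (hd : d.Coprime q) (hq : 3 ≤ q) (hd3 : 3 ≤ d) :
    ∑ m : ZMod d, log (max 2 (Function.minimalPeriod (mulMap d q) m : ℝ)) /
        Function.minimalPeriod (mulMap d q) m ≤
      8 * (d * log q) * (log (log d) / log d) := by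
  set ℓ := log d with hℓ
  set L := log q with hL
  have hdpos : (0 : ℝ) < d := by positivity
  have hd3' : (3 : ℝ) ≤ d := by exact_mod_cast hd3
  have hq3' : (3 : ℝ) ≤ q := by exact_mod_cast hq
  have hℓ3 : log 3 ≤ ℓ := log_le_log (by norm_num) hd3'
  have hL3 : log 3 ≤ L := log_le_log (by norm_num) hq3'
  have h3 := log_three_gt_d9
  have hℓpos : 0 < ℓ := by linarith
  have hlog2 := log_two_lt_d9
  have hlogℓ : 0 ≤ log ℓ := log_nonneg (by linarith)
  have hpos := minimalPeriod_mulMap_pos hd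
  -- The trivial bound `log 2` per class suffices when `d` is small in absolute terms or relative to
  -- a power of `q`.
  have htriv : ℓ * log 2 ≤ 8 * L * log ℓ →
      ∑ m : ZMod d, log (max 2 (Function.minimalPeriod (mulMap d q) m : ℝ)) /
        Function.minimalPeriod (mulMap d q) m ≤ 8 * (d * L) * (log ℓ / ℓ) := fun h => by
    calc _ ≤ ∑ _m : ZMod d, log 2 := Finset.sum_le_sum fun m _ => log_max_two_div_le (hpos m)
      _ = d * log 2 := by rw [Finset.sum_const, card_univ, ZMod.card, nsmul_eq_mul]
      _ ≤ 8 * (d * L) * (log ℓ / ℓ) := by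
        rw [mul_div_assoc', le_div_iff₀ hℓpos]
        nlinarith
  by_cases h40 : ℓ ≤ 40
  · exact htriv ((mul_log_two_le hℓ3 h40).trans (by gcongr))
  rw [not_le] at h40
  have hlogℓ1 : 1 ≤ log ℓ := by
    rw [le_log_iff_exp_le hℓpos]
    exact exp_one_lt_d9.le.trans (by linarith)
  by_cases h6 : ℓ < 6 * L
  · exact htriv (by nlinarith)
  rw [not_lt] at h6
  -- This cutoff makes `q ^ U = √d`. The excluded case `ℓ < 6 L` ensures `U ≥ 3 > e`, so that `log u
  -- / u` is decreasing beyond `U`.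
  set U := ℓ / (2 * L) with hU
  have hLpos : 0 < L := by linarith
  have hU3 : 3 ≤ U := by
    rw [hU, le_div_iff₀ (by linarith)]
    linarith
  -- Long periods cost at most `log U / U ≤ 2 L log ℓ / ℓ` and short ones at most `1`; in total the
  -- long ones account for `2` and the short ones for `6` of the constant `8`.
  have hterm : ∀ m : ZMod d, log (max 2 (Function.minimalPeriod (mulMap d q) m : ℝ)) /
      Function.minimalPeriod (mulMap d q) m ≤
        2 * L * (log ℓ / ℓ) + if Function.minimalPeriod (mulMap d q) m ≤ ⌊U⌋₊ then 1 else 0 :=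
    fun m => by
      set u := Function.minimalPeriod (mulMap d q) m with hu
      split_ifs with h
      · have := log_max_two_div_le (hpos m)
        have h7 : 0 ≤ 2 * L * (log ℓ / ℓ) := by positivity
        rw [← hu] at this
        linarith
      · rw [Nat.not_le, Nat.floor_lt (by linarith)] at h
        have he : exp 1 ≤ U := exp_one_lt_d9.le.trans (by linarith)
        rw [max_eq_right (by linarith), add_zero]
        refine (log_div_self_antitoneOn he (he.trans h.le) h.le).trans ?_
        have h8 : log U ≤ log ℓ := by
          refine log_le_log (by linarith) ?_
          rw [hU]
          exact div_le_self hℓpos.le (by linarith)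
        have h9 : log U / U = 2 * L * (log U / ℓ) := by
          rw [hU]
          field_simp
        simp only [h9]
        gcongr
  have hcard : (#{m : ZMod d | Function.minimalPeriod (mulMap d q) m ≤ ⌊U⌋₊} : ℝ) ≤
      6 * (d * L) * (log ℓ / ℓ) := by
    have h7 : (#{m : ZMod d | Function.minimalPeriod (mulMap d q) m ≤ ⌊U⌋₊} : ℝ) ≤
        ⌊U⌋₊ * (q : ℝ) ^ ⌊U⌋₊ := by
      exact_mod_cast card_le_of_minimalPeriod_le hd (by omega) ⌊U⌋₊
    have hqpos : (0 : ℝ) < q := by linarith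
    have hfl : (⌊U⌋₊ : ℝ) ≤ U := Nat.floor_le (by linarith)
    have h8 : (q : ℝ) ^ ⌊U⌋₊ ≤ exp (ℓ / 2) := by
      rw [← exp_log (pow_pos hqpos _), log_pow, exp_le_exp]
      calc (⌊U⌋₊ : ℝ) * L ≤ U * L := by gcongr
        _ = ℓ / 2 := by rw [hU]; field_simp
    have h9 : (d : ℝ) = exp (ℓ / 2) * exp (ℓ / 2) := by
      rw [← exp_add, add_halves, hℓ, exp_log hdpos]
    -- Of `d = √d · √d`, one factor absorbs `q ^ U` and the other dominates the remaining polynomial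
    -- factor `U ℓ ≤ ℓ ^ 2 / 2`.
    have h10 : ℓ ^ 2 / 8 ≤ exp (ℓ / 2) := by
      have := quadratic_le_exp_of_nonneg (show 0 ≤ ℓ / 2 by linarith)
      nlinarith
    have h11 : U * ℓ ≤ 6 * (exp (ℓ / 2) * L) * log ℓ := by
      have h12 : U ≤ ℓ / 2 := by
        rw [hU]
        exact div_le_div_of_nonneg_left hℓpos.le two_pos (by linarith)
      have h13 : exp (ℓ / 2) * 1 ≤ exp (ℓ / 2) * (L * log ℓ) := by
        gcongr
        nlinarith
      nlinarith
    calc _ ≤ (⌊U⌋₊ : ℝ) * (q : ℝ) ^ ⌊U⌋₊ := h7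
      _ ≤ U * exp (ℓ / 2) := by gcongr
      _ ≤ 6 * (d * L) * (log ℓ / ℓ) := by
        rw [mul_div_assoc', le_div_iff₀ hℓpos, h9]
        nlinarith [exp_pos (ℓ / 2)]
  calc _ ≤ ∑ m : ZMod d, (2 * L * (log ℓ / ℓ) +
        if Function.minimalPeriod (mulMap d q) m ≤ ⌊U⌋₊ then 1 else 0) :=
        Finset.sum_le_sum fun m _ => hterm m
    _ = d * (2 * L * (log ℓ / ℓ)) +
        #{m : ZMod d | Function.minimalPeriod (mulMap d q) m ≤ ⌊U⌋₊} := by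
        rw [Finset.sum_add_distrib, Finset.sum_const, card_univ, ZMod.card, nsmul_eq_mul,
          Finset.sum_boole]
    _ ≤ 8 * (d * L) * (log ℓ / ℓ) := by linarith

end Numerics
end RatFuncEC

/-! ### The main theorem -/

theorem mainTheorem4 :
    ∃ A : ℝ, 0 < A ∧ A ≤ 48 ∧
      ∀ (F : Type*) [Field F] [Finite F], ringChar F ≠ 2 →
      ∀ d : ℕ, 3 ≤ d → d.Coprime (Nat.card F) →
      ∃ L : Polynomial ℤ,
        (L : PowerSeries ℤ) = RatFuncEC.lFunction (RatFuncEC.legendreCurve F d) ∧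
        0 < RatFuncEC.specialValue (Nat.card F) L ∧
        Real.log (RatFuncEC.specialValue (Nat.card F) L) /
            Real.log (RatFuncEC.height (RatFuncEC.legendreCurve F d)) ≤
          A * (Real.log (Real.log d) / Real.log d) := by
  refine ⟨48, by norm_num, le_rfl, fun F _ _ hF d hd3 hd => ?_⟩
  have : NeZero d := ⟨by omega⟩
  have hq : 3 ≤ Nat.card F := by
    have := Fintype.ofFinite F
    have h1 := FiniteField.odd_card_of_char_ne_two hF
    have h2 : 1 < Nat.card F := Finite.one_lt_card
    rw [← Nat.card_eq_fintype_card] at h1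
    omega
  have hq0 : Nat.card F ≠ 0 := by omega
  obtain ⟨L, R, j, hL, hprod, hj, hsum⟩ := RatFuncEC.exists_polynomial_lFunction hF hd
  have hpos := RatFuncEC.minimalPeriod_mulMap_pos hd
  refine ⟨L, hL,
    (RatFuncEC.specialValue_pos_and_le (fun r _ => hpos r) hq0 hj hprod).1, ?_⟩
  set f := RatFuncEC.mulMap d (Nat.card F) with hf
  have h1 := RatFuncEC.log_specialValue_le (fun r _ => hpos r) hq0 hj hprod
  -- The summand is constant on orbits; dividing by the orbit length turns the sum over
  -- representatives into one over classes, which can then be enlarged to all of `ZMod d`.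
  have h2 := hsum
    (fun m => Real.log (max 2 (Function.minimalPeriod f m : ℝ)) / Function.minimalPeriod f m)
    fun m => by
      rw [Function.minimalPeriod_apply ((RatFuncEC.mulMap_injective hd).mem_periodicPts m)]
  have h3 : ∑ r ∈ R, Real.log (max 2 (Function.minimalPeriod f r : ℝ)) =
      ∑ r ∈ R, Function.minimalPeriod f r •
        (Real.log (max 2 (Function.minimalPeriod f r : ℝ)) / Function.minimalPeriod f r) :=
    Finset.sum_congr rfl fun r _ => by
      rw [nsmul_eq_mul, mul_div_cancel₀ _ (Nat.cast_ne_zero.2 (hpos r).ne')]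
  have h4 := RatFuncEC.sum_log_max_two_div_le hd hq hd3
  have h5 := RatFuncEC.mul_log_le_log_height (F := F) hF (show d ≠ 0 by omega)
  have hlogq : 0 < Real.log (Nat.card F) := Real.log_pos (by exact_mod_cast (by omega : 1 < Nat.card F))
  have hlogd : 1 ≤ Real.log d := by
    have h6 := Real.log_three_gt_d9
    have h7 : Real.log 3 ≤ Real.log d := Real.log_le_log (by norm_num) (by exact_mod_cast hd3)
    linarith
  have hB : 0 ≤ Real.log (Real.log d) / Real.log d :=
    div_nonneg (Real.log_nonneg hlogd) (by linarith)
  have hdpos : (0 : ℝ) < d := by positivity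
  have hH : 0 < Real.log (RatFuncEC.height (RatFuncEC.legendreCurve F d)) :=
    lt_of_lt_of_le (by positivity) h5
  rw [div_le_iff₀ hH]
  calc Real.log (RatFuncEC.specialValue (Nat.card F) L)
      ≤ ∑ m : ZMod d with 2 * m ≠ 0,
          Real.log (max 2 (Function.minimalPeriod f m : ℝ)) / Function.minimalPeriod f m := by
        rw [h2, ← h3]
        exact h1
    _ ≤ ∑ m : ZMod d,
          Real.log (max 2 (Function.minimalPeriod f m : ℝ)) / Function.minimalPeriod f m :=
        Finset.sum_le_sum_of_subset_of_nonneg (Finset.filter_subset _ _)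
          fun m _ _ => RatFuncEC.log_max_two_div_nonneg _
    _ ≤ 8 * (d * Real.log (Nat.card F)) * (Real.log (Real.log d) / Real.log d) := h4
    _ = 48 * (Real.log (Real.log d) / Real.log d) * (d / 6 * Real.log (Nat.card F)) := by ring
    _ ≤ 48 * (Real.log (Real.log d) / Real.log d) *
          Real.log (RatFuncEC.height (RatFuncEC.legendreCurve F d)) :=
        mul_le_mul_of_nonneg_left h5 (by positivity)
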